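/- For initial data $(r_0,w_0,U_0)\in\mathbb R^3$ with $r_0>0$ put $E_0=1+2U_0^2-\frac{(1-w_0^2)^2}{r_0^2}$, and let $$\mathscr I_0=\{(r_0,w_0,U_0)\in\mathbb R^3 \mid r_0>0,\ |w_0|\le 1,\ E_0\ge 0\}.$$ For $(r_0,w_0,U_0)\in\mathscr I_0$, the corresponding orbit is the maximal forward solution $(r,N,w,U,\kappa,\zeta)$, $r>0$, on an interval $0\le\rho<\rho_{\max}\le\infty$, of $$\dot r=rN,\quad \dot N=1-\tfrac{(1-w^2)^2}{r^2}-\kappa N,\quad \dot w=rU,\quad \dot U=-(\kappa-N)U-\tfrac{w(1-w^2)}{r},\quad \dot\kappa=1+2U^2-\kappa^2,\quad \dot\zeta=-\kappa\zeta,$$ with $r(0)=r_0$, $N(0)=0$, $w(0)=w_0$, $U(0)=U_0$, $\kappa(0)=0$, $\zeta(0)=\sqrt{E_0}$. An orbit is singular if $\rho_{\max}<\infty$ and $r\to0$, $N\to-\infty$ as $\rho\to\rho_{\max}$. For $n\ge0$ define subsets of $\mathscr I_0$ as follows, where zeros of $w$ are always counted for $0<\rho<\rho_{\max}$ only: - $\mathscr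 E_n$: the data of singular orbits for which $|w|>1$ somewhere and $w$ has exactly $n$ zeros; - $\mathscr C_n$: the data of singular orbits for which $|w|\le1$ throughout and $w$ has exactly $n$ zeros; $\mathscr C=\bigcup_{n\ge0}\mathscr C_n$; - $\mathscr O$: the data of orbits with $\rho_{\max}=\infty$ and $(w,\dot w)\to(0,0)$ as $\rho\to\infty$; - $\mathscr R_n$: the data of orbits with $\rho_{\max}=\infty$ and $(|w|,\dot w)\to(1,0)$ as $\rho\to\infty$, for which $w$ has exactly $n$ zeros. For $\mathscr Y\subset\mathscr I_0$ write $\mathscr Y(r_0)=\{(w_0,U_0)\mid(r_0,w_0,U_0)\in\mathscr Y\}$. **Theorem.** Fix $r_0>0$ and let $x_0=(w_0,U_0)\in\mathscr I_0(r_0)$. For $\delta>0$ let $$\mathscr W_\delta=\{(\lambda,U_0)\in\mathscr I_0(r_0)\mid|\lambda-w_0|\le\delta\},\qquad \mathscr U_\delta=\{(w_0,\mu)\in\mathscr I_0(r_0)\mid|\mu-U_0|\le\delta\}.$$ (i) Let $Y=\mathscr E_n(r_0)$ for some $n\ge0$, or $Y=\mathscr C(r_0)\setminus\{0\}$. If $x_0\in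 Y$, then $\mathscr U_\delta\subset Y$ for all sufficiently small $\delta>0$; if moreover $w_0\ne0$, then also $\mathscr W_\delta\subset Y$ for all sufficiently small $\delta>0$. (ii) If $x_0\in\mathscr O(r_0)$, then for every $n\ge0$ there is $\delta>0$ such that for every $y_0\in\mathscr I_0(r_0)$ with $0<|y_0-x_0|\le\delta$ the orbit with initial data $(r_0,y_0)$ has at least $n$ zeros of $w$ for $\rho>0$. (iii) If $x_0\in\mathscr R_n(r_0)\setminus\{0\}$ for some $n\ge0$, then $\mathscr U_\delta\subset(\mathscr R_n\cup\mathscr E_n\cup\mathscr E_{n+1})(r_0)$ for all sufficiently small $\delta>0$; if moreover $w_0\ne0$, then also $\mathscr W_\delta\subset(\mathscr R_n\cup\mathscr E_n\cup\mathscr E_{n+1})(r_0)$ for all sufficiently small $\delta>0$. -/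

import Mathlib

open Set Filter Topology

namespace HauntedEYM

/-- The six dependent variables `(r, N, w, U, κ, ζ)` as functions of the independent variable `ρ`.
Only the values on the interval of existence matter. -/
structure PhaseCurve where
  r : ℝ → ℝ
  N : ℝ → ℝ
  w : ℝ → ℝ
  U : ℝ → ℝ
  κ : ℝ → ℝ
  ζ : ℝ → ℝ

/-- The initial energy `E₀ = 1 + 2 U₀² - (1 - w₀²)² / r₀²`. -/
noncomputable def initialEnergy (r0 w0 U0 : ℝ) : ℝ :=
  1 + 2 * U0 ^ 2 - (1 - w0 ^ 2) ^ 2 / r0 ^ 2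

/-- The set of admissible initial data `(r₀, w₀, U₀)`. -/
def admissible : Set (ℝ × ℝ × ℝ) :=
  {p | 0 < p.1 ∧ |p.2.1| ≤ 1 ∧ 0 ≤ initialEnergy p.1 p.2.1 p.2.2}

/-- The slice `Y(r₀)` of a set of initial data. -/
def slice (Y : Set (ℝ × ℝ × ℝ)) (r0 : ℝ) : Set (ℝ × ℝ) :=
  {x | (r0, x.1, x.2) ∈ Y}

/-- `γ` solves the initial value problem with data `p = (r₀, w₀, U₀)` on `[0, T)`, `0 < T ≤ ∞`.
The derivative within `[0, ∞)` is the ordinary derivative at `ρ > 0` and the right derivative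
at `ρ = 0`. -/
structure IsSolution (p : ℝ × ℝ × ℝ) (T : EReal) (γ : PhaseCurve) : Prop where
  pos : 0 < T
  init_r : γ.r 0 = p.1
  init_N : γ.N 0 = 0
  init_w : γ.w 0 = p.2.1
  init_U : γ.U 0 = p.2.2
  init_κ : γ.κ 0 = 0
  init_ζ : γ.ζ 0 = Real.sqrt (initialEnergy p.1 p.2.1 p.2.2)
  r_pos : ∀ ρ : ℝ, 0 ≤ ρ → (ρ : EReal) < T → 0 < γ.r ρ
  eq_r : ∀ ρ : ℝ, 0 ≤ ρ → (ρ : EReal) < T →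
    HasDerivWithinAt γ.r (γ.r ρ * γ.N ρ) (Ici 0) ρ
  eq_N : ∀ ρ : ℝ, 0 ≤ ρ → (ρ : EReal) < T →
    HasDerivWithinAt γ.N (1 - (1 - γ.w ρ ^ 2) ^ 2 / γ.r ρ ^ 2 - γ.κ ρ * γ.N ρ) (Ici 0) ρ
  eq_w : ∀ ρ : ℝ, 0 ≤ ρ → (ρ : EReal) < T →
    HasDerivWithinAt γ.w (γ.r ρ * γ.U ρ) (Ici 0) ρ
  eq_U : ∀ ρ : ℝ, 0 ≤ ρ → (ρ : EReal) < T →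
    HasDerivWithinAt γ.U
      (-(γ.κ ρ - γ.N ρ) * γ.U ρ - γ.w ρ * (1 - γ.w ρ ^ 2) / γ.r ρ) (Ici 0) ρ
  eq_κ : ∀ ρ : ℝ, 0 ≤ ρ → (ρ : EReal) < T →
    HasDerivWithinAt γ.κ (1 + 2 * γ.U ρ ^ 2 - γ.κ ρ ^ 2) (Ici 0) ρ
  eq_ζ : ∀ ρ : ℝ, 0 ≤ ρ → (ρ : EReal) < T →
    HasDerivWithinAt γ.ζ (-γ.κ ρ * γ.ζ ρ) (Ici 0) ρ

/-- `γ` on `[0, T)` is the (maximal forward) orbit with initial data `p`. -/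
def IsOrbit (p : ℝ × ℝ × ℝ) (T : EReal) (γ : PhaseCurve) : Prop :=
  IsSolution p T γ ∧ ∀ (T' : EReal) (γ' : PhaseCurve), IsSolution p T' γ' → T' ≤ T

/-- The number of zeros of `w` for `0 < ρ < T` (possibly infinite). -/
noncomputable def numZeros (T : EReal) (γ : PhaseCurve) : ℕ∞ :=
  {ρ : ℝ | 0 < ρ ∧ (ρ : EReal) < T ∧ γ.w ρ = 0}.encard

/-- `γ` is the orbit with initial data `p`, it ends at the finite point `ρend > 0`, and `r → 0`,
`N → -∞` as `ρ → ρend`. -/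
def IsSingularOrbit (p : ℝ × ℝ × ℝ) (ρend : ℝ) (γ : PhaseCurve) : Prop :=
  IsOrbit p (ρend : EReal) γ ∧
    Tendsto γ.r (𝓝[<] ρend) (𝓝 0) ∧ Tendsto γ.N (𝓝[<] ρend) atBot

/-- Data of escaping singular orbits with exactly `n` zeros of `w` for `ρ > 0`. -/
def escaping (n : ℕ) : Set (ℝ × ℝ × ℝ) :=
  {p | p ∈ admissible ∧ ∃ (ρend : ℝ) (γ : PhaseCurve), IsSingularOrbit p ρend γ ∧
    (∃ ρ : ℝ, 0 ≤ ρ ∧ ρ < ρend ∧ 1 < |γ.w ρ|) ∧ numZeros (ρend : EReal) γ = n}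

/-- Data of crashing singular orbits with exactly `n` zeros of `w` for `ρ > 0`. -/
def crashingN (n : ℕ) : Set (ℝ × ℝ × ℝ) :=
  {p | p ∈ admissible ∧ ∃ (ρend : ℝ) (γ : PhaseCurve), IsSingularOrbit p ρend γ ∧
    (∀ ρ : ℝ, 0 ≤ ρ → ρ < ρend → |γ.w ρ| ≤ 1) ∧ numZeros (ρend : EReal) γ = n}

/-- Data of crashing singular orbits. -/
def crashing : Set (ℝ × ℝ × ℝ) := ⋃ n : ℕ, crashingN n

/-- Data of oscillatory orbits: global, with `(w, w') → (0, 0)`. -/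
def oscillatory : Set (ℝ × ℝ × ℝ) :=
  {p | p ∈ admissible ∧ ∃ γ : PhaseCurve, IsOrbit p ⊤ γ ∧
    Tendsto γ.w atTop (𝓝 0) ∧ Tendsto (deriv γ.w) atTop (𝓝 0)}

/-- Data of regular orbits: global, with `(|w|, w') → (1, 0)` and exactly `n` zeros of `w`
for `ρ > 0`. -/
def regular (n : ℕ) : Set (ℝ × ℝ × ℝ) :=
  {p | p ∈ admissible ∧ ∃ γ : PhaseCurve, IsOrbit p ⊤ γ ∧
    Tendsto (fun ρ => |γ.w ρ|) atTop (𝓝 1) ∧ Tendsto (deriv γ.w) atTop (𝓝 0) ∧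
    numZeros ⊤ γ = n}

/-- Admissible data near `x0` on the line where `U₀` is held fixed. -/
def sliceW (r0 : ℝ) (x0 : ℝ × ℝ) (δ : ℝ) : Set (ℝ × ℝ) :=
  {y | y ∈ slice admissible r0 ∧ y.2 = x0.2 ∧ |y.1 - x0.1| ≤ δ}

/-- Admissible data near `x0` on the line where `w₀` is held fixed. -/
def sliceU (r0 : ℝ) (x0 : ℝ × ℝ) (δ : ℝ) : Set (ℝ × ℝ) :=
  {y | y ∈ slice admissible r0 ∧ y.1 = x0.1 ∧ |y.2 - x0.2| ≤ δ}

/-- For all sufficiently small `δ > 0` the slice in the `U₀`-direction lies in `Y`, and, if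
`w₀ ≠ 0`, so does the slice in the `w₀`-direction. -/
def SlicesEventuallySubset (r0 : ℝ) (x0 : ℝ × ℝ) (Y : Set (ℝ × ℝ)) : Prop :=
  ∃ δ₀ : ℝ, 0 < δ₀ ∧ ∀ δ : ℝ, 0 < δ → δ ≤ δ₀ →
    sliceU r0 x0 δ ⊆ Y ∧ (x0.1 ≠ 0 → sliceW r0 x0 δ ⊆ Y)

end HauntedEYM

namespace HauntedEYM

/-! ### Scalar differential inequalities -/

/-! Solutions depend continuously on the data over compact time intervals
(`IsSolution.exists_near`). Each class is therefore tied to an open condition at one finite time, or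
over one compact interval, which by itself decides what matters about the later orbit. Nearby orbits
inherit the condition.

Collapse. The constraint turns the equation for `N` into `N' = ζ² + κN - N² - 2U²`, with `κ ≥ 0` and
`ζ` nonincreasing. Once `N < -ζ`, this is a Riccati inequality: `N` blows up in finite time, and `r
→ 0` because `-N` would otherwise have to grow both exponentially and at most quadratically in the
variation of `w` (`IsOrbit.singular_of_N_lt`). If instead `N ≥ -ζ` throughout, the orbit is global.

Escaping data. The condition is `|w| > 1` at some time. It persists, and a Lyapunov-type function
shows that it forces `N < -ζ` eventually (`IsOrbit.exists_N_lt_of_one_lt`). No zero of `w` occurs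
afterwards, so the count is settled at that time.

Crashing data. The condition is `CrashTrap`: `N` is very negative, `U` is bounded, and `r` is too
small for `w` to reach `±1` before the collapse. Inside the trap the friction `κ - N` beats the
force, which also allows only finitely many zeros (`mem_crashing_of_trap`).

Oscillatory data. In the limit `w'' = (2N - κ)w' - w(1 - w²)` is an underdamped linear oscillator,
whatever `N ∈ [0, 1]` does. The phase angle of `(w, w')` turns at a definite rate, so a long enough
time interval contains any prescribed number of zeros, for nearby orbits too (`oscillatory_nearby`).

Regular data. After a reflection `w → 1`, and the condition is `FlatTrap`, where `r` is large and
`N, κ` are close to `1`. From there only three fates are possible: `w` increases to `1`, it passes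
`1` and escapes, or it turns back. In the last case anti-friction drives it past `-1` with exactly
one more zero (`FlatTrap.trichotomy`).

Zero counts up to the chosen time are stable because zeros are simple: `w = U = 0` at any time would
force zero data by uniqueness. Since only zeros at positive times count, a zero at time `0` must not
move into the counted range. This is why `w₀ = 0` must be kept fixed whenever it holds, and why the
slices in the `w₀`-direction need `w₀ ≠ 0`. -/

theorem continuousOn_of_hasDerivWithinAt_Ici {f f' : ℝ → ℝ} {a b : ℝ} (ha : 0 ≤ a)
    (hd : ∀ t ∈ Icc a b, HasDerivWithinAt f (f' t) (Ici 0) t) : ContinuousOn f (Icc a b) :=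
  fun t ht => (hd t ht).continuousWithinAt.mono fun _ hs => ha.trans hs.1

theorem le_of_hasDerivWithinAt_nonneg {f f' : ℝ → ℝ} {a b : ℝ} (ha : 0 ≤ a) (hab : a ≤ b)
    (hd : ∀ t ∈ Icc a b, HasDerivWithinAt f (f' t) (Ici 0) t)
    (h : ∀ t ∈ Ioo a b, 0 ≤ f' t) : f a ≤ f b := by
  refine monotoneOn_of_hasDerivWithinAt_nonneg (f' := f') (convex_Icc a b)
    (continuousOn_of_hasDerivWithinAt_Ici ha hd) (fun x hx => ?_) (fun x hx => ?_)
    (left_mem_Icc.2 hab) (right_mem_Icc.2 hab) hab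
  · exact (hd x (interior_subset hx)).mono fun s hs => ha.trans (interior_subset hs).1
  · rw [interior_Icc] at hx
    exact h x hx

theorem le_of_hasDerivWithinAt_nonpos {f f' : ℝ → ℝ} {a b : ℝ} (ha : 0 ≤ a) (hab : a ≤ b)
    (hd : ∀ t ∈ Icc a b, HasDerivWithinAt f (f' t) (Ici 0) t)
    (h : ∀ t ∈ Ioo a b, f' t ≤ 0) : f b ≤ f a := by
  have := le_of_hasDerivWithinAt_nonneg (f := fun t => -f t) (f' := fun t => -f' t) ha hab
    (fun t ht => (hd t ht).neg) (fun t ht => by have := h t ht; linarith)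
  linarith

theorem lt_of_hasDerivWithinAt_pos {f f' : ℝ → ℝ} {a b : ℝ} (ha : 0 ≤ a) (hab : a < b)
    (hd : ∀ t ∈ Icc a b, HasDerivWithinAt f (f' t) (Ici 0) t)
    (h : ∀ t ∈ Ioo a b, 0 < f' t) : f a < f b := by
  refine strictMonoOn_of_hasDerivWithinAt_pos (f' := f') (convex_Icc a b)
    (continuousOn_of_hasDerivWithinAt_Ici ha hd) (fun x hx => ?_) (fun x hx => ?_)
    (left_mem_Icc.2 hab.le) (right_mem_Icc.2 hab.le) hab
  · exact (hd x (interior_subset hx)).mono fun s hs => ha.trans (interior_subset hs).1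
  · rw [interior_Icc] at hx
    exact h x hx

/-- Continuous induction: a continuous function whose positivity before `t` forces positivity
at `t` is positive. -/
theorem pos_of_continuous_induction {f : ℝ → ℝ} {a b : ℝ} (hc : ContinuousOn f (Icc a b))
    (h : ∀ t ∈ Icc a b, (∀ s ∈ Ico a t, 0 < f s) → 0 < f t) : ∀ t ∈ Icc a b, 0 < f t := by
  by_contra! hne
  obtain ⟨t₁, ht₁, hft₁⟩ := hne
  have hK : IsCompact (Icc a b ∩ f ⁻¹' Iic 0) :=
    isCompact_Icc.of_isClosed_subset (hc.preimage_isClosed_of_isClosed isClosed_Icc isClosed_Iic)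
      inter_subset_left
  obtain ⟨t₀, ht₀, hmin⟩ := hK.exists_isLeast ⟨t₁, ht₁, hft₁⟩
  refine absurd (h t₀ ht₀.1 fun s hs => ?_) (not_lt.2 ht₀.2)
  by_contra hs'
  exact absurd (hmin ⟨⟨hs.1, hs.2.le.trans ht₀.1.2⟩, not_lt.1 hs'⟩) (not_le.2 hs.2)

/-- The last time before `b` at which a continuous function is nonpositive. -/
theorem exists_last_nonpos {f : ℝ → ℝ} {a b : ℝ} (hab : a ≤ b) (hc : ContinuousOn f (Icc a b))
    (hfa : f a ≤ 0) (hfb : 0 < f b) :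
    ∃ s ∈ Ico a b, f s = 0 ∧ ∀ t ∈ Ioc s b, 0 < f t := by
  have hK : IsCompact (Icc a b ∩ f ⁻¹' Iic 0) :=
    isCompact_Icc.of_isClosed_subset (hc.preimage_isClosed_of_isClosed isClosed_Icc isClosed_Iic)
      inter_subset_left
  obtain ⟨s, hs, hmax⟩ := hK.exists_isGreatest ⟨a, left_mem_Icc.2 hab, hfa⟩
  have hlt : ∀ t ∈ Ioc s b, 0 < f t := fun t ht => by
    by_contra hcon
    exact absurd (hmax ⟨⟨hs.1.1.trans ht.1.le, ht.2⟩, not_lt.1 hcon⟩) (not_le.2 ht.1)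
  have hsb : s < b := lt_of_le_of_ne hs.1.2 fun h => by
    have h2 : f s ≤ 0 := hs.2
    rw [h] at h2
    exact absurd hfb (not_lt.2 h2)
  refine ⟨s, ⟨hs.1.1, hsb⟩, le_antisymm hs.2 ?_, hlt⟩
  by_contra hneg
  obtain ⟨c, hc1, hc2⟩ := intermediate_value_Icc hsb.le (hc.mono (Icc_subset_Icc_left hs.1.1))
    (show (0 : ℝ) ∈ Icc (f s) (f b) from ⟨hs.2, hfb.le⟩)
  rcases eq_or_lt_of_le hc1.1 with h | h
  · rw [h, hc2] at hneg
    exact hneg le_rfl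
  · exact absurd hc2 (hlt c ⟨h, hc1.2⟩).ne'

/-- A barrier principle. -/
theorem nonpos_of_barrier {f f' K : ℝ → ℝ} {a b : ℝ} (ha : 0 ≤ a)
    (hd : ∀ t ∈ Icc a b, HasDerivWithinAt f (f' t) (Ici 0) t)
    (hK : ContinuousOn K (Icc a b)) (hfa : f a ≤ 0)
    (h : ∀ t ∈ Ioo a b, 0 < f t → f' t ≤ K t * f t) : ∀ t ∈ Icc a b, f t ≤ 0 := by
  intro t ht
  by_contra hpos
  rw [not_le] at hpos
  have hcont := continuousOn_of_hasDerivWithinAt_Ici ha hd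
  obtain ⟨s, hs, hs0, hlt⟩ := exists_last_nonpos ht.1
    (hcont.mono (Icc_subset_Icc_right ht.2)) hfa hpos
  obtain ⟨C, hC⟩ := isCompact_Icc.bddAbove_image hK
  -- On the stretch where `f > 0` the variable coefficient may be replaced by its upper bound `C`;
  -- then `f e^{-Cx}` is nonincreasing and starts from `0`.
  have key := le_of_hasDerivWithinAt_nonpos (f := fun x => f x * Real.exp (-(C * x)))
    (f' := fun x => f' x * Real.exp (-(C * x)) + f x * (Real.exp (-(C * x)) * (-(C * 1))))
    (ha.trans hs.1) hs.2.le
    (fun x hx => (hd x ⟨hs.1.trans hx.1, hx.2.trans ht.2⟩).mul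
      (((hasDerivAt_id x).const_mul C).neg.exp.hasDerivWithinAt))
    (fun x hx => by
      have hx' : x ∈ Ioo a b := ⟨hs.1.trans_lt hx.1, hx.2.trans_le ht.2⟩
      have hfx := hlt x ⟨hx.1, hx.2.le⟩
      have h1 := h x hx' hfx
      have h2 : K x ≤ C := hC (mem_image_of_mem K (Ioo_subset_Icc_self hx'))
      have h3 : f' x ≤ C * f x := h1.trans (mul_le_mul_of_nonneg_right h2 hfx.le)
      have h4 := Real.exp_pos (-(C * x))
      have h5 : f' x * Real.exp (-(C * x)) + f x * (Real.exp (-(C * x)) * (-(C * 1)))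
        = (f' x - C * f x) * Real.exp (-(C * x)) := by ring
      rw [h5]
      exact mul_nonpos_of_nonpos_of_nonneg (by linarith) h4.le)
  simp only [hs0, zero_mul] at key
  exact absurd (mul_pos hpos (Real.exp_pos (-(C * t)))) (not_lt.2 key)

/-- Positivity persists as long as it forces a linear lower bound on the derivative. -/
theorem pos_of_deriv_ge {f f' K : ℝ → ℝ} {a b : ℝ} (ha : 0 ≤ a)
    (hd : ∀ t ∈ Icc a b, HasDerivWithinAt f (f' t) (Ici 0) t)
    (hK : ContinuousOn K (Icc a b)) (hfa : 0 < f a)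
    (h : ∀ t ∈ Ioo a b, (∀ s ∈ Icc a t, 0 < f s) → K t * f t ≤ f' t) :
    ∀ t ∈ Icc a b, 0 < f t := by
  obtain ⟨C, hC⟩ := isCompact_Icc.bddBelow_image hK
  refine pos_of_continuous_induction (continuousOn_of_hasDerivWithinAt_Ici ha hd)
    fun t ht hbefore => ?_
  have key := le_of_hasDerivWithinAt_nonneg (f := fun x => f x * Real.exp (-(C * x)))
    (f' := fun x => f' x * Real.exp (-(C * x)) + f x * (Real.exp (-(C * x)) * (-(C * 1))))
    ha ht.1
    (fun x hx => (hd x ⟨hx.1, hx.2.trans ht.2⟩).mul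
      (((hasDerivAt_id x).const_mul C).neg.exp.hasDerivWithinAt))
    (fun x hx => by
      have hx' : x ∈ Ioo a b := ⟨hx.1, hx.2.trans_le ht.2⟩
      have hfx := hbefore x ⟨hx.1.le, hx.2⟩
      have h1 := h x hx' fun s hs => hbefore s ⟨hs.1, hs.2.trans_lt hx.2⟩
      have h2 : C ≤ K x := hC (mem_image_of_mem K (Ioo_subset_Icc_self hx'))
      have h3 : C * f x ≤ f' x := (mul_le_mul_of_nonneg_right h2 hfx.le).trans h1
      have h4 := Real.exp_pos (-(C * x))
      have h5 : f' x * Real.exp (-(C * x)) + f x * (Real.exp (-(C * x)) * (-(C * 1)))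
        = (f' x - C * f x) * Real.exp (-(C * x)) := by ring
      rw [h5]
      exact mul_nonneg (by linarith) h4.le)
  have h6 : 0 < f a * Real.exp (-(C * a)) := mul_pos hfa (Real.exp_pos _)
  exact pos_of_mul_pos_left (h6.trans_le key) (Real.exp_pos _).le

/-! ### The system as an autonomous ordinary differential equation -/

/-- Speed at most `C` keeps a trajectory within distance `C L` of its start, so the Picard–Lindelöf
ball of that radius is never left and `L` can be arbitrary. -/
theorem exists_solution_of_lipschitz_bounded {E : Type*} [NormedAddCommGroup E]
    [NormedSpace ℝ E] [CompleteSpace E] {f : E → E} {K C : NNReal} (hK : LipschitzWith K f)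
    (hC : ∀ x, ‖f x‖ ≤ C) (x₀ : E) {L : ℝ} (hL : 0 ≤ L) :
    ∃ α : ℝ → E, α 0 = x₀ ∧ ∀ t ∈ Icc 0 L, HasDerivWithinAt α (f (α t)) (Icc 0 L) t := by
  have hPL : IsPicardLindelof (fun _ => f) (tmin := 0) (tmax := L) ⟨0, left_mem_Icc.2 hL⟩ x₀
      (C * L.toNNReal) 0 C K :=
    { lipschitzOnWith := fun _ _ => hK.lipschitzOnWith
      continuousOn := fun _ _ => continuousOn_const
      norm_le := fun _ _ x _ => hC x
      mul_max_le := by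
        simp [Real.coe_toNNReal L hL, hL] }
  exact hPL.exists_eq_forall_mem_Icc_hasDerivWithinAt₀

abbrev Phase := Fin 6 → ℝ

/-- The right-hand side of the system. -/
noncomputable def field (x : Phase) : Phase :=
  ![x 0 * x 1, 1 - (1 - x 2 ^ 2) ^ 2 / x 0 ^ 2 - x 4 * x 1, x 0 * x 3,
    -(x 4 - x 1) * x 3 - x 2 * (1 - x 2 ^ 2) / x 0, 1 + 2 * x 3 ^ 2 - x 4 ^ 2, -x 4 * x 5]

def state (γ : PhaseCurve) (t : ℝ) : Phase := ![γ.r t, γ.N t, γ.w t, γ.U t, γ.κ t, γ.ζ t]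

noncomputable def initState (p : ℝ × ℝ × ℝ) : Phase :=
  ![p.1, 0, p.2.1, p.2.2, 0, Real.sqrt (initialEnergy p.1 p.2.1 p.2.2)]

def ofState (x : ℝ → Phase) : PhaseCurve :=
  ⟨fun t => x t 0, fun t => x t 1, fun t => x t 2, fun t => x t 3, fun t => x t 4, fun t => x t 5⟩

theorem state_ofState (x : ℝ → Phase) : state (ofState x) = x := by
  funext t i
  fin_cases i <;> rfl

theorem isSolution_iff {p : ℝ × ℝ × ℝ} {T : EReal} {γ : PhaseCurve} :
    IsSolution p T γ ↔ 0 < T ∧ state γ 0 = initState p ∧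
      (∀ ρ : ℝ, 0 ≤ ρ → (ρ : EReal) < T → 0 < state γ ρ 0) ∧
      ∀ ρ : ℝ, 0 ≤ ρ → (ρ : EReal) < T →
        HasDerivWithinAt (state γ) (field (state γ ρ)) (Ici 0) ρ := by
  constructor
  · intro h
    refine ⟨h.pos, ?_, h.r_pos, fun ρ h0 hT => ?_⟩
    · simp [state, initState, h.init_r, h.init_N, h.init_w, h.init_U, h.init_κ, h.init_ζ]
    · rw [hasDerivWithinAt_pi]
      intro i
      fin_cases i
      exacts [h.eq_r ρ h0 hT, h.eq_N ρ h0 hT, h.eq_w ρ h0 hT, h.eq_U ρ h0 hT, h.eq_κ ρ h0 hT,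
        h.eq_ζ ρ h0 hT]
  · rintro ⟨hT, hinit, hpos, hder⟩
    have hd := fun ρ h0 hρ => hasDerivWithinAt_pi.1 (hder ρ h0 hρ)
    exact ⟨hT, congrFun hinit 0, congrFun hinit 1, congrFun hinit 2, congrFun hinit 3,
      congrFun hinit 4, congrFun hinit 5, hpos, fun ρ h0 hρ => hd ρ h0 hρ 0,
      fun ρ h0 hρ => hd ρ h0 hρ 1, fun ρ h0 hρ => hd ρ h0 hρ 2, fun ρ h0 hρ => hd ρ h0 hρ 3,
      fun ρ h0 hρ => hd ρ h0 hρ 4, fun ρ h0 hρ => hd ρ h0 hρ 5⟩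

/-- These boxes exhaust `r > 0`. Composing the field with the retraction `clamp` makes it globally
Lipschitz and bounded without changing it inside the box, so truncated solutions exist on any
interval and solve the original system for as long as they stay in the box. Existence, continuation
and continuous dependence all use this device. -/
noncomputable def boxLo (R : ℝ) : Phase := ![1 / R, -R, -R, -R, -R, -R]

def boxHi (R : ℝ) : Phase := fun _ => R

noncomputable def clamp (R : ℝ) (x : Phase) : Phase :=
  fun i => max (boxLo R i) (min (boxHi R i) (x i))

theorem boxLo_le_boxHi {R : ℝ} (hR : 1 ≤ R) : boxLo R ≤ boxHi R := by
  have h1 : 1 / R ≤ R := by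
    rw [div_le_iff₀ (by linarith)]
    nlinarith
  intro i
  fin_cases i <;> simp [boxLo, boxHi] at * <;> linarith

theorem clamp_mem {R : ℝ} (hR : 1 ≤ R) (x : Phase) : clamp R x ∈ Icc (boxLo R) (boxHi R) :=
  ⟨fun _ => le_max_left _ _, fun i => max_le (boxLo_le_boxHi hR i) (min_le_left _ _)⟩

theorem clamp_eq {R : ℝ} {x : Phase} (hx : x ∈ Icc (boxLo R) (boxHi R)) : clamp R x = x := by
  funext i
  simp [clamp, min_eq_right (hx.2 i), max_eq_right (hx.1 i)]

theorem lipschitzWith_clamp (R : ℝ) : LipschitzWith 1 (clamp R) := by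
  refine LipschitzWith.of_dist_le_mul fun x y => ?_
  rw [NNReal.coe_one, one_mul, dist_pi_le_iff dist_nonneg]
  intro i
  refine le_trans ?_ (dist_le_pi_dist x y i)
  simp only [Real.dist_eq, clamp]
  refine (abs_max_sub_max_le_max _ _ _ _).trans ?_
  rw [sub_self, abs_zero, max_eq_right (abs_nonneg _)]
  refine (abs_min_sub_min_le_max _ _ _ _).trans ?_
  rw [sub_self, abs_zero, max_eq_right (abs_nonneg _)]

theorem contDiffOn_field : ContDiffOn ℝ 1 field {x : Phase | 0 < x 0} := by
  rw [contDiffOn_pi]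
  have hi : ∀ i : Fin 6, ContDiffOn ℝ 1 (fun x : Phase => x i) {x : Phase | 0 < x 0} :=
    fun i => (contDiff_apply ℝ ℝ i).contDiffOn
  have hne : ∀ x ∈ {x : Phase | 0 < x 0}, x 0 ≠ 0 := fun x hx => ne_of_gt hx
  have hne2 : ∀ x ∈ {x : Phase | 0 < x 0}, x 0 ^ 2 ≠ 0 := fun x hx => pow_ne_zero 2 (hne x hx)
  intro i
  fin_cases i
  · exact (hi 0).mul (hi 1)
  · exact (contDiffOn_const.sub (((contDiffOn_const.sub ((hi 2).pow 2)).pow 2).div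
      ((hi 0).pow 2) hne2)).sub ((hi 4).mul (hi 1))
  · exact (hi 0).mul (hi 3)
  · exact (((hi 4).sub (hi 1)).neg.mul (hi 3)).sub
      (((hi 2).mul (contDiffOn_const.sub ((hi 2).pow 2))).div (hi 0) hne)
  · exact (contDiffOn_const.add (contDiffOn_const.mul ((hi 3).pow 2))).sub ((hi 4).pow 2)
  · exact (hi 4).neg.mul (hi 5)

theorem box_subset {R : ℝ} (hR : 1 ≤ R) : Icc (boxLo R) (boxHi R) ⊆ {x : Phase | 0 < x 0} := by
  intro x hx
  have h : 1 / R ≤ x 0 := hx.1 0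
  exact lt_of_lt_of_le (by positivity) h

theorem exists_lipschitz_bound_field {R : ℝ} (hR : 1 ≤ R) :
    ∃ K C : NNReal, LipschitzOnWith K field (Icc (boxLo R) (boxHi R)) ∧
      LipschitzWith K (field ∘ clamp R) ∧ ∀ x, ‖(field ∘ clamp R) x‖ ≤ C := by
  have hcd := contDiffOn_field.mono (box_subset hR)
  obtain ⟨K, hK⟩ := (hcd.locallyLipschitzOn (convex_Icc _ _)).exists_lipschitzOnWith_of_compact
    isCompact_Icc
  obtain ⟨C, hC⟩ := isCompact_Icc.exists_bound_of_continuousOn hcd.continuousOn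
  refine ⟨K, C.toNNReal, hK, ?_, fun x => ?_⟩
  · have := hK.comp (s := univ) ((lipschitzWith_clamp R).lipschitzOnWith) fun x _ => clamp_mem hR x
    rw [mul_one] at this
    exact lipschitzOnWith_univ.1 this
  · exact (hC _ (clamp_mem hR x)).trans (Real.le_coe_toNNReal C)

theorem exists_clamped_solution {R : ℝ} (hR : 1 ≤ R) (x₀ : Phase) {L : ℝ} (hL : 0 ≤ L) :
    ∃ α : ℝ → Phase, α 0 = x₀ ∧
      ∀ t ∈ Icc 0 L, HasDerivWithinAt α (field (clamp R (α t))) (Icc 0 L) t := by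
  obtain ⟨K, C, -, hK, hC⟩ := exists_lipschitz_bound_field hR
  exact exists_solution_of_lipschitz_bounded hK hC x₀ hL

/-- A phase point with positive radius lies in the interior of some box. -/
theorem exists_box_of_bounds {B c : ℝ} (hc : 0 < c) :
    ∃ R, 1 ≤ R ∧ ∀ x : Phase, c ≤ x 0 → (∀ i, |x i| ≤ B) →
      ∀ i, boxLo R i < x i ∧ x i < boxHi R i := by
  refine ⟨max (max 1 (B + 1)) (1 / c + 1), (le_max_left _ _).trans (le_max_left _ _), ?_⟩
  intro x hx hB
  set R := max (max 1 (B + 1)) (1 / c + 1) with hRdef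
  have h1 : B + 1 ≤ R := (le_max_right _ _).trans (le_max_left _ _)
  have h2 : 1 / c + 1 ≤ R := le_max_right _ _
  have h0 : 0 < 1 / c := by positivity
  have h3 : 1 / R < c := by
    rw [div_lt_iff₀ (by linarith)]
    have : 1 / c * c = 1 := by field_simp
    nlinarith
  have hb : ∀ i, -R < x i ∧ x i < R := fun i => by
    have := abs_le.1 (hB i)
    constructor <;> linarith [this.1, this.2]
  intro i
  fin_cases i
  · exact ⟨h3.trans_le hx, (hb 0).2⟩
  all_goals exact hb _

theorem exists_box_of_continuousOn {α : ℝ → Phase} {a b : ℝ} (hc : ContinuousOn α (Icc a b))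
    (hpos : ∀ t ∈ Icc a b, 0 < α t 0) :
    ∃ R, 1 ≤ R ∧ ∀ t ∈ Icc a b, ∀ i, boxLo R i < α t i ∧ α t i < boxHi R i := by
  obtain ⟨B, hB⟩ := isCompact_Icc.exists_bound_of_continuousOn hc
  rcases (Icc a b).eq_empty_or_nonempty with he | hne
  · exact ⟨1, le_rfl, by simp [he]⟩
  obtain ⟨t₀, ht₀, hmin⟩ := isCompact_Icc.exists_isMinOn hne (continuousOn_pi.1 hc 0)
  obtain ⟨R, hR, hbox⟩ := exists_box_of_bounds (B := B) (hpos t₀ ht₀)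
  exact ⟨R, hR, fun t ht => hbox _ (hmin ht) fun i =>
    (norm_le_pi_norm (α t) i).trans (hB t ht)⟩

theorem eventually_mem_box {R : ℝ} {x : Phase} (h : ∀ i, boxLo R i < x i ∧ x i < boxHi R i) :
    ∀ᶠ y in 𝓝 x, ∀ i, boxLo R i < y i ∧ y i < boxHi R i := by
  rw [eventually_all]
  intro i
  have hci : Tendsto (fun y : Phase => y i) (𝓝 x) (𝓝 (x i)) := (continuous_apply i).tendsto x
  exact (hci.eventually_const_lt (h i).1).and (hci.eventually_lt_const (h i).2)

theorem mem_box_of_lt {R : ℝ} {x : Phase} (h : ∀ i, boxLo R i < x i ∧ x i < boxHi R i) :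
    x ∈ Icc (boxLo R) (boxHi R) :=
  ⟨fun i => (h i).1.le, fun i => (h i).2.le⟩

theorem coe_lt_of_le {T : EReal} {s t : ℝ} (hst : s ≤ t) (ht : (t : EReal) < T) :
    (s : EReal) < T :=
  lt_of_le_of_lt (EReal.coe_le_coe_iff.2 hst) ht

theorem IsSolution.continuousOn_state {p : ℝ × ℝ × ℝ} {T : EReal} {γ : PhaseCurve}
    (h : IsSolution p T γ) {τ : ℝ} (hτ : (τ : EReal) < T) : ContinuousOn (state γ) (Icc 0 τ) :=
  fun t ht => (((isSolution_iff.1 h).2.2.2 t ht.1 (coe_lt_of_le ht.2 hτ)).continuousWithinAt).mono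
    fun _ hs => hs.1

/-- A solution of the clamped system that stays in the open box solves the original system. -/
theorem isSolution_of_clamped {p : ℝ × ℝ × ℝ} {R L T : ℝ} {α : ℝ → Phase} (hTL : T ≤ L)
    (hT : 0 < T) (hR : 1 ≤ R) (h0 : α 0 = initState p)
    (hd : ∀ t ∈ Icc 0 L, HasDerivWithinAt α (field (clamp R (α t))) (Icc 0 L) t)
    (hbox : ∀ t ∈ Ico 0 T, α t ∈ Icc (boxLo R) (boxHi R)) :
    IsSolution p (T : EReal) (ofState α) := by
  rw [isSolution_iff, state_ofState]
  refine ⟨by exact_mod_cast hT, h0, fun ρ hρ hρT => ?_, fun ρ hρ hρT => ?_⟩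
  · exact box_subset hR (hbox ρ ⟨hρ, by exact_mod_cast hρT⟩)
  · have hρT' : ρ < T := by exact_mod_cast hρT
    have := hd ρ ⟨hρ, hρT'.le.trans hTL⟩
    rw [clamp_eq (hbox ρ ⟨hρ, hρT'⟩)] at this
    refine this.mono_of_mem_nhdsWithin ?_
    exact mem_nhdsWithin.2 ⟨Iio L, isOpen_Iio, hρT'.trans_le hTL,
      fun s hs => ⟨hs.2, (le_of_lt hs.1)⟩⟩

theorem IsSolution.hasDerivWithinAt_Ici_self {p : ℝ × ℝ × ℝ} {T : EReal} {γ : PhaseCurve}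
    (h : IsSolution p T γ) {t : ℝ} (h0 : 0 ≤ t) (ht : (t : EReal) < T) :
    HasDerivWithinAt (state γ) (field (state γ t)) (Ici t) t :=
  ((isSolution_iff.1 h).2.2.2 t h0 ht).mono (Ici_subset_Ici.2 h0)

theorem hasDerivWithinAt_Ici_of_Icc {α : ℝ → Phase} {v : Phase} {L t : ℝ} (ht : t ∈ Ico 0 L)
    (h : HasDerivWithinAt α v (Icc 0 L) t) : HasDerivWithinAt α v (Ici t) t := by
  refine h.mono_of_mem_nhdsWithin ?_
  exact mem_nhdsWithin.2 ⟨Iio L, isOpen_Iio, ht.2, fun s hs => ⟨ht.1.trans hs.2, le_of_lt hs.1⟩⟩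

/-- Uniqueness of solutions. -/
theorem IsSolution.state_eq {p : ℝ × ℝ × ℝ} {T T' : EReal} {γ γ' : PhaseCurve}
    (h : IsSolution p T γ) (h' : IsSolution p T' γ') {t : ℝ} (h0 : 0 ≤ t)
    (ht : (t : EReal) < T) (ht' : (t : EReal) < T') : state γ t = state γ' t := by
  have hc := h.continuousOn_state ht
  have hc' := h'.continuousOn_state ht'
  obtain ⟨R₁, hR₁, hb₁⟩ := exists_box_of_continuousOn hc fun s hs =>
    h.r_pos s hs.1 (coe_lt_of_le hs.2 ht)
  obtain ⟨R₂, hR₂, hb₂⟩ := exists_box_of_continuousOn hc' fun s hs =>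
    h'.r_pos s hs.1 (coe_lt_of_le hs.2 ht')
  have hR : 1 ≤ max R₁ R₂ := hR₁.trans (le_max_left _ _)
  have mono : ∀ {R R' : ℝ}, 1 ≤ R → R ≤ R' →
      Icc (boxLo R) (boxHi R) ⊆ Icc (boxLo R') (boxHi R') := by
    intro R R' h1 hle
    refine Icc_subset_Icc ?_ fun i => hle
    intro i
    have : 1 / R' ≤ 1 / R := one_div_le_one_div_of_le (by linarith) hle
    fin_cases i <;> simp [boxLo] at * <;> linarith
  obtain ⟨K, -, hK, -, -⟩ := exists_lipschitz_bound_field hR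
  have key := ODE_solution_unique_of_mem_Icc_right (v := fun _ => field)
    (s := fun _ => Icc (boxLo (max R₁ R₂)) (boxHi (max R₁ R₂))) (fun _ _ => hK) hc
    (fun s hs => h.hasDerivWithinAt_Ici_self hs.1 (coe_lt_of_le hs.2.le ht))
    (fun s hs => mono hR₁ (le_max_left _ _) (mem_box_of_lt (hb₁ s ⟨hs.1, hs.2.le⟩))) hc'
    (fun s hs => h'.hasDerivWithinAt_Ici_self hs.1 (coe_lt_of_le hs.2.le ht'))
    (fun s hs => mono hR₂ (le_max_right _ _) (mem_box_of_lt (hb₂ s ⟨hs.1, hs.2.le⟩)))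
    ((isSolution_iff.1 h).2.1.trans (isSolution_iff.1 h').2.1.symm)
  exact key (right_mem_Icc.2 h0)

theorem exists_isSolution {p : ℝ × ℝ × ℝ} (hp : 0 < p.1) :
    ∃ (T : ℝ) (γ : PhaseCurve), IsSolution p (T : EReal) γ := by
  obtain ⟨R, hR, hbox⟩ := exists_box_of_bounds (B := ‖initState p‖) hp
  have hb := hbox (initState p) le_rfl fun i => norm_le_pi_norm (initState p) i
  obtain ⟨α, h0, hd⟩ := exists_clamped_solution hR (initState p) zero_le_one
  have hev := (hd 0 (by simp)).continuousWithinAt.eventually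
    (by rw [h0]; exact eventually_mem_box hb)
  rw [eventually_nhdsWithin_iff, Metric.eventually_nhds_iff] at hev
  obtain ⟨ε, hε, hball⟩ := hev
  refine ⟨min ε 1, ofState α, isSolution_of_clamped (min_le_right _ _) (by positivity) hR h0 hd
    fun t ht => mem_box_of_lt (hball ?_ ⟨ht.1, ht.2.le.trans (min_le_right _ _)⟩)⟩
  rw [Real.dist_eq, sub_zero, abs_of_nonneg ht.1]
  exact ht.2.trans_le (min_le_left _ _)

/-- By uniqueness, solutions with the same data agree where both exist, so they glue to a solution
up to the supremum of their end points. -/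
theorem exists_isOrbit {p : ℝ × ℝ × ℝ} (hp : 0 < p.1) :
    ∃ (T : EReal) (γ : PhaseCurve), IsOrbit p T γ := by
  classical
  set S : Set EReal := {T | ∃ γ, IsSolution p T γ} with hS
  have hex : ∀ t : ℝ, ∃ γ : PhaseCurve, (t : EReal) < sSup S →
      ∃ T : EReal, (t : EReal) < T ∧ IsSolution p T γ := by
    intro t
    by_cases ht : (t : EReal) < sSup S
    · obtain ⟨T, ⟨γ, hγ⟩, hT⟩ := lt_sSup_iff.1 ht
      exact ⟨γ, fun _ => ⟨T, hT, hγ⟩⟩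
    -- Beyond the supremum the curve is irrelevant; a dummy value is chosen.
    · exact ⟨ofState fun _ => 0, fun h => absurd h ht⟩
  choose g hg using hex
  obtain ⟨T₁, γ₁, h₁⟩ := exists_isSolution hp
  have hSpos : 0 < sSup S := lt_of_lt_of_le h₁.pos (le_sSup ⟨γ₁, h₁⟩)
  have hagree : ∀ {T : EReal} {γ : PhaseCurve}, IsSolution p T γ → ∀ t : ℝ, 0 ≤ t →
      (t : EReal) < T → state (g t) t = state γ t := by
    intro T γ hγ t h0 ht
    obtain ⟨T', hT', hsol⟩ := hg t (ht.trans_le (le_sSup ⟨γ, hγ⟩))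
    exact hsol.state_eq hγ h0 hT' ht
  refine ⟨sSup S, ofState fun t => state (g t) t, ?_, fun T' γ' h' => le_sSup ⟨γ', h'⟩⟩
  rw [isSolution_iff, state_ofState]
  refine ⟨hSpos, ?_, fun ρ h0 hρ => ?_, fun ρ h0 hρ => ?_⟩
  · rw [hagree h₁ 0 le_rfl h₁.pos]
    exact (isSolution_iff.1 h₁).2.1
  · obtain ⟨T, hT, hsol⟩ := hg ρ hρ
    exact hsol.r_pos ρ h0 hT
  · obtain ⟨T, hT, hsol⟩ := hg ρ hρ
    have hder := (isSolution_iff.1 hsol).2.2.2 ρ h0 hT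
    have hnear : ∀ᶠ s : ℝ in 𝓝[Ici 0] ρ, state (g s) s = state (g ρ) s := by
      have h1 : ∀ᶠ s : ℝ in 𝓝 ρ, (s : EReal) < T :=
        (continuous_coe_real_ereal.tendsto ρ).eventually_lt_const hT
      filter_upwards [nhdsWithin_le_nhds h1, self_mem_nhdsWithin] with s hs hs0
      exact hagree hsol s hs0 hs
    exact hder.congr_of_eventuallyEq hnear rfl

/-- A maximal solution cannot stay in a compact part of phase space up to a finite end point. -/
theorem IsOrbit.not_bounded {p : ℝ × ℝ × ℝ} {T : ℝ} {γ : PhaseCurve}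
    (h : IsOrbit p (T : EReal) γ) {B c : ℝ} (hc : 0 < c)
    (hr : ∀ t ∈ Ico 0 T, c ≤ γ.r t) (hB : ∀ t ∈ Ico 0 T, ∀ i, |state γ t i| ≤ B) : False := by
  obtain ⟨R, hR, hbox⟩ := exists_box_of_bounds (B := B) hc
  have hT : 0 < T := by exact_mod_cast h.1.pos
  have hinit := (isSolution_iff.1 h.1).2.1
  obtain ⟨α, h0, hd⟩ := exists_clamped_solution hR (initState p) (show 0 ≤ T + 1 by linarith)
  obtain ⟨K, -, hK, hKc, -⟩ := exists_lipschitz_bound_field hR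
  have hαc : ContinuousOn α (Icc 0 (T + 1)) := fun t ht => (hd t ht).continuousWithinAt
  have hgbox : ∀ t ∈ Ico 0 T, ∀ i, boxLo R i < state γ t i ∧ state γ t i < boxHi R i :=
    fun t ht => hbox _ (hr t ht) (hB t ht)
  have heq : ∀ t ∈ Ico 0 T, state γ t = α t := by
    intro t ht
    have htT : (t : EReal) < T := by exact_mod_cast ht.2
    -- Uniqueness is applied to the truncated field on the whole space, since `α` is not yet known
    -- to stay in the box.
    refine ODE_solution_unique_of_mem_Icc_right (v := fun _ => field ∘ clamp R)
      (s := fun _ => univ) (fun _ _ => hKc.lipschitzOnWith) (h.1.continuousOn_state htT)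
      (fun s hs => ?_) (fun _ _ => trivial)
      (hαc.mono (Icc_subset_Icc_right (by linarith [ht.2])))
      (fun s hs => hasDerivWithinAt_Ici_of_Icc ⟨hs.1, by linarith [hs.2, ht.2]⟩
        (hd s ⟨hs.1, by linarith [hs.2, ht.2]⟩))
      (fun _ _ => trivial) (hinit.trans h0.symm) (right_mem_Icc.2 ht.1)
    have hs' : s ∈ Ico 0 T := ⟨hs.1, hs.2.trans ht.2⟩
    have := h.1.hasDerivWithinAt_Ici_self hs.1 (by exact_mod_cast hs'.2)
    rwa [Function.comp_apply, clamp_eq (mem_box_of_lt (hgbox s hs'))]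
  have hTmem : T ∈ Icc 0 (T + 1) := ⟨hT.le, by linarith⟩
  have hleft : Tendsto α (𝓝[<] T) (𝓝 (α T)) := by
    refine (hαc T hTmem).mono_left (nhdsWithin_le_of_mem ?_)
    exact mem_nhdsWithin.2 ⟨Ioi 0, isOpen_Ioi, hT, fun s hs =>
      ⟨le_of_lt hs.1, by linarith [show s < T from hs.2]⟩⟩
  have hIco : Ico 0 T ∈ 𝓝[<] T := mem_nhdsWithin.2 ⟨Ioi 0, isOpen_Ioi, hT, fun s hs =>
      ⟨le_of_lt hs.1, hs.2⟩⟩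
  have hTr : c ≤ α T 0 := by
    refine ge_of_tendsto (((continuous_apply 0).tendsto _).comp hleft) ?_
    filter_upwards [hIco] with s hs
    rw [Function.comp_apply, ← heq s hs]
    exact hr s hs
  have hTB : ∀ i, |α T i| ≤ B := fun i => by
    refine le_of_tendsto ((((continuous_apply i).tendsto _).comp hleft).abs) ?_
    filter_upwards [hIco] with s hs
    rw [Function.comp_apply, ← heq s hs]
    exact hB s hs i
  have hev := (hd T hTmem).continuousWithinAt.eventually
    (eventually_mem_box (hbox _ hTr hTB))
  rw [eventually_nhdsWithin_iff, Metric.eventually_nhds_iff] at hev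
  obtain ⟨ε, hε, hball⟩ := hev
  have hsol : IsSolution p ((T + min ε 1 : ℝ) : EReal) (ofState α) := by
    refine isSolution_of_clamped (by linarith [min_le_right ε 1]) (by positivity) hR h0 hd
      fun t ht => ?_
    rcases lt_or_ge t T with hlt | hge
    · rw [← heq t ⟨ht.1, hlt⟩]
      exact mem_box_of_lt (hgbox t ⟨ht.1, hlt⟩)
    · refine mem_box_of_lt (hball ?_ ⟨ht.1, by linarith [ht.2, min_le_right ε 1]⟩)
      rw [Real.dist_eq, abs_of_nonneg (by linarith)]
      linarith [ht.2, min_le_left ε 1]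
  have hle := h.2 _ _ hsol
  have hlt : 0 < min ε 1 := by positivity
  have : T + min ε 1 ≤ T := by exact_mod_cast hle
  linarith

/-- Continuous dependence on the initial state over a compact time interval. -/
theorem IsSolution.exists_near {p : ℝ × ℝ × ℝ} {T : EReal} {γ : PhaseCurve}
    (h : IsSolution p T γ) {τ : ℝ} (hτ0 : 0 ≤ τ) (hτ : (τ : EReal) < T) {ε : ℝ} (hε : 0 < ε) :
    ∃ δ > 0, ∀ q : ℝ × ℝ × ℝ, dist (initState q) (initState p) ≤ δ →
      ∀ (T' : EReal) (γ' : PhaseCurve), IsOrbit q T' γ' →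
        (τ : EReal) < T' ∧ ∀ t ∈ Icc 0 τ, dist (state γ' t) (state γ t) < ε := by
  have hc := h.continuousOn_state hτ
  obtain ⟨R, hR, hb⟩ := exists_box_of_continuousOn hc fun s hs =>
    h.r_pos s hs.1 (coe_lt_of_le hs.2 hτ)
  obtain ⟨K, -, -, hKc, -⟩ := exists_lipschitz_bound_field hR
  -- the tube around the given solution stays in the box
  obtain ⟨η, hη, htube⟩ : ∃ η > 0, ∀ t ∈ Icc 0 τ, ∀ x : Phase, dist x (state γ t) ≤ η →
      ∀ i, boxLo R i < x i ∧ x i < boxHi R i := by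
    have hopen : IsOpen {x : Phase | ∀ i, boxLo R i < x i ∧ x i < boxHi R i} :=
      isOpen_iff_mem_nhds.2 fun x hx => eventually_mem_box hx
    have hcomp : IsCompact (state γ '' Icc 0 τ) := isCompact_Icc.image_of_continuousOn hc
    obtain ⟨η, hη, hsub⟩ := hcomp.exists_cthickening_subset_open hopen (by
      rintro _ ⟨t, ht, rfl⟩
      exact hb t ht)
    exact ⟨η, hη, fun t ht x hx => hsub
      (Metric.mem_cthickening_of_dist_le x _ η _ (mem_image_of_mem _ ht) hx)⟩
  -- The factor compensates the Grönwall growth `e^{Kτ}`; the bound `η` keeps the perturbed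
  -- trajectory in the tube, hence in the box.
  set δ := min η (ε / 2) * Real.exp (-(K * τ)) with hδdef
  have hδ : 0 < δ := by positivity
  refine ⟨δ, hδ, fun q hq T' γ' hγ' => ?_⟩
  obtain ⟨α, h0, hd⟩ := exists_clamped_solution hR (initState q) (show 0 ≤ τ + 1 by linarith)
  have hαc : ContinuousOn α (Icc 0 (τ + 1)) := fun t ht => (hd t ht).continuousWithinAt
  have hclose : ∀ t ∈ Icc 0 τ, dist (α t) (state γ t) ≤ min η (ε / 2) := by
    intro t ht
    have := dist_le_of_trajectories_ODE (v := fun _ => field ∘ clamp R) (fun _ => hKc)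
      (hαc.mono (Icc_subset_Icc_right (by linarith)))
      (fun s hs => hasDerivWithinAt_Ici_of_Icc ⟨hs.1, by linarith [hs.2]⟩
        (hd s ⟨hs.1, by linarith [hs.2]⟩)) hc
      (fun s hs => by
        have := h.hasDerivWithinAt_Ici_self hs.1 (coe_lt_of_le hs.2.le hτ)
        rwa [Function.comp_apply, clamp_eq (mem_box_of_lt (hb s ⟨hs.1, hs.2.le⟩))])
      (δ := δ) (by rw [h0, (isSolution_iff.1 h).2.1]; exact hq) t ht
    refine this.trans ?_
    rw [hδdef, mul_assoc, ← Real.exp_add]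
    have h1 : -(K * τ) + K * (t - 0) ≤ 0 := by
      have := mul_le_mul_of_nonneg_left ht.2 K.2
      simp only [sub_zero]
      linarith [show (K : ℝ) * t ≤ K * τ from this]
    have h2 : Real.exp (-(K * τ) + K * (t - 0)) ≤ 1 := Real.exp_le_one_iff.2 h1
    exact mul_le_of_le_one_right (by positivity) h2
  have hmem : τ ∈ Icc 0 (τ + 1) := ⟨hτ0, by linarith⟩
  have hαbox : ∀ t ∈ Icc 0 τ, ∀ i, boxLo R i < α t i ∧ α t i < boxHi R i := fun t ht =>
    htube t ht _ ((hclose t ht).trans (min_le_left _ _))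
  have hev := (hd τ hmem).continuousWithinAt.eventually
    (eventually_mem_box (hαbox τ (right_mem_Icc.2 hτ0)))
  rw [eventually_nhdsWithin_iff, Metric.eventually_nhds_iff] at hev
  obtain ⟨θ, hθ, hball⟩ := hev
  have hsol : IsSolution q ((τ + min θ 1 : ℝ) : EReal) (ofState α) := by
    refine isSolution_of_clamped (by linarith [min_le_right θ 1]) (by positivity) hR h0 hd
      fun t ht => ?_
    rcases le_or_gt t τ with hle | hgt
    · exact mem_box_of_lt (hαbox t ⟨ht.1, hle⟩)
    · refine mem_box_of_lt (hball ?_ ⟨ht.1, by linarith [ht.2, min_le_right θ 1]⟩)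
      rw [Real.dist_eq, abs_of_nonneg (by linarith)]
      linarith [ht.2, min_le_left θ 1]
  have hpos : 0 < min θ 1 := by positivity
  have hlt : (τ : EReal) < ((τ + min θ 1 : ℝ) : EReal) := by
    exact_mod_cast (by linarith : τ < τ + min θ 1)
  have hT' : (τ : EReal) < T' := hlt.trans_le (hγ'.2 _ _ hsol)
  refine ⟨hT', fun t ht => ?_⟩
  have heq := hγ'.1.state_eq hsol ht.1 (coe_lt_of_le ht.2 hT') (coe_lt_of_le ht.2 hlt)
  rw [state_ofState] at heq
  rw [heq]
  exact (hclose t ht).trans_lt (lt_of_le_of_lt (min_le_right _ _) (by linarith))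

theorem continuous_initState (r0 : ℝ) :
    Continuous fun y : ℝ × ℝ => initState (r0, y.1, y.2) := by
  refine continuous_pi fun i => ?_
  fin_cases i
  · exact continuous_const
  · exact continuous_const
  · exact continuous_fst
  · exact continuous_snd
  · exact continuous_const
  · refine Real.continuous_sqrt.comp ?_
    simp only [initialEnergy]
    fun_prop

theorem IsSolution.eventually_near {r0 : ℝ} {x0 : ℝ × ℝ} {T : EReal} {γ : PhaseCurve}
    (h : IsSolution (r0, x0.1, x0.2) T γ) {τ : ℝ} (hτ0 : 0 ≤ τ) (hτ : (τ : EReal) < T)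
    {ε : ℝ} (hε : 0 < ε) :
    ∀ᶠ y in 𝓝 x0, ∀ (T' : EReal) (γ' : PhaseCurve), IsOrbit (r0, y.1, y.2) T' γ' →
      (τ : EReal) < T' ∧ ∀ t ∈ Icc 0 τ, ∀ i, |state γ' t i - state γ t i| < ε := by
  obtain ⟨δ, hδ, hq⟩ := h.exists_near hτ0 hτ hε
  have := ((continuous_initState r0).tendsto x0).eventually (Metric.closedBall_mem_nhds _ hδ)
  filter_upwards [this] with y hy T' γ' hγ'
  obtain ⟨h1, h2⟩ := hq _ hy T' γ' hγ'
  exact ⟨h1, fun t ht i => (dist_le_pi_dist _ _ i).trans_lt (h2 t ht)⟩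

/-! ### A priori estimates -/

section Estimates

variable {p : ℝ × ℝ × ℝ} {T : EReal} {γ : PhaseCurve}

theorem IsSolution.continuousOn_coord (h : IsSolution p T γ) {b : ℝ} (hb : (b : EReal) < T) :
    ContinuousOn γ.r (Icc 0 b) ∧ ContinuousOn γ.N (Icc 0 b) ∧ ContinuousOn γ.w (Icc 0 b) ∧
      ContinuousOn γ.U (Icc 0 b) ∧ ContinuousOn γ.κ (Icc 0 b) ∧ ContinuousOn γ.ζ (Icc 0 b) := by
  have hc := continuousOn_pi.1 (h.continuousOn_state hb)
  exact ⟨hc 0, hc 1, hc 2, hc 3, hc 4, hc 5⟩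

theorem IsSolution.kappa_nonneg (h : IsSolution p T γ) {t : ℝ} (h0 : 0 ≤ t)
    (ht : (t : EReal) < T) : 0 ≤ γ.κ t := by
  have := nonpos_of_barrier (f := fun s => -γ.κ s)
    (f' := fun s => -(1 + 2 * γ.U s ^ 2 - γ.κ s ^ 2)) (K := fun s => -γ.κ s) le_rfl
    (fun s hs => (h.eq_κ s hs.1 (coe_lt_of_le hs.2 ht)).neg)
    (h.continuousOn_coord ht).2.2.2.2.1.neg (by simp [h.init_κ])
    (fun s _ _ => by nlinarith [sq_nonneg (γ.U s)]) t (right_mem_Icc.2 h0)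
  simpa using this

/-- Comparison for `κ' ≥ 1 - κ²`: the function `t/(1+t)` is a rational subsolution. -/
theorem IsSolution.kappa_ge (h : IsSolution p T γ) {t : ℝ} (h0 : 0 ≤ t)
    (ht : (t : EReal) < T) : t / (1 + t) ≤ γ.κ t := by
  have := nonpos_of_barrier (f := fun s => s / (1 + s) - γ.κ s)
    (f' := fun s => (1 * (1 + s) - s * 1) / (1 + s) ^ 2 - (1 + 2 * γ.U s ^ 2 - γ.κ s ^ 2))
    (K := fun _ => 0) le_rfl
    (fun s hs => (((hasDerivAt_id s).div ((hasDerivAt_id s).const_add 1)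
      (by simp only [id]; linarith [hs.1])).hasDerivWithinAt).sub
      (h.eq_κ s hs.1 (coe_lt_of_le hs.2 ht)))
    continuousOn_const (by simp [h.init_κ])
    (fun s hs hpos => by
      have hs0 : 0 < s := hs.1
      have hk := h.kappa_nonneg hs.1.le (coe_lt_of_le hs.2.le ht)
      have hlt : γ.κ s < s / (1 + s) := by linarith
      have hsq : γ.κ s ^ 2 ≤ (s / (1 + s)) ^ 2 := pow_le_pow_left₀ hk hlt.le 2
      have e : (1 * (1 + s) - s * 1) / (1 + s) ^ 2 + (s / (1 + s)) ^ 2 ≤ 1 := by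
        rw [div_pow, ← add_div, div_le_one (by positivity)]
        nlinarith
      nlinarith [sq_nonneg (γ.U s)]) t (right_mem_Icc.2 h0)
  linarith

theorem IsSolution.zeta_nonneg (h : IsSolution p T γ) {t : ℝ} (h0 : 0 ≤ t)
    (ht : (t : EReal) < T) : 0 ≤ γ.ζ t := by
  have := nonpos_of_barrier (f := fun s => -γ.ζ s)
    (f' := fun s => -(-γ.κ s * γ.ζ s)) (K := fun s => -γ.κ s) le_rfl
    (fun s hs => (h.eq_ζ s hs.1 (coe_lt_of_le hs.2 ht)).neg)
    (h.continuousOn_coord ht).2.2.2.2.1.neg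
    (by simp [h.init_ζ])
    (fun s _ _ => by linarith) t (right_mem_Icc.2 h0)
  simpa using this

theorem IsSolution.zeta_antitone (h : IsSolution p T γ) {s t : ℝ} (h0 : 0 ≤ s) (hst : s ≤ t)
    (ht : (t : EReal) < T) : γ.ζ t ≤ γ.ζ s := by
  refine le_of_hasDerivWithinAt_nonpos h0 hst
    (fun x hx => h.eq_ζ x (h0.trans hx.1) (coe_lt_of_le hx.2 ht)) fun x hx => ?_
  have h1 := h.kappa_nonneg (h0.trans hx.1.le) (coe_lt_of_le hx.2.le ht)
  have h2 := h.zeta_nonneg (h0.trans hx.1.le) (coe_lt_of_le hx.2.le ht)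
  nlinarith [mul_nonneg h1 h2]

/-- Where `N > κ`, the derivative of `N - κ` is `-κ(N - κ)` minus squares, hence nonpositive. -/
theorem IsSolution.N_le_kappa (h : IsSolution p T γ) {t : ℝ} (h0 : 0 ≤ t)
    (ht : (t : EReal) < T) : γ.N t ≤ γ.κ t := by
  have := nonpos_of_barrier (f := fun s => γ.N s - γ.κ s)
    (f' := fun s => 1 - (1 - γ.w s ^ 2) ^ 2 / γ.r s ^ 2 - γ.κ s * γ.N s -
      (1 + 2 * γ.U s ^ 2 - γ.κ s ^ 2)) (K := fun s => 0) le_rfl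
    (fun s hs => (h.eq_N s hs.1 (coe_lt_of_le hs.2 ht)).sub (h.eq_κ s hs.1 (coe_lt_of_le hs.2 ht)))
    continuousOn_const (by simp [h.init_N, h.init_κ])
    (fun s hs hpos => by
      have h1 := h.kappa_nonneg hs.1.le (coe_lt_of_le hs.2.le ht)
      have h2 : 0 ≤ (1 - γ.w s ^ 2) ^ 2 / γ.r s ^ 2 := by positivity
      nlinarith [mul_nonneg h1 hpos.le, sq_nonneg (γ.U s)]) t (right_mem_Icc.2 h0)
  linarith

/-- If `N > 1`, then `κ ≥ N > 1`, so `N' ≤ 1 - κN < 0`. -/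
theorem IsSolution.N_le_one (h : IsSolution p T γ) {t : ℝ} (h0 : 0 ≤ t)
    (ht : (t : EReal) < T) : γ.N t ≤ 1 := by
  have := nonpos_of_barrier (f := fun s => γ.N s - 1)
    (f' := fun s => 1 - (1 - γ.w s ^ 2) ^ 2 / γ.r s ^ 2 - γ.κ s * γ.N s) (K := fun s => 0) le_rfl
    (fun s hs => (h.eq_N s hs.1 (coe_lt_of_le hs.2 ht)).sub_const 1)
    continuousOn_const (by simp [h.init_N])
    (fun s hs hpos => by
      have h1 := h.N_le_kappa hs.1.le (coe_lt_of_le hs.2.le ht)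
      have h2 : 0 ≤ (1 - γ.w s ^ 2) ^ 2 / γ.r s ^ 2 := by positivity
      nlinarith) t (right_mem_Icc.2 h0)
  linarith

/-- The conserved constraint. -/
theorem IsSolution.constraint (h : IsSolution p T γ) (hp : p ∈ admissible) {t : ℝ} (h0 : 0 ≤ t)
    (ht : (t : EReal) < T) :
    1 + 2 * γ.U t ^ 2 - (1 - γ.w t ^ 2) ^ 2 / γ.r t ^ 2 + γ.N t ^ 2 - 2 * γ.κ t * γ.N t
      = γ.ζ t ^ 2 := by
  -- The defect satisfies the linear equation `D' = -2κD` with `D(0) = 0`; the barrier principle for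
  -- `D` and `-D` gives `D = 0`.
  set D : ℝ → ℝ := fun s => 1 + 2 * γ.U s ^ 2 - (1 - γ.w s ^ 2) ^ 2 / γ.r s ^ 2 + γ.N s ^ 2
    - 2 * (γ.κ s * γ.N s) - γ.ζ s ^ 2 with hD
  have hder : ∀ s ∈ Icc 0 t, HasDerivWithinAt D (-(2 * γ.κ s) * D s) (Ici 0) s := by
    intro s hs
    have hsT := coe_lt_of_le hs.2 ht
    have hr := (h.r_pos s hs.1 hsT).ne'
    have hr2 : γ.r s ^ 2 ≠ 0 := pow_ne_zero 2 hr
    have hU := (h.eq_U s hs.1 hsT)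
    have hw := (h.eq_w s hs.1 hsT)
    have hrd := (h.eq_r s hs.1 hsT)
    have hN := (h.eq_N s hs.1 hsT)
    have hκ := (h.eq_κ s hs.1 hsT)
    have hζ := (h.eq_ζ s hs.1 hsT)
    refine (((((hU.pow 2).const_mul 2).const_add 1).sub
      ((((hw.pow 2).const_sub 1).pow 2).div (hrd.pow 2) hr2)).add (hN.pow 2) |>.sub
      ((hκ.mul hN).const_mul 2) |>.sub (hζ.pow 2)).congr_deriv ?_
    simp only [hD, Pi.pow_apply]
    field_simp
    ring
  have hD0 : D 0 = 0 := by
    have hE := hp.2.2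
    simp only [hD, h.init_U, h.init_w, h.init_r, h.init_N, h.init_κ, h.init_ζ, Real.sq_sqrt hE]
    simp only [initialEnergy]
    ring
  have hc : ContinuousOn (fun s => -(2 * γ.κ s)) (Icc 0 t) :=
    (continuousOn_const.mul (h.continuousOn_coord ht).2.2.2.2.1).neg
  have h1 := nonpos_of_barrier le_rfl hder hc hD0.le (fun s _ _ => le_rfl) t (right_mem_Icc.2 h0)
  have h2 := nonpos_of_barrier (f := fun s => -D s) (f' := fun s => -(-(2 * γ.κ s) * D s)) le_rfl
    (fun s hs => (hder s hs).neg) hc (by simp [hD0]) (fun s _ _ => by linarith) t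
    (right_mem_Icc.2 h0)
  have h3 : D t = 0 := le_antisymm h1 (by linarith)
  simp only [hD] at h3
  linarith

/-- The derivative of `N` rewritten with the constraint. -/
theorem IsSolution.eq_N' (h : IsSolution p T γ) (hp : p ∈ admissible) {t : ℝ} (h0 : 0 ≤ t)
    (ht : (t : EReal) < T) :
    HasDerivWithinAt γ.N (γ.ζ t ^ 2 + γ.κ t * γ.N t - γ.N t ^ 2 - 2 * γ.U t ^ 2) (Ici 0) t :=
  (h.eq_N t h0 ht).congr_deriv (by linarith [h.constraint hp h0 ht])

/-- Second-order form of the equation for `w`, in terms of `w' = r U`. -/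
theorem IsSolution.eq_rU (h : IsSolution p T γ) {t : ℝ} (h0 : 0 ≤ t) (ht : (t : EReal) < T) :
    HasDerivWithinAt (fun s => γ.r s * γ.U s)
      ((2 * γ.N t - γ.κ t) * (γ.r t * γ.U t) - γ.w t * (1 - γ.w t ^ 2)) (Ici 0) t := by
  have hr := (h.r_pos t h0 ht).ne'
  refine ((h.eq_r t h0 ht).mul (h.eq_U t h0 ht)).congr_deriv ?_
  field_simp
  ring

theorem IsSolution.hasDerivAt_w (h : IsSolution p T γ) {t : ℝ} (h0 : 0 < t)
    (ht : (t : EReal) < T) : HasDerivAt γ.w (γ.r t * γ.U t) t :=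
  (h.eq_w t h0.le ht).hasDerivAt (Ici_mem_nhds h0)

/-- A solution that meets one of the invariant planes `w ∈ {0, 1, -1}`, `U = 0` starts there. -/
theorem IsSolution.init_of_stationary (h : IsSolution p T γ) {c : ℝ} (hc : c * (1 - c ^ 2) = 0)
    {t : ℝ} (h0 : 0 ≤ t) (ht : (t : EReal) < T) (hw : γ.w t = c) (hU : γ.U t = 0) :
    p.2.1 = c ∧ p.2.2 = 0 := by
  obtain ⟨c1, c2, c3, c4, c5, -⟩ := h.continuousOn_coord ht
  have hrne : ∀ s ∈ Icc 0 t, γ.r s ≠ 0 := fun s hs =>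
    (h.r_pos s hs.1 (coe_lt_of_le hs.2 ht)).ne'
  -- The quotient comes from `w(1 - w²) - c(1 - c²) = (w - c)(1 - w² - wc - c²)`.
  set A : ℝ → ℝ := fun s => γ.r s - (1 - γ.w s ^ 2 - γ.w s * c - c ^ 2) / γ.r s with hA
  set H : ℝ → ℝ := fun s => γ.κ s - γ.N s with hH
  have hAc : ContinuousOn A (Icc 0 t) := c1.sub
    ((((continuousOn_const.sub (c3.pow 2)).sub (c3.mul continuousOn_const)).sub
      continuousOn_const).div c1 hrne)
  set Y : ℝ → ℝ := fun s => (γ.w s - c) ^ 2 + γ.U s ^ 2 with hY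
  -- reverse time
  have hder : ∀ s ∈ Icc 0 t, HasDerivWithinAt Y
      (2 * A s * ((γ.w s - c) * γ.U s) - 2 * H s * γ.U s ^ 2) (Ici 0) s := by
    intro s hs
    have hsT := coe_lt_of_le hs.2 ht
    have hr := hrne s hs
    refine ((((h.eq_w s hs.1 hsT).sub_const c).pow 2).add
      ((h.eq_U s hs.1 hsT).pow 2)).congr_deriv ?_
    simp only [hA, hH]
    field_simp
    linear_combination (-2 * γ.U s) * hc
  obtain ⟨C₁, hC₁⟩ := isCompact_Icc.exists_bound_of_continuousOn hAc
  obtain ⟨C₂, hC₂⟩ := isCompact_Icc.exists_bound_of_continuousOn (c5.sub c2)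
  have hYpos : ∀ s, 0 ≤ Y s := fun s => by positivity
  -- Backward Grönwall: `Y' ≥ -(C₁ + 2C₂)Y`, so the weighted `Y` is nondecreasing and its vanishing
  -- at `t` forces it to vanish at `0`.
  have key := le_of_hasDerivWithinAt_nonneg
    (f := fun s => Y s * Real.exp ((C₁ + 2 * C₂) * s))
    (f' := fun s => (2 * A s * ((γ.w s - c) * γ.U s) - 2 * H s * γ.U s ^ 2) *
      Real.exp ((C₁ + 2 * C₂) * s) + Y s * (Real.exp ((C₁ + 2 * C₂) * s) * ((C₁ + 2 * C₂) * 1)))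
    le_rfl h0
    (fun s hs => (hder s hs).mul
      (((hasDerivAt_id s).const_mul (C₁ + 2 * C₂)).exp.hasDerivWithinAt))
    (fun s hs => by
      have hs' := Ioo_subset_Icc_self hs
      have h1 := abs_le.1 (hC₁ s hs')
      have h2 := abs_le.1 (hC₂ s hs')
      simp only [Pi.sub_apply] at h2
      have h4 : |2 * ((γ.w s - c) * γ.U s)| ≤ Y s := by
        rw [abs_le]
        constructor <;> simp only [hY] <;>
          nlinarith [sq_nonneg (γ.w s - c + γ.U s), sq_nonneg (γ.w s - c - γ.U s)]
      have h5 : |A s * (2 * ((γ.w s - c) * γ.U s))| ≤ C₁ * Y s := by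
        rw [abs_mul]
        exact mul_le_mul (hC₁ s hs') h4 (abs_nonneg _) ((abs_nonneg _).trans (hC₁ s hs'))
      have h6 : H s * γ.U s ^ 2 ≤ C₂ * Y s := by
        have hC0 : 0 ≤ C₂ := (norm_nonneg _).trans (hC₂ s hs')
        have : γ.U s ^ 2 ≤ Y s := by simp only [hY]; nlinarith [sq_nonneg (γ.w s - c)]
        calc H s * γ.U s ^ 2 ≤ C₂ * γ.U s ^ 2 :=
              mul_le_mul_of_nonneg_right h2.2 (sq_nonneg _)
          _ ≤ C₂ * Y s := mul_le_mul_of_nonneg_left this hC0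
      have h7 := (abs_le.1 h5).1
      have h8 := Real.exp_pos ((C₁ + 2 * C₂) * s)
      have h9 : (2 * A s * ((γ.w s - c) * γ.U s) - 2 * H s * γ.U s ^ 2) *
          Real.exp ((C₁ + 2 * C₂) * s) +
          Y s * (Real.exp ((C₁ + 2 * C₂) * s) * ((C₁ + 2 * C₂) * 1)) =
          (A s * (2 * ((γ.w s - c) * γ.U s)) - 2 * (H s * γ.U s ^ 2) + (C₁ + 2 * C₂) * Y s) *
          Real.exp ((C₁ + 2 * C₂) * s) := by ring
      rw [h9]
      exact mul_nonneg (by linarith) h8.le)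
  have hYt : Y t = 0 := by simp [hY, hw, hU]
  simp only [hYt, zero_mul, mul_zero, Real.exp_zero, mul_one] at key
  simp only [hY, h.init_w, h.init_U] at key
  constructor <;> nlinarith [sq_nonneg (p.2.1 - c), sq_nonneg p.2.2]

end Estimates

/-! ### The reflection `w ↦ -w` -/

/-- The curve reflected in `w`. -/
def PhaseCurve.reflect (γ : PhaseCurve) : PhaseCurve :=
  ⟨γ.r, γ.N, fun t => -γ.w t, fun t => -γ.U t, γ.κ, γ.ζ⟩

def reflectData (p : ℝ × ℝ × ℝ) : ℝ × ℝ × ℝ := (p.1, -p.2.1, -p.2.2)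

theorem reflectData_reflectData (p : ℝ × ℝ × ℝ) : reflectData (reflectData p) = p := by
  simp [reflectData]

theorem initialEnergy_reflect (r w U : ℝ) : initialEnergy r (-w) (-U) = initialEnergy r w U := by
  simp [initialEnergy]

theorem reflectData_mem_admissible {p : ℝ × ℝ × ℝ} (hp : p ∈ admissible) :
    reflectData p ∈ admissible := by
  refine ⟨hp.1, ?_, ?_⟩
  · simpa [reflectData] using hp.2.1
  · simpa only [reflectData, initialEnergy_reflect] using hp.2.2

theorem IsSolution.reflect {p : ℝ × ℝ × ℝ} {T : EReal} {γ : PhaseCurve} (h : IsSolution p T γ) :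
    IsSolution (reflectData p) T γ.reflect where
  pos := h.pos
  init_r := h.init_r
  init_N := h.init_N
  init_w := by simp [PhaseCurve.reflect, reflectData, h.init_w]
  init_U := by simp [PhaseCurve.reflect, reflectData, h.init_U]
  init_κ := h.init_κ
  init_ζ := by
    simp only [reflectData, initialEnergy_reflect]
    exact h.init_ζ
  r_pos := h.r_pos
  eq_r := h.eq_r
  eq_N := fun ρ h0 hρ => (h.eq_N ρ h0 hρ).congr_deriv (by simp [PhaseCurve.reflect])
  eq_w := fun ρ h0 hρ => (h.eq_w ρ h0 hρ).neg.congr_deriv (by simp [PhaseCurve.reflect])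
  eq_U := fun ρ h0 hρ => (h.eq_U ρ h0 hρ).neg.congr_deriv (by simp [PhaseCurve.reflect]; ring)
  eq_κ := fun ρ h0 hρ => (h.eq_κ ρ h0 hρ).congr_deriv (by simp [PhaseCurve.reflect])
  eq_ζ := h.eq_ζ

theorem IsOrbit.reflect {p : ℝ × ℝ × ℝ} {T : EReal} {γ : PhaseCurve} (h : IsOrbit p T γ) :
    IsOrbit (reflectData p) T γ.reflect :=
  ⟨h.1.reflect, fun T' γ' h' => h.2 T' γ'.reflect (by
    have := h'.reflect
    rwa [reflectData_reflectData] at this)⟩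

theorem numZeros_reflect (T : EReal) (γ : PhaseCurve) : numZeros T γ.reflect = numZeros T γ := by
  simp [numZeros, PhaseCurve.reflect]

/-! ### Singular orbits -/

section Singular

variable {p : ℝ × ℝ × ℝ} {γ : PhaseCurve}

set_option maxHeartbeats 800000 in
/-- If `N` is bounded below, an orbit does not end. -/
theorem IsOrbit.not_bddBelow {T : ℝ} (h : IsOrbit p (T : EReal) γ) (hp : p ∈ admissible) {B : ℝ}
    (hB0 : 0 ≤ B) (hB : ∀ t ∈ Ico 0 T, -B ≤ γ.N t) : False := by
  have hT : 0 < T := by exact_mod_cast h.1.pos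
  have hs := h.1
  have dom : ∀ {t : ℝ}, t < T → (t : EReal) < T := fun ht => by exact_mod_cast ht
  obtain ⟨Z, hZ⟩ : ∃ x, x = γ.ζ 0 ^ 2 := ⟨_, rfl⟩
  have hZ0 : 0 ≤ Z := hZ ▸ sq_nonneg _
  have hζ : ∀ t ∈ Ico 0 T, γ.ζ t ^ 2 ≤ Z := fun t ht => hZ ▸
    pow_le_pow_left₀ (hs.zeta_nonneg ht.1 (dom ht.2)) (hs.zeta_antitone le_rfl ht.1 (dom ht.2)) 2
  obtain ⟨Kb, hKb⟩ : ∃ x, x = B + (1 + Z) * T := ⟨_, rfl⟩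
  have hKb0 : 0 ≤ Kb := by rw [hKb]; positivity
  have hκ : ∀ t ∈ Ico 0 T, γ.κ t ≤ Kb := by
    intro t ht
    -- In `(κ + N)'` the terms `±2U²` cancel, and what remains is at most `1 + Z`.
    have := le_of_hasDerivWithinAt_nonpos (f := fun s => γ.κ s + γ.N s - (1 + Z) * s)
      (f' := fun s => (1 + 2 * γ.U s ^ 2 - γ.κ s ^ 2) +
        (γ.ζ s ^ 2 + γ.κ s * γ.N s - γ.N s ^ 2 - 2 * γ.U s ^ 2) - (1 + Z) * 1) le_rfl ht.1
      (fun s hs' => ((hs.eq_κ s hs'.1 (dom (hs'.2.trans_lt ht.2))).add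
        (hs.eq_N' hp hs'.1 (dom (hs'.2.trans_lt ht.2)))).sub
        ((hasDerivAt_id s).const_mul (1 + Z)).hasDerivWithinAt)
      (fun s hs' => by
        have := hζ s ⟨hs'.1.le, hs'.2.trans ht.2⟩
        linarith [sq_nonneg (γ.κ s - γ.N s), sq_nonneg (γ.κ s), sq_nonneg (γ.N s)])
    simp only [hs.init_κ, hs.init_N] at this
    have h1 := hB t ht
    have h2 : (1 + Z) * t ≤ (1 + Z) * T := mul_le_mul_of_nonneg_left ht.2.le (by linarith)
    linarith
  obtain ⟨R, hR⟩ : ∃ x, x = p.1 * Real.exp T := ⟨_, rfl⟩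
  have hR0 : 0 < R := hR ▸ mul_pos hp.1 (Real.exp_pos _)
  have hrpos : ∀ t ∈ Ico 0 T, 0 < γ.r t := fun t ht => hs.r_pos t ht.1 (dom ht.2)
  have hrU : ∀ t ∈ Ico 0 T, γ.r t ≤ R := by
    intro t ht
    have := le_of_hasDerivWithinAt_nonpos (f := fun s => γ.r s * Real.exp (-s))
      (f' := fun s => γ.r s * γ.N s * Real.exp (-s) + γ.r s * (Real.exp (-s) * -1)) le_rfl ht.1
      (fun s hs' => (hs.eq_r s hs'.1 (dom (hs'.2.trans_lt ht.2))).mul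
        ((hasDerivAt_id s).neg.exp.hasDerivWithinAt))
      (fun s hs' => by
        have h1 := hrpos s ⟨hs'.1.le, hs'.2.trans ht.2⟩
        have h2 := hs.N_le_one hs'.1.le (dom (hs'.2.trans ht.2))
        have h3 := mul_pos h1 (Real.exp_pos (-s))
        nlinarith)
    simp only [hs.init_r, neg_zero, Real.exp_zero, mul_one] at this
    rw [Real.exp_neg, ← div_eq_mul_inv, div_le_iff₀ (Real.exp_pos _)] at this
    rw [hR]
    exact this.trans (mul_le_mul_of_nonneg_left (Real.exp_le_exp.2 ht.2.le) hp.1.le)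
  obtain ⟨c, hc⟩ : ∃ x, x = p.1 * Real.exp (-(B * T)) := ⟨_, rfl⟩
  have hc0 : 0 < c := hc ▸ mul_pos hp.1 (Real.exp_pos _)
  have hrL : ∀ t ∈ Ico 0 T, c ≤ γ.r t := by
    intro t ht
    have := le_of_hasDerivWithinAt_nonneg (f := fun s => γ.r s * Real.exp (B * s))
      (f' := fun s => γ.r s * γ.N s * Real.exp (B * s) + γ.r s * (Real.exp (B * s) * (B * 1)))
      le_rfl ht.1
      (fun s hs' => (hs.eq_r s hs'.1 (dom (hs'.2.trans_lt ht.2))).mul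
        (((hasDerivAt_id s).const_mul B).exp.hasDerivWithinAt))
      (fun s hs' => by
        have h1 := hrpos s ⟨hs'.1.le, hs'.2.trans ht.2⟩
        have h2 := hB s ⟨hs'.1.le, hs'.2.trans ht.2⟩
        have h3 := mul_pos h1 (Real.exp_pos (B * s))
        nlinarith)
    simp only [hs.init_r, mul_zero, Real.exp_zero, mul_one] at this
    rw [hc, Real.exp_neg, ← div_eq_mul_inv, div_le_iff₀ (Real.exp_pos _)]
    exact this.trans (mul_le_mul_of_nonneg_left
      (Real.exp_le_exp.2 (mul_le_mul_of_nonneg_left ht.2.le hB0)) (hrpos t ht).le)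
  obtain ⟨W, hW⟩ : ∃ x, x = |p.2.1| + R / 2 * B + R * (1 + (Z + Kb) / 2) * T := ⟨_, rfl⟩
  have hW0 : 0 ≤ W := by rw [hW]; positivity
  have hw : ∀ t ∈ Ico 0 T, |γ.w t| ≤ W := by
    have aux : ∀ σ : ℝ, σ ^ 2 = 1 → ∀ t ∈ Ico 0 T, σ * γ.w t ≤ W := by
      intro σ hσ t ht
      -- The growth of `w` is at most `R(1 + U²)` in rate, and the term `-2U²` in `N'` pays for `R
      -- U²` through `(R/2) N`.
      have := le_of_hasDerivWithinAt_nonpos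
        (f := fun s => σ * γ.w s + R / 2 * γ.N s - R * (1 + (Z + Kb) / 2) * s)
        (f' := fun s => σ * (γ.r s * γ.U s) +
          R / 2 * (γ.ζ s ^ 2 + γ.κ s * γ.N s - γ.N s ^ 2 - 2 * γ.U s ^ 2) -
          R * (1 + (Z + Kb) / 2) * 1) le_rfl ht.1
        (fun s hs' => (((hs.eq_w s hs'.1 (dom (hs'.2.trans_lt ht.2))).const_mul σ).add
          ((hs.eq_N' hp hs'.1 (dom (hs'.2.trans_lt ht.2))).const_mul (R / 2))).sub
          ((hasDerivAt_id s).const_mul _).hasDerivWithinAt)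
        (fun s hs' => by
          have hm : s ∈ Ico 0 T := ⟨hs'.1.le, hs'.2.trans ht.2⟩
          have h1 := hrpos s hm
          have h2 := hrU s hm
          have h3 : σ * γ.U s ≤ 1 + γ.U s ^ 2 := by
            linarith [sq_nonneg (σ - γ.U s), sq_nonneg (γ.U s)]
          have h4 : σ * (γ.r s * γ.U s) ≤ R * (1 + γ.U s ^ 2) := by
            calc σ * (γ.r s * γ.U s) = γ.r s * (σ * γ.U s) := by ring
              _ ≤ γ.r s * (1 + γ.U s ^ 2) := mul_le_mul_of_nonneg_left h3 h1.le
              _ ≤ R * (1 + γ.U s ^ 2) := mul_le_mul_of_nonneg_right h2 (by positivity)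
          have h5 : γ.κ s * γ.N s ≤ Kb := by
            have := hs.kappa_nonneg hm.1 (dom hm.2)
            have h6 := hs.N_le_one hm.1 (dom hm.2)
            have h7 := hκ s hm
            exact (mul_le_of_le_one_right this h6).trans h7
          have h8 : γ.ζ s ^ 2 + γ.κ s * γ.N s - γ.N s ^ 2 ≤ Z + Kb := by
            linarith [hζ s hm, sq_nonneg (γ.N s)]
          have h9 := mul_le_mul_of_nonneg_left h8 (show 0 ≤ R / 2 by positivity)
          linarith)
      simp only [hs.init_w, hs.init_N] at this
      have h1 : R / 2 * (-γ.N t) ≤ R / 2 * B :=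
        mul_le_mul_of_nonneg_left (by linarith [hB t ht]) (by positivity)
      have h2 : R * (1 + (Z + Kb) / 2) * t ≤ R * (1 + (Z + Kb) / 2) * T :=
        mul_le_mul_of_nonneg_left ht.2.le (by positivity)
      have h3 : σ * p.2.1 ≤ |p.2.1| := by
        have hσ' : |σ| = 1 := by
          have := sq_abs σ
          rw [hσ] at this
          nlinarith [abs_nonneg σ]
        calc σ * p.2.1 ≤ |σ * p.2.1| := le_abs_self _
          _ = |p.2.1| := by rw [abs_mul, hσ', one_mul]
      linarith
    intro t ht
    exact abs_le.2 ⟨by linarith [aux (-1) (by norm_num) t ht],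
      by linarith [aux 1 (by norm_num) t ht]⟩
  -- With `w`, `κ` and `1/r` bounded, the constraint bounds `U²`.
  obtain ⟨V, hV⟩ : ∃ x, x = Z + (1 + W ^ 2) ^ 2 / c ^ 2 + 2 * Kb := ⟨_, rfl⟩
  have hV0 : 0 ≤ V := by rw [hV]; positivity
  have hU : ∀ t ∈ Ico 0 T, |γ.U t| ≤ 1 + V := by
    intro t ht
    have h1 := hs.constraint hp ht.1 (dom ht.2)
    have h2 : (1 - γ.w t ^ 2) ^ 2 / γ.r t ^ 2 ≤ (1 + W ^ 2) ^ 2 / c ^ 2 := by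
      have hw2 : γ.w t ^ 2 ≤ W ^ 2 := by
        rw [← sq_abs]
        exact pow_le_pow_left₀ (abs_nonneg _) (hw t ht) 2
      have hr2 : c ^ 2 ≤ γ.r t ^ 2 := pow_le_pow_left₀ hc0.le (hrL t ht) 2
      refine div_le_div₀ (by positivity) ?_ (by positivity) hr2
      exact sq_le_sq' (by linarith [sq_nonneg (γ.w t)]) (by linarith [sq_nonneg (γ.w t)])
    have h3 : γ.κ t * γ.N t ≤ Kb := by
      have := hs.kappa_nonneg ht.1 (dom ht.2)
      have h6 := hs.N_le_one ht.1 (dom ht.2)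
      exact (mul_le_of_le_one_right this h6).trans (hκ t ht)
    have h4 : γ.U t ^ 2 ≤ V := by
      linarith [hζ t ht, sq_nonneg (γ.N t), sq_nonneg (γ.U t)]
    rw [← sq_abs] at h4
    linarith [sq_nonneg (|γ.U t| - 1), sq_nonneg (|γ.U t|)]
  have hζ1 : ∀ t ∈ Ico 0 T, |γ.ζ t| ≤ 1 + Z := by
    intro t ht
    have := hζ t ht
    rw [← sq_abs] at this
    linarith [sq_nonneg (|γ.ζ t| - 1), sq_nonneg (|γ.ζ t|)]
  refine h.not_bounded hc0 hrL (B := R + (1 + B) + W + (1 + V) + Kb + (1 + Z)) fun t ht i => ?_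
  have e1 : |γ.r t| ≤ R := by rw [abs_of_pos (hrpos t ht)]; exact hrU t ht
  have e2 : |γ.N t| ≤ 1 + B := abs_le.2 ⟨by linarith [hB t ht],
    by linarith [hs.N_le_one ht.1 (dom ht.2)]⟩
  have e5 : |γ.κ t| ≤ Kb := by
    rw [abs_of_nonneg (hs.kappa_nonneg ht.1 (dom ht.2))]; exact hκ t ht
  have e3 := hw t ht
  have e4 := hU t ht
  have e6 := hζ1 t ht
  fin_cases i
  · show |γ.r t| ≤ _; linarith
  · show |γ.N t| ≤ _; linarith
  · show |γ.w t| ≤ _; linarith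
  · show |γ.U t| ≤ _; linarith
  · show |γ.κ t| ≤ _; linarith
  · show |γ.ζ t| ≤ _; linarith

end Singular

/-! ### Finite-time collapse once `N < -ζ` -/

section Trapped

variable {p : ℝ × ℝ × ℝ} {γ : PhaseCurve}

/-- Once `N < -ζ`, the function `N` keeps decreasing. -/
theorem IsSolution.N_le_of_lt {T : EReal} (h : IsSolution p T γ) (hp : p ∈ admissible) {s t : ℝ}
    (hs0 : 0 ≤ s) (hst : s ≤ t) (ht : (t : EReal) < T) (hN : γ.N s < -γ.ζ s) :
    γ.N t ≤ γ.N s := by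
  have hder : ∀ x ∈ Icc s t, HasDerivWithinAt γ.N
      (γ.ζ x ^ 2 + γ.κ x * γ.N x - γ.N x ^ 2 - 2 * γ.U x ^ 2) (Ici 0) x :=
    fun x hx => h.eq_N' hp (hs0.trans hx.1) (coe_lt_of_le hx.2 ht)
  have hζs := h.zeta_nonneg hs0 (coe_lt_of_le hst ht)
  -- While `N < -ζ(s) ≤ -ζ`, both `κN` and `ζ² - N²` are nonpositive, so `N` decreases and the
  -- strict inequality reproduces itself.
  have step : ∀ y ∈ Icc s t, (∀ x ∈ Ico s y, 0 < -γ.ζ s - γ.N x) → γ.N y ≤ γ.N s := by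
    intro y hy hb
    refine le_of_hasDerivWithinAt_nonpos hs0 hy.1
      (fun x hx => hder x ⟨hx.1, hx.2.trans hy.2⟩) fun x hx => ?_
    have hxT : (x : EReal) < T := coe_lt_of_le (hx.2.le.trans hy.2) ht
    have h1 := hb x ⟨hx.1.le, hx.2⟩
    have h2 := h.zeta_antitone hs0 hx.1.le hxT
    have h3 := h.zeta_nonneg (hs0.trans hx.1.le) hxT
    have h4 := h.kappa_nonneg (hs0.trans hx.1.le) hxT
    have h5 : γ.κ x * γ.N x ≤ 0 := mul_nonpos_of_nonneg_of_nonpos h4 (by linarith)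
    have h6 : γ.ζ x ^ 2 ≤ γ.N x ^ 2 := by nlinarith
    linarith [sq_nonneg (γ.U x)]
  have hpos := pos_of_continuous_induction (f := fun x => -γ.ζ s - γ.N x) (a := s) (b := t)
    (continuousOn_const.sub (continuousOn_of_hasDerivWithinAt_Ici hs0 hder))
    (fun y hy hb => by have := step y hy hb; linarith)
  exact step t (right_mem_Icc.2 hst) fun x hx => hpos x (Ico_subset_Icc_self hx)

theorem IsSolution.N_lt_neg_zeta {T : EReal} (h : IsSolution p T γ) (hp : p ∈ admissible)
    {s t : ℝ} (hs0 : 0 ≤ s) (hst : s ≤ t) (ht : (t : EReal) < T) (hN : γ.N s < -γ.ζ s) :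
    γ.N t < -γ.ζ t := by
  have h1 := h.N_le_of_lt hp hs0 hst ht hN
  have h2 := h.zeta_antitone hs0 hst ht
  linarith

/-- The Riccati lower bound for `-N'` once `N < -ζ`. -/
theorem IsSolution.exists_riccati {T : EReal} (h : IsSolution p T γ) (hp : p ∈ admissible)
    {s : ℝ} (hs0 : 0 ≤ s) (hs : (s : EReal) < T) (hN : γ.N s < -γ.ζ s) :
    ∃ c : ℝ, 0 < c ∧ c ≤ 1 ∧ ∀ t, s ≤ t → (t : EReal) < T →
      γ.ζ t ^ 2 + γ.κ t * γ.N t - γ.N t ^ 2 - 2 * γ.U t ^ 2 ≤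
        -(c * γ.N t ^ 2 + 2 * γ.U t ^ 2) := by
  have hζs := h.zeta_nonneg hs0 hs
  have hm : 0 < γ.N s ^ 2 := by nlinarith
  -- Since `ζ` decreases and `|N|` increases, `ζ² ≤ (ζ(s)²/N(s)²) N²`; this fraction of `N²` is what
  -- the Riccati term loses.
  refine ⟨1 - γ.ζ s ^ 2 / γ.N s ^ 2, ?_, ?_, fun t hst ht => ?_⟩
  · rw [sub_pos, div_lt_one hm]
    nlinarith
  · have : 0 ≤ γ.ζ s ^ 2 / γ.N s ^ 2 := by positivity
    linarith
  · have h1 := h.N_le_of_lt hp hs0 hst ht hN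
    have h2 := h.zeta_antitone hs0 hst ht
    have h3 := h.zeta_nonneg (hs0.trans hst) ht
    have h4 := h.kappa_nonneg (hs0.trans hst) ht
    have h5 : γ.κ t * γ.N t ≤ 0 := mul_nonpos_of_nonneg_of_nonpos h4 (by linarith)
    have h6 : γ.ζ t ^ 2 ≤ γ.ζ s ^ 2 := pow_le_pow_left₀ h3 h2 2
    have h7 : γ.N s ^ 2 ≤ γ.N t ^ 2 := by nlinarith
    have h8 : γ.ζ s ^ 2 ≤ γ.ζ s ^ 2 / γ.N s ^ 2 * γ.N t ^ 2 := by
      rw [div_mul_eq_mul_div, le_div_iff₀ hm]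
      exact mul_le_mul_of_nonneg_left h7 (sq_nonneg _)
    linarith

/-- Integrating `N' ≤ -cN²`: the function `1/N - ct` is nondecreasing while `1/N` stays negative,
which bounds the remaining time. -/
theorem IsSolution.time_bound {T : EReal} (h : IsSolution p T γ) (hp : p ∈ admissible)
    {s : ℝ} (hs0 : 0 ≤ s) (hs : (s : EReal) < T) (hN : γ.N s < -γ.ζ s) :
    ∃ L : ℝ, ∀ t, s ≤ t → (t : EReal) < T → t ≤ L := by
  obtain ⟨c, hc, -, hric⟩ := h.exists_riccati hp hs0 hs hN
  have hζs := h.zeta_nonneg hs0 hs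
  refine ⟨s - (γ.N s)⁻¹ / c, fun t hst ht => ?_⟩
  have hneg : ∀ x ∈ Icc s t, γ.N x < 0 := fun x hx => by
    have := h.N_le_of_lt hp hs0 hx.1 (coe_lt_of_le hx.2 ht) hN
    linarith
  have key := le_of_hasDerivWithinAt_nonneg (f := fun x => (γ.N x)⁻¹ - c * x)
    (f' := fun x => -(γ.ζ x ^ 2 + γ.κ x * γ.N x - γ.N x ^ 2 - 2 * γ.U x ^ 2) / γ.N x ^ 2 - c * 1)
    hs0 hst (fun x hx => ((h.eq_N' hp (hs0.trans hx.1) (coe_lt_of_le hx.2 ht)).inv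
      (hneg x hx).ne).sub ((hasDerivAt_id x).const_mul c).hasDerivWithinAt) fun x hx => by
      have h1 := hneg x (Ioo_subset_Icc_self hx)
      have h2 := hric x hx.1.le (coe_lt_of_le hx.2.le ht)
      have h3 : 0 < γ.N x ^ 2 := by nlinarith
      rw [sub_nonneg, le_div_iff₀ h3]
      linarith [sq_nonneg (γ.U x)]
  have h1 : (γ.N t)⁻¹ < 0 := inv_lt_zero.2 (hneg t (right_mem_Icc.2 hst))
  have h2 : c * (t - s) ≤ -(γ.N s)⁻¹ := by linarith
  have h3 : t - s ≤ -(γ.N s)⁻¹ / c := by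
    rw [le_div_iff₀ hc]
    linarith
  rw [neg_div] at h3
  linarith

theorem IsSolution.r_antitone_of_lt {T : EReal} (h : IsSolution p T γ) (hp : p ∈ admissible)
    {s t u : ℝ} (hs0 : 0 ≤ s) (hst : s ≤ t) (htu : t ≤ u) (hu : (u : EReal) < T)
    (hN : γ.N s < -γ.ζ s) : γ.r u ≤ γ.r t := by
  refine le_of_hasDerivWithinAt_nonpos (hs0.trans hst) htu
    (fun x hx => h.eq_r x (hs0.trans (hst.trans hx.1)) (coe_lt_of_le hx.2 hu)) fun x hx => ?_
  have hsx := hst.trans hx.1.le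
  have hxT := coe_lt_of_le hx.2.le hu
  have h1 := h.N_le_of_lt hp hs0 hsx hxT hN
  have h2 := h.zeta_nonneg hs0 (coe_lt_of_le hsx hxT)
  exact mul_nonpos_of_nonneg_of_nonpos (h.r_pos x (hs0.trans hsx) hxT).le (by linarith)

/-- Exponential growth of `-N` in terms of the variation of `w`. -/
theorem IsSolution.exp_le_neg_N {T : EReal} (h : IsSolution p T γ) (hp : p ∈ admissible)
    {s : ℝ} (hs0 : 0 ≤ s) (hs : (s : EReal) < T) (hN : γ.N s < -γ.ζ s) :
    ∃ k : ℝ, 0 < k ∧ ∀ t, s ≤ t → (t : EReal) < T →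
      -γ.N s * Real.exp (k * |γ.w t - γ.w s|) ≤ -γ.N t := by
  obtain ⟨c, hc, hc1, hric⟩ := h.exists_riccati hp hs0 hs hN
  have hrs := h.r_pos s hs0 hs
  have hζs := h.zeta_nonneg hs0 hs
  refine ⟨c / γ.r s, by positivity, fun t hst ht => ?_⟩
  have hneg : ∀ x ∈ Icc s t, γ.N x < 0 := fun x hx => by
    have := h.N_le_of_lt hp hs0 hx.1 (coe_lt_of_le hx.2 ht) hN
    linarith
  -- The rate of `log(-N)` is at least `(cN² + 2U²)/|N|`, which dominates `c|U|` because `c ≤ 1`;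
  -- and `|w'| = r|U| ≤ r(s)|U|`.
  have aux : ∀ σ : ℝ, |σ| = 1 →
      σ * (c / γ.r s) * (γ.w t - γ.w s) ≤ Real.log (-γ.N t) - Real.log (-γ.N s) := by
    intro σ hσ
    have key := le_of_hasDerivWithinAt_nonneg
      (f := fun x => Real.log (-γ.N x) - σ * (c / γ.r s) * γ.w x)
      (f' := fun x => -(γ.ζ x ^ 2 + γ.κ x * γ.N x - γ.N x ^ 2 - 2 * γ.U x ^ 2) / (-γ.N x)
        - σ * (c / γ.r s) * (γ.r x * γ.U x))
      hs0 hst (fun x hx => (((h.eq_N' hp (hs0.trans hx.1) (coe_lt_of_le hx.2 ht)).neg.log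
        (neg_pos.2 (hneg x hx)).ne').sub
        ((h.eq_w x (hs0.trans hx.1) (coe_lt_of_le hx.2 ht)).const_mul _))) fun x hx => by
        have hxT := coe_lt_of_le hx.2.le ht
        have hx0 := hs0.trans hx.1.le
        have h1 := hneg x (Ioo_subset_Icc_self hx)
        have h2 := hric x hx.1.le hxT
        have h3 := h.r_pos x hx0 hxT
        have h4 := h.r_antitone_of_lt hp hs0 le_rfl hx.1.le hxT hN
        have h5 : σ * (c / γ.r s) * (γ.r x * γ.U x) ≤ c * |γ.U x| := by
          have e : σ * (c / γ.r s) * (γ.r x * γ.U x) = c * (γ.r x / γ.r s) * (σ * γ.U x) := by ring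
          have e1 : σ * γ.U x ≤ |γ.U x| := by
            calc σ * γ.U x ≤ |σ * γ.U x| := le_abs_self _
              _ = |γ.U x| := by rw [abs_mul, hσ, one_mul]
          have e2 : γ.r x / γ.r s ≤ 1 := (div_le_one hrs).2 h4
          have e3 : 0 ≤ γ.r x / γ.r s := by positivity
          rw [e]
          calc c * (γ.r x / γ.r s) * (σ * γ.U x) ≤ c * (γ.r x / γ.r s) * |γ.U x| :=
                mul_le_mul_of_nonneg_left e1 (by positivity)
            _ ≤ c * 1 * |γ.U x| := by gcongr
            _ = c * |γ.U x| := by ring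
        have h6 : c * |γ.U x| ≤
            -(γ.ζ x ^ 2 + γ.κ x * γ.N x - γ.N x ^ 2 - 2 * γ.U x ^ 2) / (-γ.N x) := by
          rw [le_div_iff₀ (by linarith)]
          have e4 := sq_abs (γ.U x)
          have e5 : c * |γ.U x| * (-γ.N x) ≤ c * γ.N x ^ 2 + 2 * |γ.U x| ^ 2 := by
            have e6 : |γ.U x| * (-γ.N x) ≤ γ.N x ^ 2 + |γ.U x| ^ 2 := by
              nlinarith [sq_nonneg (|γ.U x| + γ.N x), sq_nonneg (|γ.U x|), sq_nonneg (γ.N x)]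
            nlinarith [sq_nonneg (|γ.U x|)]
          linarith
        linarith
    linarith
  have hM : 0 < -γ.N t := by have := hneg t (right_mem_Icc.2 hst); linarith
  have hm : 0 < -γ.N s := by have := hneg s (left_mem_Icc.2 hst); linarith
  have habs : c / γ.r s * |γ.w t - γ.w s| ≤ Real.log (-γ.N t) - Real.log (-γ.N s) := by
    rcases abs_cases (γ.w t - γ.w s) with ⟨e, -⟩ | ⟨e, -⟩ <;> rw [e]
    · have := aux 1 (by norm_num)
      linarith
    · have := aux (-1) (by norm_num)
      linarith
  calc -γ.N s * Real.exp (c / γ.r s * |γ.w t - γ.w s|)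
      ≤ -γ.N s * Real.exp (Real.log (-γ.N t) - Real.log (-γ.N s)) := by gcongr
    _ = -γ.N t := by
      rw [Real.exp_sub, Real.exp_log hM, Real.exp_log hm, ← mul_div_assoc,
        mul_div_cancel_left₀ _ hm.ne']

theorem IsOrbit.exists_N_lt {T : ℝ} (h : IsOrbit p (T : EReal) γ) (hp : p ∈ admissible) (B : ℝ) :
    ∃ t ∈ Ico 0 T, γ.N t < B := by
  by_contra! hcon
  exact h.not_bddBelow hp (abs_nonneg B) fun t ht => (neg_abs_le B).trans (hcon t ht)

theorem IsOrbit.exists_N_lt_after {T : ℝ} (h : IsOrbit p (T : EReal) γ) (hp : p ∈ admissible)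
    (B : ℝ) {s : ℝ} (hs : s < T) : ∃ t ∈ Ioo s T, 0 ≤ t ∧ γ.N t < B := by
  have hsT : (s : EReal) < T := by exact_mod_cast hs
  obtain ⟨C, hC⟩ := isCompact_Icc.bddBelow_image (h.1.continuousOn_coord hsT).2.1
  obtain ⟨t, ht, hN⟩ := h.exists_N_lt hp (min B C)
  refine ⟨t, ⟨?_, ht.2⟩, ht.1, hN.trans_le (min_le_left _ _)⟩
  by_contra hts
  have := hC (mem_image_of_mem γ.N ⟨ht.1, not_lt.1 hts⟩)
  exact absurd (hN.trans_le (min_le_right _ _)) (not_lt.2 this)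

/-- If `N` drops below `-ζ`, then `r` cannot stay away from `0`. -/
theorem IsOrbit.exists_r_lt {T : ℝ} (h : IsOrbit p (T : EReal) γ) (hp : p ∈ admissible) {s : ℝ}
    (hs0 : 0 ≤ s) (hs : s < T) (hN : γ.N s < -γ.ζ s) {ε : ℝ} (hε : 0 < ε) :
    ∃ t ∈ Ico s T, γ.r t < ε := by
  by_contra! hr
  have hsT : (s : EReal) < T := by exact_mod_cast hs
  obtain ⟨k, hk, hexp⟩ := h.1.exp_le_neg_N hp hs0 hsT hN
  have hζs := h.1.zeta_nonneg hs0 hsT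
  obtain ⟨m, hmdef⟩ : ∃ m, m = -γ.N s := ⟨_, rfl⟩
  have hm : 0 < m := by rw [hmdef]; linarith
  obtain ⟨A, hA⟩ : ∃ A, A = (1 + 2 * γ.w s ^ 2) / ε + γ.ζ s := ⟨_, rfl⟩
  obtain ⟨B, hB⟩ : ∃ B, B = 2 / (k ^ 2 * ε) := ⟨_, rfl⟩
  have hA0 : 0 ≤ A := by rw [hA]; positivity
  have hB0 : 0 ≤ B := by rw [hB]; positivity
  -- If `r ≥ ε`, the constraint gives `-N ≤ A + Bx²` with `x = k|w(t) - w(s)|`, while the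
  -- exponential bound gives `-N ≥ m x³/6`. Together they force `x ≤ X`, so `-N` cannot exceed `A +
  -- BX²`.
  obtain ⟨X, hX⟩ : ∃ X, X = max 1 (6 * (A + B) / m) := ⟨_, rfl⟩
  obtain ⟨t, ht, ht0, hNt⟩ := h.exists_N_lt_after hp (-(A + B * X ^ 2)) hs
  have htT : (t : EReal) < T := by exact_mod_cast ht.2
  obtain ⟨x, hx⟩ : ∃ x, x = k * |γ.w t - γ.w s| := ⟨_, rfl⟩
  have hx0 : 0 ≤ x := by rw [hx]; positivity
  have hrt := hr t ⟨ht.1.le, ht.2⟩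
  have hM1 : -γ.N t ≤ A + B * x ^ 2 := by
    have hcon := h.1.constraint hp ht0 htT
    have hNneg : γ.N t ≤ γ.N s := h.1.N_le_of_lt hp hs0 ht.1.le htT hN
    have h1 := mul_nonneg (h.1.kappa_nonneg ht0 htT) (show 0 ≤ -γ.N t by linarith)
    have h2 := h.1.zeta_antitone hs0 ht.1.le htT
    have h3 := h.1.zeta_nonneg ht0 htT
    have h4 : (1 - γ.w t ^ 2) ^ 2 / γ.r t ^ 2 ≤ ((1 + γ.w t ^ 2) / ε) ^ 2 := by
      rw [div_pow]
      refine div_le_div₀ (by positivity) ?_ (by positivity) (pow_le_pow_left₀ hε.le hrt 2)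
      exact sq_le_sq' (by linarith [sq_nonneg (γ.w t)]) (by linarith [sq_nonneg (γ.w t)])
    have h5 : 0 ≤ (1 + γ.w t ^ 2) / ε := by positivity
    have h6 : -γ.N t ≤ (1 + γ.w t ^ 2) / ε + γ.ζ s := by
      refine abs_le_of_sq_le_sq' ?_ (by linarith) |>.2
      have h7 : γ.ζ t ^ 2 ≤ γ.ζ s ^ 2 := pow_le_pow_left₀ h3 h2 2
      have h8 := mul_nonneg h5 hζs
      linarith [sq_nonneg (γ.U t)]
    have h9 : γ.w t ^ 2 ≤ 2 * γ.w s ^ 2 + 2 * (x ^ 2 / k ^ 2) := by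
      have : x ^ 2 / k ^ 2 = (γ.w t - γ.w s) ^ 2 := by
        rw [hx, mul_pow, sq_abs]
        field_simp
      rw [this]
      linarith [sq_nonneg (γ.w t - 2 * γ.w s)]
    calc -γ.N t ≤ (1 + γ.w t ^ 2) / ε + γ.ζ s := h6
      _ ≤ (1 + (2 * γ.w s ^ 2 + 2 * (x ^ 2 / k ^ 2))) / ε + γ.ζ s := by gcongr
      _ = A + B * x ^ 2 := by rw [hA, hB]; field_simp; ring
  have hM2 : m * (x ^ 3 / 6) ≤ -γ.N t := by
    refine le_trans ?_ (hexp t ht.1.le htT)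
    rw [← hmdef, ← hx]
    refine mul_le_mul_of_nonneg_left ?_ hm.le
    have := Real.pow_div_factorial_le_exp x hx0 3
    norm_num [Nat.factorial] at this
    linarith
  have hxX : x ≤ X := by
    by_contra hgt
    rw [not_le] at hgt
    have h1 : 1 < x := lt_of_le_of_lt (by rw [hX]; exact le_max_left _ _) hgt
    have h2 : 6 * (A + B) / m < x := lt_of_le_of_lt (by rw [hX]; exact le_max_right _ _) hgt
    rw [div_lt_iff₀ hm] at h2
    have h3 : m * x ^ 3 ≤ 6 * (A + B * x ^ 2) := by linarith
    have h4 : 1 ≤ x ^ 2 := by nlinarith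
    have h5 : A ≤ A * x ^ 2 := le_mul_of_one_le_right hA0 h4
    have h6 : 0 < x ^ 2 * (x * m - 6 * (A + B)) := mul_pos (by linarith) (by linarith)
    linarith
  have h7 : B * x ^ 2 ≤ B * X ^ 2 :=
    mul_le_mul_of_nonneg_left (pow_le_pow_left₀ hx0 hxX 2) hB0
  linarith

/-- An orbit on which `N` drops below `-ζ` is singular. -/
theorem IsOrbit.singular_of_N_lt {T : EReal} (h : IsOrbit p T γ) (hp : p ∈ admissible) {s : ℝ}
    (hs0 : 0 ≤ s) (hs : (s : EReal) < T) (hN : γ.N s < -γ.ζ s) :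
    ∃ ρend : ℝ, T = ρend ∧ IsSingularOrbit p ρend γ := by
  obtain ⟨L, hL⟩ := h.1.time_bound hp hs0 hs hN
  induction T with
  | bot => exact absurd h.1.pos (by simp)
  | top =>
    have h1 := hL (max s L + 1) (by linarith [le_max_left s L]) (EReal.coe_lt_top _)
    linarith [le_max_right s L]
  | coe T =>
    have hsT : s < T := by exact_mod_cast hs
    have hnear : ∀ {t : ℝ}, t < T → Ioo t T ∈ 𝓝[<] T := fun ht => Ioo_mem_nhdsLT ht
    refine ⟨T, rfl, h, ?_, ?_⟩
    · rw [Metric.tendsto_nhds]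
      intro ε hε
      obtain ⟨t, ht, hr⟩ := h.exists_r_lt hp hs0 hsT hN hε
      filter_upwards [hnear ht.2] with u hu
      have huT : (u : EReal) < T := by exact_mod_cast hu.2
      rw [Real.dist_eq, sub_zero,
        abs_of_pos (h.1.r_pos u (hs0.trans (ht.1.trans hu.1.le)) huT)]
      exact (h.1.r_antitone_of_lt hp hs0 ht.1 hu.1.le huT hN).trans_lt hr
    · rw [tendsto_atBot]
      intro b
      obtain ⟨t, ht, ht0, hNt⟩ := h.exists_N_lt_after hp b hsT
      filter_upwards [hnear ht.2] with u hu
      have huT : (u : EReal) < T := by exact_mod_cast hu.2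
      have htT : (t : EReal) < T := by exact_mod_cast ht.2
      have := h.1.N_le_of_lt hp ht0 hu.1.le huT (h.1.N_lt_neg_zeta hp hs0 ht.1.le htT hN)
      linarith

/-- An orbit on which `N ≥ -ζ` is global. -/
theorem IsOrbit.eq_top_of_N_ge {T : EReal} (h : IsOrbit p T γ) (hp : p ∈ admissible)
    (hN : ∀ t : ℝ, 0 ≤ t → (t : EReal) < T → -γ.ζ t ≤ γ.N t) : T = ⊤ := by
  induction T with
  | bot => exact absurd h.1.pos (by simp)
  | top => rfl
  | coe T =>
    refine (h.not_bddBelow hp (h.1.zeta_nonneg le_rfl h.1.pos) fun t ht => ?_).elim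
    have htT : (t : EReal) < T := by exact_mod_cast ht.2
    have := h.1.zeta_antitone le_rfl ht.1 htT
    linarith [hN t ht.1 htT]

end Trapped

/-! ### Escaping orbits -/

section Escape

variable {p : ℝ × ℝ × ℝ} {T : EReal} {γ : PhaseCurve}

/-- Once `w > 1`, `w` keeps increasing. -/
theorem IsSolution.exit_persists (h : IsSolution p T γ) (hp : p ∈ admissible) {s t : ℝ}
    (hs0 : 0 ≤ s) (hst : s ≤ t) (ht : (t : EReal) < T) (hw : 1 < γ.w s) :
    1 < γ.w t ∧ 0 < γ.U t := by
  have hsT := coe_lt_of_le hst ht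
  have hw0 : γ.w 0 ≤ 1 := by rw [h.init_w]; exact (abs_le.1 hp.2.1).2
  -- As `w(0) ≤ 1`, there is a last time with `w = 1` before `s`; after it `w > 1`, and somewhere `U
  -- > 0`. From that point the force has the sign that keeps `U` positive.
  obtain ⟨s₀, hs₀, hws₀, hlt⟩ := exists_last_nonpos (f := fun x => γ.w x - 1) hs0
    ((h.continuousOn_coord hsT).2.2.1.sub continuousOn_const) (by simpa using hw0)
    (by simpa using hw)
  have hws₀' : γ.w s₀ = 1 := by linarith
  obtain ⟨x, hx, hUx⟩ : ∃ x ∈ Ioo s₀ s, 0 < γ.r x * γ.U x := by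
    by_contra! hcon
    have := le_of_hasDerivWithinAt_nonpos hs₀.1 hs₀.2.le
      (fun y hy => h.eq_w y (hs₀.1.trans hy.1) (coe_lt_of_le hy.2 hsT)) hcon
    linarith
  have hwx : 1 < γ.w x := by have := hlt x ⟨hx.1, hx.2.le⟩; linarith
  have hx0 : 0 ≤ x := hs₀.1.trans hx.1.le
  have hxt : x ≤ t := hx.2.le.trans hst
  have hr : ∀ y ∈ Icc x t, 0 < γ.r y := fun y hy =>
    h.r_pos y (hx0.trans hy.1) (coe_lt_of_le hy.2 ht)
  have hmono : ∀ y ∈ Icc x t, (∀ u ∈ Ioo x y, 0 < γ.U u) → γ.w x ≤ γ.w y := fun y hy hU =>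
    le_of_hasDerivWithinAt_nonneg hx0 hy.1
      (fun u hu => h.eq_w u (hx0.trans hu.1) (coe_lt_of_le (hu.2.trans hy.2) ht))
      fun u hu => mul_nonneg (hr u ⟨hu.1.le, hu.2.le.trans hy.2⟩).le (hU u hu).le
  have hUpos := pos_of_deriv_ge hx0
    (fun y hy => h.eq_U y (hx0.trans hy.1) (coe_lt_of_le hy.2 ht))
    (K := fun y => -(γ.κ y - γ.N y))
    ((((h.continuousOn_coord ht).2.2.2.2.1.sub (h.continuousOn_coord ht).2.1).neg).mono
      (Icc_subset_Icc_left hx0))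
    (pos_of_mul_pos_right hUx (hr x (left_mem_Icc.2 hxt)).le) fun y hy hb => by
      have h1 := hmono y (Ioo_subset_Icc_self hy) fun u hu => hb u (Ioo_subset_Icc_self hu)
      have h2 := hr y (Ioo_subset_Icc_self hy)
      have h3 : 0 ≤ γ.w y * (γ.w y ^ 2 - 1) / γ.r y := by
        have : 1 ≤ γ.w y ^ 2 := by nlinarith
        have h4 : 0 ≤ γ.w y := by linarith
        exact div_nonneg (mul_nonneg h4 (by linarith)) h2.le
      have h5 : γ.w y * (1 - γ.w y ^ 2) / γ.r y = -(γ.w y * (γ.w y ^ 2 - 1) / γ.r y) := by ring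
      rw [h5]
      linarith
  exact ⟨hwx.trans_le (hmono t (right_mem_Icc.2 hxt) fun u hu => hUpos u (Ioo_subset_Icc_self hu)),
    hUpos t (right_mem_Icc.2 hxt)⟩

/-- If `N ≥ -ζ` held throughout, the orbit would be global with `w > 1` forever. The quotient `q =
w'/(w² - 1)` then obeys a Riccati equation and stays below some `Q`. In `(q/w)'` the constant `1`
survives up to terms linear in `q`, which are absorbed by `½ log((w-1)/(w+1))`, an antiderivative of
`q` that is bounded above, and up to `-κq`. That term costs `εκ²`, which is recovered from `-εκ'`;
the resulting `U²` is bounded by `Q²` times the tension in `N'`. So a quantity bounded above would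
grow linearly. -/
theorem IsOrbit.exists_N_lt_of_one_lt (h : IsOrbit p T γ) (hp : p ∈ admissible) {s : ℝ}
    (hs0 : 0 ≤ s) (hs : (s : EReal) < T) (hw : 1 < γ.w s) :
    ∃ t : ℝ, 0 ≤ t ∧ (t : EReal) < T ∧ γ.N t < -γ.ζ t := by
  by_contra! hN
  have hT := h.eq_top_of_N_ge hp hN
  subst hT
  have hsol := h.1
  have dom : ∀ t : ℝ, (t : EReal) < ⊤ := EReal.coe_lt_top
  have hwU : ∀ t, s ≤ t → 1 < γ.w t ∧ 0 < γ.U t := fun t ht =>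
    hsol.exit_persists hp hs0 ht (dom t) hw
  have hr : ∀ t, s ≤ t → 0 < γ.r t := fun t ht => hsol.r_pos t (hs0.trans ht) (dom t)
  have hw2 : ∀ t, s ≤ t → 0 < γ.w t ^ 2 - 1 := fun t ht => by nlinarith [(hwU t ht).1]
  obtain ⟨q, hq⟩ : ∃ q : ℝ → ℝ, q = fun t => γ.r t * γ.U t / (γ.w t ^ 2 - 1) := ⟨_, rfl⟩
  have hqpos : ∀ t, s ≤ t → 0 < q t := fun t ht => by
    rw [hq]
    exact div_pos (mul_pos (hr t ht) (hwU t ht).2) (hw2 t ht)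
  have hz : ∀ t, s ≤ t → γ.r t * γ.U t = q t * (γ.w t ^ 2 - 1) := fun t ht => by
    rw [hq]
    have := (hw2 t ht).ne'
    field_simp
  have hqd : ∀ t, s ≤ t → HasDerivWithinAt q
      ((2 * γ.N t - γ.κ t) * q t + γ.w t - 2 * γ.w t * q t ^ 2) (Ici 0) t := by
    intro t ht
    have hne := (hw2 t ht).ne'
    have := ((hsol.eq_rU (hs0.trans ht) (dom t)).div
      (((hsol.eq_w t (hs0.trans ht) (dom t)).pow 2).sub_const 1) hne)
    rw [hq]
    refine this.congr_deriv ?_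
    simp only [Pi.pow_apply]
    field_simp
    ring
  obtain ⟨Q, hQ⟩ : ∃ Q, Q = max (q s) 2 := ⟨_, rfl⟩
  have hQ2 : 2 ≤ Q := hQ ▸ le_max_right _ _
  have hqQ : ∀ t, s ≤ t → q t ≤ Q := by
    intro t ht
    have := nonpos_of_barrier (f := fun x => q x - Q) (K := fun _ => 0) hs0
      (fun x hx => (hqd x hx.1).sub_const Q) continuousOn_const
      (by simp only [hQ]; linarith [le_max_left (q s) 2]) (fun x hx hpos => by
        have h1 := (hwU x hx.1.le).1
        have h2 : 2 < q x := by linarith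
        have h3 := hsol.N_le_one (hs0.trans hx.1.le) (dom x)
        have h4 := hsol.kappa_nonneg (hs0.trans hx.1.le) (dom x)
        have h5 : (2 * γ.N x - γ.κ x) * q x ≤ 2 * q x :=
          mul_le_mul_of_nonneg_right (by linarith) (by linarith)
        have h6 : 1 * (2 * q x ^ 2 - 1) ≤ γ.w x * (2 * q x ^ 2 - 1) :=
          mul_le_mul_of_nonneg_right h1.le (by nlinarith)
        nlinarith) t (right_mem_Icc.2 ht)
    linarith
  -- The constants in `ε(κ' + 2Q²(N + ζ)')` add up to `ε(1 + 2Q²)`; this choice makes them `1/2`,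
  -- leaving a net rate of `1/2`.
  obtain ⟨ε, hε⟩ : ∃ ε, ε = 1 / (2 * (1 + 2 * Q ^ 2)) := ⟨_, rfl⟩
  have hε0 : 0 < ε := by rw [hε]; positivity
  have hεQ : ε * (1 + 2 * Q ^ 2) = 1 / 2 := by
    rw [hε]
    field_simp
  -- Sum of all coefficients of `q` to be absorbed; the last one comes from `κq ≤ εκ² + q²/(4ε)` and
  -- `q² ≤ Qq`.
  obtain ⟨C, hC⟩ : ∃ C, C = 3 * Q + 2 * γ.ζ 0 + Q / (4 * ε) := ⟨_, rfl⟩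
  have hζ0 := hsol.zeta_nonneg le_rfl (dom 0)
  obtain ⟨Φ, hΦ⟩ : ∃ Φ : ℝ → ℝ, Φ = fun t => q t / γ.w t
      + C * ((Real.log (γ.w t - 1) - Real.log (γ.w t + 1)) / 2)
      - ε * (γ.κ t + 2 * Q ^ 2 * (γ.N t + γ.ζ t)) - 1 / 2 * t := ⟨_, rfl⟩
  have hbound : ∀ t, s ≤ t → Φ t + 1 / 2 * t ≤ Q := by
    intro t ht
    have h1 := (hwU t ht).1
    have h2 : q t / γ.w t ≤ Q := (div_le_self (hqpos t ht).le h1.le).trans (hqQ t ht)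
    have h3 : Real.log (γ.w t - 1) ≤ Real.log (γ.w t + 1) :=
      Real.log_le_log (by linarith) (by linarith)
    have h4 := hsol.kappa_nonneg (hs0.trans ht) (dom t)
    have h5 := hN t (hs0.trans ht) (dom t)
    have hC0 : 0 ≤ C := by rw [hC]; positivity
    have h6 : C * ((Real.log (γ.w t - 1) - Real.log (γ.w t + 1)) / 2) ≤ 0 :=
      mul_nonpos_of_nonneg_of_nonpos hC0 (by linarith)
    have h7 : 0 ≤ ε * (γ.κ t + 2 * Q ^ 2 * (γ.N t + γ.ζ t)) :=
      mul_nonneg hε0.le (add_nonneg h4 (mul_nonneg (by positivity) (by linarith)))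
    rw [hΦ]
    linarith
  have hmono : ∀ t, s ≤ t → Φ s ≤ Φ t := by
    intro t ht
    refine le_of_hasDerivWithinAt_nonneg (f' := fun x =>
      (((2 * γ.N x - γ.κ x) * q x + γ.w x - 2 * γ.w x * q x ^ 2) * γ.w x -
        q x * (γ.r x * γ.U x)) / γ.w x ^ 2 + C * q x
      - ε * ((1 + 2 * γ.U x ^ 2 - γ.κ x ^ 2) + 2 * Q ^ 2 *
        ((1 - (1 - γ.w x ^ 2) ^ 2 / γ.r x ^ 2 - γ.κ x * γ.N x) + (-γ.κ x * γ.ζ x))) - 1 / 2 * 1)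
      hs0 ht (fun x hx => ?_) fun x hx => ?_
    · have hx0 := hs0.trans hx.1
      have h1 := (hwU x hx.1).1
      have hwd := hsol.eq_w x hx0 (dom x)
      have hlog := ((((hwd.sub_const 1).log (by linarith)).sub
        ((hwd.add_const 1).log (by linarith))).div_const 2).const_mul C
      have hlog' := hlog.congr_deriv (g' := C * q x) (by
        have e1 : γ.w x - 1 ≠ 0 := by linarith
        have e2 : γ.w x + 1 ≠ 0 := by linarith
        have e3 := (hw2 x hx.1).ne'
        rw [hz x hx.1]
        field_simp
        ring)
      rw [hΦ]
      exact ((((hqd x hx.1).div hwd (by linarith)).add hlog').sub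
        ((((hsol.eq_κ x hx0 (dom x)).add (((hsol.eq_N x hx0 (dom x)).add
          (hsol.eq_ζ x hx0 (dom x))).const_mul (2 * Q ^ 2)))).const_mul ε)).sub
        ((hasDerivAt_id x).const_mul (1 / 2)).hasDerivWithinAt
    · have hx0 := hs0.trans hx.1.le
      obtain ⟨h1, hU⟩ := hwU x hx.1.le
      have hκ := hsol.kappa_nonneg hx0 (dom x)
      have hNx := hN x hx0 (dom x)
      have hζx := hsol.zeta_antitone le_rfl hx0 (dom x)
      have hq0 := hqpos x hx.1.le
      have hq1 := hqQ x hx.1.le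
      obtain ⟨S, hS⟩ : ∃ S, S = (1 - γ.w x ^ 2) ^ 2 / γ.r x ^ 2 := ⟨_, rfl⟩
      have hS0 : 0 ≤ S := by rw [hS]; positivity
      have hUS : γ.U x ^ 2 ≤ Q ^ 2 * S := by
        have e : γ.U x ^ 2 = q x ^ 2 * S := by
          have e1 := hz x hx.1.le
          have e2 := (hr x hx.1.le).ne'
          have e3 : γ.U x = q x * (γ.w x ^ 2 - 1) / γ.r x := by
            field_simp
            linarith
          rw [e3, hS]
          field_simp
          ring
        rw [e]
        exact mul_le_mul_of_nonneg_right (pow_le_pow_left₀ hq0.le hq1 2) hS0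
      have hA : 1 - 3 * Q * q x - γ.κ x * q x - 2 * γ.ζ 0 * q x ≤
          (((2 * γ.N x - γ.κ x) * q x + γ.w x - 2 * γ.w x * q x ^ 2) * γ.w x -
          q x * (γ.r x * γ.U x)) / γ.w x ^ 2 := by
        have hw0 : 0 < γ.w x := by linarith
        have hw1 : γ.w x ≤ γ.w x ^ 2 := by nlinarith
        rw [le_div_iff₀ (by positivity), hz x hx.1.le]
        have e1 : -(γ.κ x + 2 * γ.ζ 0) * q x * γ.w x ^ 2 ≤ (2 * γ.N x - γ.κ x) * q x * γ.w x := by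
          have e2 : (-(2 * γ.N x - γ.κ x)) * (q x * γ.w x) ≤
              (γ.κ x + 2 * γ.ζ 0) * (q x * γ.w x) :=
            mul_le_mul_of_nonneg_right (by linarith) (by positivity)
          have e3 : (γ.κ x + 2 * γ.ζ 0) * q x * γ.w x ≤ (γ.κ x + 2 * γ.ζ 0) * q x * γ.w x ^ 2 :=
            mul_le_mul_of_nonneg_left hw1 (by positivity)
          linarith
        have e4 : q x ^ 2 * γ.w x ^ 2 ≤ Q * q x * γ.w x ^ 2 := by
          refine mul_le_mul_of_nonneg_right ?_ (by positivity)
          rw [sq]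
          exact mul_le_mul_of_nonneg_right hq1 hq0.le
        have e5 := sq_nonneg (q x)
        linarith
      have hB : γ.κ x * q x ≤ ε * γ.κ x ^ 2 + Q / (4 * ε) * q x := by
        have e1 : q x * q x ≤ Q * q x := mul_le_mul_of_nonneg_right hq1 hq0.le
        have e2 : Q / (4 * ε) * q x = Q * q x / (4 * ε) := by ring
        have e3 : γ.κ x * q x - ε * γ.κ x ^ 2 ≤ Q * q x / (4 * ε) := by
          rw [le_div_iff₀ (by positivity)]
          linarith [sq_nonneg (2 * ε * γ.κ x - q x)]
        linarith
      have hD : ε * ((1 + 2 * γ.U x ^ 2 - γ.κ x ^ 2) + 2 * Q ^ 2 *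
          ((1 - S - γ.κ x * γ.N x) + (-γ.κ x * γ.ζ x))) ≤
          ε * (1 + 2 * Q ^ 2) - ε * γ.κ x ^ 2 := by
        rw [← mul_sub]
        refine mul_le_mul_of_nonneg_left ?_ hε0.le
        have e1 : 0 ≤ γ.κ x * (γ.N x + γ.ζ x) := mul_nonneg hκ (by linarith)
        have e2 : 0 ≤ Q ^ 2 * (γ.κ x * (γ.N x + γ.ζ x)) := mul_nonneg (sq_nonneg _) e1
        linarith
      rw [← hS]
      have hCq : C * q x = 3 * Q * q x + 2 * γ.ζ 0 * q x + Q / (4 * ε) * q x := by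
        rw [hC]
        ring
      linarith
  obtain ⟨t, hts, ht⟩ : ∃ t, s ≤ t ∧ 2 * (Q - Φ s) < t :=
    ⟨max s (2 * (Q - Φ s) + 1), le_max_left _ _, lt_of_lt_of_le (by linarith) (le_max_right _ _)⟩
  linarith [hmono t hts, hbound t hts]

end Escape

/-! ### Exit through `|w| = 1` and simplicity of zeros -/

section Zeros

variable {p : ℝ × ℝ × ℝ} {T : EReal} {γ : PhaseCurve}

theorem IsSolution.exit_persists_abs (h : IsSolution p T γ) (hp : p ∈ admissible) {s t : ℝ}
    (hs0 : 0 ≤ s) (hst : s ≤ t) (ht : (t : EReal) < T) (hw : 1 < |γ.w s|) : 1 < |γ.w t| := by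
  rcases lt_abs.1 hw with hw | hw
  · exact lt_abs.2 (Or.inl (h.exit_persists hp hs0 hst ht hw).1)
  · exact lt_abs.2 (Or.inr (h.reflect.exit_persists (reflectData_mem_admissible hp) hs0 hst ht
      hw).1)

theorem IsOrbit.singular_of_exit (h : IsOrbit p T γ) (hp : p ∈ admissible) {s : ℝ} (hs0 : 0 ≤ s)
    (hs : (s : EReal) < T) (hw : 1 < |γ.w s|) :
    ∃ ρend : ℝ, T = ρend ∧ IsSingularOrbit p ρend γ := by
  have : ∃ t : ℝ, 0 ≤ t ∧ (t : EReal) < T ∧ γ.N t < -γ.ζ t := by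
    rcases lt_abs.1 hw with hw | hw
    · exact h.exists_N_lt_of_one_lt hp hs0 hs hw
    · exact h.reflect.exists_N_lt_of_one_lt (reflectData_mem_admissible hp) hs0 hs hw
  obtain ⟨t, ht0, ht, hN⟩ := this
  exact h.singular_of_N_lt hp ht0 ht hN

/-- Such data are fixed by the reflection, so uniqueness gives `w = -w`. -/
theorem IsSolution.w_eq_zero (h : IsSolution p T γ) (hp : p.2 = 0) {t : ℝ} (h0 : 0 ≤ t)
    (ht : (t : EReal) < T) : γ.w t = 0 := by
  have hrefl : reflectData p = p := by
    have h1 : p.2.1 = 0 := by rw [hp]; rfl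
    have h2 : p.2.2 = 0 := by rw [hp]; rfl
    ext <;> simp [reflectData, h1, h2]
  have h' := h.reflect
  rw [hrefl] at h'
  have := congrFun (h.state_eq h' h0 ht ht) 2
  have e : γ.w t = -γ.w t := this
  linarith

/-- Zeros of `w` are simple away from the invariant plane `w = U = 0`; all zero counting rests on
this. -/
theorem IsSolution.U_ne_zero (h : IsSolution p T γ) (hp : p.2 ≠ 0) {t : ℝ} (h0 : 0 ≤ t)
    (ht : (t : EReal) < T) (hw : γ.w t = 0) : γ.U t ≠ 0 := fun hU => by
  obtain ⟨h1, h2⟩ := h.init_of_stationary (c := 0) (by simp) h0 ht hw hU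
  exact hp (Prod.ext h1 h2)

theorem IsSolution.finite_zeros (h : IsSolution p T γ) (hp : p.2 ≠ 0) {b : ℝ}
    (hb : (b : EReal) < T) : {t ∈ Icc 0 b | γ.w t = 0}.Finite := by
  by_contra hinf
  obtain ⟨x, hx, hacc⟩ := Set.Infinite.exists_accPt_of_subset_isCompact hinf
    (isCompact_Icc (a := (0 : ℝ)) (b := b)) fun t ht => ht.1
  have hxT := coe_lt_of_le hx.2 hb
  have hd := h.eq_w x hx.1 hxT
  have hfreq := accPt_iff_frequently.1 hacc
  have hw : γ.w x = 0 := by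
    have hcl : IsClosed {t ∈ Icc 0 b | γ.w t = 0} :=
      (h.continuousOn_coord hb).2.2.1.preimage_isClosed_of_isClosed isClosed_Icc
        isClosed_singleton
    exact (hcl.mem_of_frequently_of_tendsto (hfreq.mono fun y hy => hy.2) tendsto_id).2
  have hne : γ.r x * γ.U x ≠ 0 :=
    mul_ne_zero (h.r_pos x hx.1 hxT).ne' (h.U_ne_zero hp hx.1 hxT hw)
  have hev := hd.eventually_ne (c := 0) hne
  rw [eventually_nhdsWithin_iff] at hev
  obtain ⟨y, hy, hy1, hy2⟩ := (hev.and_frequently hfreq).exists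
  exact hy ⟨hy2.1.1, hy1⟩ hy2.2

/-! ### Crashing orbits -/

/-- The tension term bounded by the constraint. -/
theorem IsSolution.tension_le (h : IsSolution p T γ) (hp : p ∈ admissible) {t : ℝ} (h0 : 0 ≤ t)
    (ht : (t : EReal) < T) (hN : γ.N t ≤ 0) :
    |1 - γ.w t ^ 2| / γ.r t ≤ 1 + 3 / 2 * |γ.U t| + (γ.κ t - γ.N t) := by
  have hκ := h.kappa_nonneg h0 ht
  have hr := h.r_pos t h0 ht
  have hc := h.constraint hp h0 ht
  have h1 : (|1 - γ.w t ^ 2| / γ.r t) ^ 2 = (1 - γ.w t ^ 2) ^ 2 / γ.r t ^ 2 := by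
    rw [div_pow, sq_abs]
  have hH : 0 ≤ γ.κ t - γ.N t := by linarith
  have hU := abs_nonneg (γ.U t)
  -- With `H = κ - N`, the constraint bounds the squared tension by `1 + 2U² + H²`, and `(3/2)² ≥
  -- 2`.
  refine abs_le_of_sq_le_sq' ?_ (by linarith) |>.2
  have h2 := mul_nonneg hU hH
  have h3 := sq_abs (γ.U t)
  nlinarith [sq_nonneg (γ.κ t), sq_nonneg (γ.ζ t), sq_nonneg (γ.U t)]

end Zeros

section Crash

variable {p : ℝ × ℝ × ℝ} {T : EReal} {γ : PhaseCurve}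

/-- In the region `N ≤ -4`, `|w| ≤ 1` the function `U` stays bounded. -/
theorem IsSolution.U_bound (h : IsSolution p T γ) (hp : p ∈ admissible) {s t B : ℝ}
    (hs0 : 0 ≤ s) (hst : s ≤ t) (ht : (t : EReal) < T) (hN : γ.N s ≤ -4)
    (hζ : γ.N s < -γ.ζ s) (hB : 2 ≤ B) (hU : |γ.U s| ≤ B)
    (hw : ∀ x ∈ Ico s t, |γ.w x| ≤ 1) : |γ.U t| ≤ B := by
  have key := nonpos_of_barrier (f := fun x => γ.U x ^ 2 - B ^ 2) (K := fun _ => 0) hs0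
    (fun x hx => ((h.eq_U x (hs0.trans hx.1) (coe_lt_of_le hx.2 ht)).pow 2).sub_const (B ^ 2))
    continuousOn_const
    (by have := sq_abs (γ.U s); nlinarith [abs_nonneg (γ.U s)]) (fun x hx hpos => by
      have hx0 := hs0.trans hx.1.le
      have hxT := coe_lt_of_le hx.2.le ht
      have hNx : γ.N x ≤ -4 := (h.N_le_of_lt hp hs0 hx.1.le hxT hζ).trans hN
      have hκ := h.kappa_nonneg hx0 hxT
      have hr := h.r_pos x hx0 hxT
      have hT := h.tension_le hp hx0 hxT (by linarith)
      have hwx := hw x ⟨hx.1.le, hx.2⟩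
      obtain ⟨u, hu⟩ : ∃ u, u = |γ.U x| := ⟨_, rfl⟩
      have hu2 : u ^ 2 = γ.U x ^ 2 := by rw [hu, sq_abs]
      have hu0 : 0 ≤ u := hu ▸ abs_nonneg _
      have huB : B < u := by
        by_contra hle
        have : u ^ 2 ≤ B ^ 2 := pow_le_pow_left₀ hu0 (not_lt.1 hle) 2
        linarith
      obtain ⟨H, hH⟩ : ∃ H, H = γ.κ x - γ.N x := ⟨_, rfl⟩
      have hH4 : 4 ≤ H := by linarith
      have hforce : -(γ.U x * (γ.w x * (1 - γ.w x ^ 2) / γ.r x)) ≤ u * (1 + 3 / 2 * u + H) := by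
        calc -(γ.U x * (γ.w x * (1 - γ.w x ^ 2) / γ.r x))
            ≤ |γ.U x * (γ.w x * (1 - γ.w x ^ 2) / γ.r x)| := neg_le_abs _
          _ = u * (|γ.w x| * (|1 - γ.w x ^ 2| / γ.r x)) := by
            rw [abs_mul, abs_div, abs_mul, abs_of_pos hr, ← hu, mul_div_assoc]
          _ ≤ u * (1 * (1 + 3 / 2 * u + H)) := by
            rw [hu, hH]
            gcongr
          _ = _ := by ring
      -- Friction beats force: `H(u - 1) ≥ 4(u - 1) ≥ 1 + 3u/2` for `H ≥ 4` and `u ≥ 2`.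
      have hfin : 0 ≤ u * (H * u - (1 + 3 / 2 * u + H)) := by
        refine mul_nonneg hu0 ?_
        nlinarith
      simp only [zero_mul, Nat.cast_ofNat, Nat.reduceSub, pow_one]
      have e : -(γ.κ x - γ.N x) * γ.U x - γ.w x * (1 - γ.w x ^ 2) / γ.r x =
        -(H * γ.U x) - γ.w x * (1 - γ.w x ^ 2) / γ.r x := by rw [hH]; ring
      rw [e]
      nlinarith) t (right_mem_Icc.2 hst)
  have hB0 : 0 ≤ B := by linarith
  exact abs_le_of_sq_le_sq (by linarith) hB0

/-- Conditions at one time that force an orbit to crash. -/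
structure CrashTrap (γ : PhaseCurve) (s B : ℝ) : Prop where
  N_lt : γ.N s < -4
  N_lt_zeta : γ.N s < -γ.ζ s
  two_le : 2 ≤ B
  U_lt : |γ.U s| < B
  w_lt : |γ.w s| + B / 4 * γ.r s < 1

theorem CrashTrap.w_lt_one {s t B : ℝ} (hc : CrashTrap γ s B) (h : IsSolution p T γ)
    (hp : p ∈ admissible) (hs0 : 0 ≤ s) (hst : s ≤ t) (ht : (t : EReal) < T) : |γ.w t| < 1 := by
  have hwc := (h.continuousOn_coord ht).2.2.1
  have hB := hc.two_le
  have step : ∀ y ∈ Icc s t, (∀ x ∈ Ico s y, 0 < 1 - |γ.w x|) → 0 < 1 - |γ.w y| := by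
    intro y hy hb
    have hyT := coe_lt_of_le hy.2 ht
    -- The derivative is `r(σU + BN/4)`, nonpositive because `|U| ≤ B` and `N ≤ -4`. The shrinking
    -- radius thus pays for every change of `w`.
    have aux : ∀ σ : ℝ, |σ| = 1 → σ * γ.w y + B / 4 * γ.r y ≤ σ * γ.w s + B / 4 * γ.r s := by
      intro σ hσ
      refine le_of_hasDerivWithinAt_nonpos (f := fun x => σ * γ.w x + B / 4 * γ.r x) hs0 hy.1
        (fun x hx => ((h.eq_w x (hs0.trans hx.1) (coe_lt_of_le (hx.2.trans hy.2) ht)).const_mul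
          σ).add ((h.eq_r x (hs0.trans hx.1) (coe_lt_of_le (hx.2.trans hy.2) ht)).const_mul
          (B / 4))) fun x hx => ?_
      have hxT := coe_lt_of_le hx.2.le hyT
      have hx0 := hs0.trans hx.1.le
      have h1 := h.U_bound hp hs0 hx.1.le hxT hc.N_lt.le hc.N_lt_zeta hB hc.U_lt.le
        fun u hu => by have := hb u ⟨hu.1, hu.2.trans hx.2⟩; linarith
      have h2 : γ.N x ≤ -4 := (h.N_le_of_lt hp hs0 hx.1.le hxT hc.N_lt_zeta).trans hc.N_lt.le
      have h3 := h.r_pos x hx0 hxT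
      have h4 : σ * γ.U x ≤ B := by
        calc σ * γ.U x ≤ |σ * γ.U x| := le_abs_self _
          _ = |γ.U x| := by rw [abs_mul, hσ, one_mul]
          _ ≤ B := h1
      have h5 : γ.r x * (σ * γ.U x + B / 4 * γ.N x) ≤ 0 :=
        mul_nonpos_of_nonneg_of_nonpos h3.le (by nlinarith)
      linarith
    have hr := h.r_pos y (hs0.trans hy.1) hyT
    have hBr : 0 < B / 4 * γ.r y := by positivity
    have h1 := aux 1 (by norm_num)
    have h2 := aux (-1) (by norm_num)
    have h3 := hc.w_lt
    have h4 := neg_abs_le (γ.w s)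
    have h5 := le_abs_self (γ.w s)
    have h6 : |γ.w y| < 1 := abs_lt.2 ⟨by linarith, by linarith⟩
    linarith
  have := pos_of_continuous_induction (f := fun x => 1 - |γ.w x|)
    (continuousOn_const.sub (hwc.mono (Icc_subset_Icc_left hs0)).abs) step t
    (right_mem_Icc.2 hst)
  linarith

theorem CrashTrap.U_le {s t B : ℝ} (hc : CrashTrap γ s B) (h : IsSolution p T γ)
    (hp : p ∈ admissible) (hs0 : 0 ≤ s) (hst : s ≤ t) (ht : (t : EReal) < T) : |γ.U t| ≤ B :=
  h.U_bound hp hs0 hst ht hc.N_lt.le hc.N_lt_zeta hc.two_le hc.U_lt.le fun _ hx =>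
    (hc.w_lt_one h hp hs0 hx.1 (coe_lt_of_le hx.2.le ht)).le

/-- A crashing orbit enters the trapping region. -/
theorem exists_crashTrap {ρend : ℝ} (h : IsOrbit p (ρend : EReal) γ) (hp : p ∈ admissible)
    (hw : ∀ ρ, 0 ≤ ρ → ρ < ρend → |γ.w ρ| ≤ 1) :
    ∃ s B, 0 ≤ s ∧ s < ρend ∧ CrashTrap γ s B := by
  have hsol := h.1
  have hζ0 := hsol.zeta_nonneg le_rfl hsol.pos
  obtain ⟨s₁, hs₁, hN₁⟩ := h.exists_N_lt hp (-(4 + γ.ζ 0))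
  have dom : ∀ {t : ℝ}, t < ρend → (t : EReal) < ρend := fun ht => by exact_mod_cast ht
  have hζ₁ := hsol.zeta_antitone le_rfl hs₁.1 (dom hs₁.2)
  obtain ⟨B, hBdef⟩ : ∃ B, B = max |γ.U s₁| 2 := ⟨_, rfl⟩
  have hB2 : 2 ≤ B := hBdef ▸ le_max_right _ _
  have hU : ∀ t, s₁ ≤ t → t < ρend → |γ.U t| ≤ B := fun t h1 h2 =>
    hsol.U_bound hp hs₁.1 h1 (dom h2) (by linarith) (by linarith) hB2 (hBdef ▸ le_max_left _ _)
      fun x hx => hw x (hs₁.1.trans hx.1) (hx.2.trans h2)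
  -- The trap uses `B + 1` to make `|U| < B + 1` strict. If its last condition failed, `1 - |w| ≤
  -- (B+1)r/4` would bound the tension by `B + 1`, and the constraint would give `N² ≤ (B+1)² + ζ²`,
  -- against this choice of `s`.
  obtain ⟨s, hs, hs0, hNs⟩ := h.exists_N_lt_after hp (-((B + 1) + γ.ζ 0 + 4)) hs₁.2
  have hsT := dom hs.2
  have hζs := hsol.zeta_antitone le_rfl hs0 hsT
  have hζs0 := hsol.zeta_nonneg hs0 hsT
  refine ⟨s, B + 1, hs0, hs.2, ⟨by linarith, by linarith, by linarith,
    by linarith [hU s hs.1.le hs.2], ?_⟩⟩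
  by_contra hge
  rw [not_lt] at hge
  have hr := hsol.r_pos s hs0 hsT
  have hws := hw s hs0 hs.2
  have hcon := hsol.constraint hp hs0 hsT
  have h1 := mul_nonneg (hsol.kappa_nonneg hs0 hsT) (show 0 ≤ -γ.N s by linarith)
  have h2 : (1 - γ.w s ^ 2) ^ 2 / γ.r s ^ 2 ≤ (B + 1) ^ 2 := by
    rw [div_le_iff₀ (by positivity), ← mul_pow]
    have h3 : 1 - γ.w s ^ 2 = (1 - |γ.w s|) * (1 + |γ.w s|) := by rw [← sq_abs]; ring
    have h4 : 0 ≤ |γ.w s| := abs_nonneg _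
    have h5 : 0 ≤ 1 - γ.w s ^ 2 := by rw [h3]; exact mul_nonneg (by linarith) (by linarith)
    refine pow_le_pow_left₀ h5 ?_ 2
    have h6 : (1 - |γ.w s|) * (1 + |γ.w s|) ≤ (B + 1) / 4 * γ.r s * 2 :=
      mul_le_mul (by linarith) (by linarith) (by linarith) (by positivity)
    have h7 : 0 ≤ (B + 1) * γ.r s := by positivity
    linarith
  have h8 : γ.ζ s ^ 2 ≤ γ.ζ 0 ^ 2 := pow_le_pow_left₀ hζs0 hζs 2
  have h9 : ((B + 1) + γ.ζ 0) ^ 2 ≤ γ.N s ^ 2 := by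
    rw [← neg_sq (γ.N s)]
    exact pow_le_pow_left₀ (by linarith) (by linarith) 2
  have h10 : 0 ≤ (B + 1) * γ.ζ 0 := mul_nonneg (by linarith) hζ0
  linarith [sq_nonneg (γ.U s)]

/-- Deep inside the trapping region `w` stays positive after an upward zero. -/
theorem CrashTrap.pos_after_zero {s a t B : ℝ} (hc : CrashTrap γ s B) (h : IsSolution p T γ)
    (hp : p ∈ admissible) (hs0 : 0 ≤ s) (hsa : s ≤ a) (hat : a < t) (ht : (t : EReal) < T)
    (hN : γ.N a ≤ -(4 * γ.r a + 1 + 3 / 2 * B)) (hw : γ.w a = 0) (hU : 0 < γ.U a) :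
    0 < γ.w t := by
  have ha0 := hs0.trans hsa
  have haT := coe_lt_of_le hat.le ht
  have hNa := h.N_lt_neg_zeta hp hs0 hsa haT hc.N_lt_zeta
  have hrp : ∀ x ∈ Icc a t, 0 < γ.r x := fun x hx =>
    h.r_pos x (ha0.trans hx.1) (coe_lt_of_le hx.2 ht)
  have hwnn : ∀ x ∈ Icc a t, (∀ y ∈ Icc a x, 0 < γ.U y + 2 * γ.w y) → 0 ≤ γ.w x := by
    intro x hx hb
    have := nonpos_of_barrier (f := fun y => -γ.w y) (K := fun _ => 0) ha0
      (fun y hy => (h.eq_w y (ha0.trans hy.1) (coe_lt_of_le (hy.2.trans hx.2) ht)).neg)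
      continuousOn_const (by simp [hw]) (fun y hy hpos => by
        have h1 := hb y (Ioo_subset_Icc_self hy)
        have h2 := hrp y ⟨hy.1.le, hy.2.le.trans hx.2⟩
        have h3 : 0 < γ.r y * γ.U y := mul_pos h2 (by linarith)
        linarith) x (right_mem_Icc.2 hx.1)
    linarith
  obtain ⟨c1, c2, -, -, c5, -⟩ := h.continuousOn_coord ht
  -- For such negative `N` the tension is at most `2(H - 2r)`, where `H = κ - N`. Hence `(U + 2w)' ≥
  -- -(H - 2r)(U + 2w)` while `w ≥ 0`.
  have hf := pos_of_deriv_ge (f := fun x => γ.U x + 2 * γ.w x)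
    (K := fun x => -((γ.κ x - γ.N x) - 2 * γ.r x)) ha0
    (fun x hx => (h.eq_U x (ha0.trans hx.1) (coe_lt_of_le hx.2 ht)).add
      ((h.eq_w x (ha0.trans hx.1) (coe_lt_of_le hx.2 ht)).const_mul 2))
    (((c5.sub c2).sub (continuousOn_const.mul c1)).neg.mono (Icc_subset_Icc_left ha0))
    (by rw [hw]; linarith) fun x hx hb => by
      have hx0 := ha0.trans hx.1.le
      have hxT := coe_lt_of_le hx.2.le ht
      have h1 := hwnn x (Ioo_subset_Icc_self hx) hb
      have h2 := hrp x (Ioo_subset_Icc_self hx)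
      have h3 := h.r_antitone_of_lt hp ha0 le_rfl hx.1.le hxT hNa
      have h4 := h.N_le_of_lt hp ha0 hx.1.le hxT hNa
      have h5 := hc.U_le h hp hs0 (hsa.trans hx.1.le) hxT
      have hNx : γ.N x ≤ 0 := by
        have := hrp a (left_mem_Icc.2 hat.le)
        linarith [hc.two_le]
      have h6 := h.tension_le hp hx0 hxT hNx
      have hκ := h.kappa_nonneg hx0 hxT
      have h7 : (1 - γ.w x ^ 2) / γ.r x ≤ 2 * (γ.κ x - γ.N x) - 4 * γ.r x := by
        refine (div_le_div_of_nonneg_right (le_abs_self _) h2.le).trans (h6.trans ?_)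
        linarith
      have h8 : γ.w x * (1 - γ.w x ^ 2) / γ.r x ≤ γ.w x * (2 * (γ.κ x - γ.N x) - 4 * γ.r x) := by
        rw [mul_div_assoc]
        exact mul_le_mul_of_nonneg_left h7 h1
      linarith
  obtain ⟨R, hR⟩ := isCompact_Icc.bddAbove_image c1
  have key := lt_of_hasDerivWithinAt_pos (f := fun x => γ.w x * Real.exp (2 * R * x)) ha0 hat
    (fun x hx => (h.eq_w x (ha0.trans hx.1) (coe_lt_of_le hx.2 ht)).mul
      (((hasDerivAt_id x).const_mul (2 * R)).exp.hasDerivWithinAt)) fun x hx => by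
    have hx' := Ioo_subset_Icc_self hx
    have h1 := hf x hx'
    have h2 := hrp x hx'
    have h3 : γ.r x ≤ R := hR (mem_image_of_mem γ.r ⟨ha0.trans hx.1.le, hx.2.le⟩)
    have h4 := hwnn x hx' fun y hy => hf y ⟨hy.1, hy.2.trans hx.2.le⟩
    have h5 : 0 < γ.r x * (γ.U x + 2 * γ.w x) := mul_pos h2 h1
    have h6 : γ.r x * γ.w x ≤ R * γ.w x := mul_le_mul_of_nonneg_right h3 h4
    have h7 : 0 < (γ.r x * γ.U x + 2 * R * γ.w x) * Real.exp (2 * R * x) :=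
      mul_pos (by linarith) (Real.exp_pos _)
    simp only [id]
    linarith
  simp only [hw, zero_mul] at key
  exact pos_of_mul_pos_left key (Real.exp_pos _).le

theorem CrashTrap.reflect {s B : ℝ} (hc : CrashTrap γ s B) : CrashTrap γ.reflect s B where
  N_lt := hc.N_lt
  N_lt_zeta := hc.N_lt_zeta
  two_le := hc.two_le
  U_lt := by simpa [PhaseCurve.reflect] using hc.U_lt
  w_lt := by simpa [PhaseCurve.reflect] using hc.w_lt

theorem CrashTrap.ne_zero_after_zero {s a t B : ℝ} (hc : CrashTrap γ s B) (h : IsSolution p T γ)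
    (hp : p ∈ admissible) (hp0 : p.2 ≠ 0) (hs0 : 0 ≤ s) (hsa : s ≤ a) (hat : a < t)
    (ht : (t : EReal) < T) (hN : γ.N a ≤ -(4 * γ.r a + 1 + 3 / 2 * B)) (hw : γ.w a = 0) :
    γ.w t ≠ 0 := by
  rcases lt_or_gt_of_ne (h.U_ne_zero hp0 (hs0.trans hsa) (coe_lt_of_le hat.le ht) hw) with hU | hU
  · have := hc.reflect.pos_after_zero h.reflect (reflectData_mem_admissible hp) hs0 hsa hat ht hN
      (by simp [PhaseCurve.reflect, hw]) (by simpa [PhaseCurve.reflect] using hU)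
    intro h0
    simp [PhaseCurve.reflect, h0] at this
  · exact (hc.pos_after_zero h hp hs0 hsa hat ht hN hw hU).ne'

/-- An orbit that enters the trapping region without having left `|w| ≤ 1` is crashing. -/
theorem mem_crashing_of_trap (h : IsOrbit p T γ) (hp : p ∈ admissible) (hp0 : p.2 ≠ 0) {s B : ℝ}
    (hs0 : 0 ≤ s) (hs : (s : EReal) < T) (hc : CrashTrap γ s B) : p ∈ crashing := by
  obtain ⟨ρend, rfl, hsing⟩ := h.singular_of_N_lt hp hs0 hs hc.N_lt_zeta
  have hsT : s < ρend := by exact_mod_cast hs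
  have dom : ∀ {t : ℝ}, t < ρend → (t : EReal) < ρend := fun ht => by exact_mod_cast ht
  have hw : ∀ ρ, 0 ≤ ρ → ρ < ρend → |γ.w ρ| ≤ 1 := by
    intro ρ h0 hρ
    by_contra hgt
    rw [not_le] at hgt
    rcases le_total ρ s with hle | hle
    · exact absurd (h.1.exit_persists_abs hp h0 hle hs hgt)
        (not_lt.2 (hc.w_lt_one h.1 hp hs0 le_rfl hs).le)
    · exact absurd hgt (not_lt.2 (hc.w_lt_one h.1 hp hs0 hle (dom hρ)).le)
  -- After `s₂` any zero is the last one, so all zeros lie in a compact interval, where simplicity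
  -- makes them finite in number.
  obtain ⟨s₂, hs₂, h0₂, hN₂⟩ := h.exists_N_lt_after hp (-(4 * γ.r s + 1 + 3 / 2 * B)) hsT
  have hN : ∀ a, s₂ ≤ a → a < ρend → γ.N a ≤ -(4 * γ.r a + 1 + 3 / 2 * B) := by
    intro a h1 h2
    have h3 := h.1.r_antitone_of_lt hp hs0 le_rfl (hs₂.1.le.trans h1) (dom h2) hc.N_lt_zeta
    have h4 := h.1.N_le_of_lt hp h0₂ h1 (dom h2)
      (h.1.N_lt_neg_zeta hp hs0 hs₂.1.le (dom hs₂.2) hc.N_lt_zeta)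
    linarith
  have hfin : {ρ : ℝ | 0 < ρ ∧ (ρ : EReal) < (ρend : EReal) ∧ γ.w ρ = 0}.Finite := by
    by_cases hex : ∃ a, s₂ ≤ a ∧ a < ρend ∧ γ.w a = 0
    · obtain ⟨a, ha1, ha2, ha3⟩ := hex
      refine (h.1.finite_zeros hp0 (dom ha2)).subset fun x hx => ⟨⟨hx.1.le, ?_⟩, hx.2.2⟩
      by_contra hgt
      exact hc.ne_zero_after_zero h.1 hp hp0 hs0 (hs₂.1.le.trans ha1) (not_le.1 hgt) hx.2.1
        (hN a ha1 ha2) ha3 hx.2.2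
    · refine (h.1.finite_zeros hp0 (dom hs₂.2)).subset fun x hx => ⟨⟨hx.1.le, ?_⟩, hx.2.2⟩
      by_contra hgt
      exact hex ⟨x, (not_le.1 hgt).le, by exact_mod_cast hx.2.1, hx.2.2⟩
  obtain ⟨n, hn⟩ := ENat.ne_top_iff_exists.1 (Set.encard_ne_top_iff.2 hfin)
  exact mem_iUnion.2 ⟨n, hp, ρend, γ, hsing, hw, hn.symm⟩

end Crash

/-! ### Stability of the number of simple zeros -/

theorem exists_sign (x : ℝ) : ∃ σ : ℝ, |σ| = 1 ∧ σ * x = |x| := by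
  rcases abs_cases x with ⟨h, -⟩ | ⟨h, -⟩
  · exact ⟨1, by norm_num, by rw [h, one_mul]⟩
  · exact ⟨-1, by norm_num, by rw [h]; ring⟩

/-- The number of zeros in `(0, b]` of a function with simple zeros is stable under
perturbations that are small together with their derivatives. -/
theorem encard_zeros_stable {f f' : ℝ → ℝ} {b : ℝ} (hb : 0 ≤ b)
    (hd : ∀ t ∈ Icc 0 b, HasDerivWithinAt f (f' t) (Ici 0) t) (hf' : ContinuousOn f' (Icc 0 b))
    (hsimple : ∀ t ∈ Icc 0 b, f t = 0 → f' t ≠ 0) (hfb : f b ≠ 0)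
    (hfin : {t ∈ Icc 0 b | f t = 0}.Finite) :
    ∃ ε > 0, ∀ g g' : ℝ → ℝ, (∀ t ∈ Icc 0 b, HasDerivWithinAt g (g' t) (Ici 0) t) →
      (∀ t ∈ Icc 0 b, |g t - f t| < ε ∧ |g' t - f' t| < ε) → (f 0 = 0 → g 0 = 0) →
      {t : ℝ | 0 < t ∧ t ≤ b ∧ g t = 0}.encard = {t : ℝ | 0 < t ∧ t ≤ b ∧ f t = 0}.encard := by
  have hf := continuousOn_of_hasDerivWithinAt_Ici le_rfl hd
  have hne : (Icc 0 b).Nonempty := nonempty_Icc.2 hb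
  -- The margin `3m` allows one `m` for the oscillation of `f'` near the zero and one `m` for the
  -- perturbation of the derivative.
  obtain ⟨m, hm, hmin⟩ : ∃ m > 0, ∀ t ∈ Icc 0 b, f t = 0 → 3 * m ≤ |f' t| := by
    obtain ⟨t₀, ht₀, hmin⟩ := isCompact_Icc.exists_isMinOn hne (hf.abs.add hf'.abs)
    have hpos : 0 < |f t₀| + |f' t₀| := by
      by_cases h0 : f t₀ = 0
      · have := abs_pos.2 (hsimple t₀ ht₀ h0)
        have := abs_nonneg (f t₀)
        linarith
      · have := abs_pos.2 h0
        have := abs_nonneg (f' t₀)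
        linarith
    refine ⟨(|f t₀| + |f' t₀|) / 3, by linarith, fun t ht h0 => ?_⟩
    have : |f t₀| + |f' t₀| ≤ |f t| + |f' t| := hmin ht
    rw [h0, abs_zero] at this
    linarith
  obtain ⟨δ, hδ, huc⟩ := Metric.uniformContinuousOn_iff.1
    (isCompact_Icc.uniformContinuousOn_of_continuous hf') m hm
  -- strict monotonicity near a zero
  have hmono : ∀ z ∈ Icc 0 b, f z = 0 → ∃ σ : ℝ, |σ| = 1 ∧
      ∀ g g' : ℝ → ℝ, (∀ t ∈ Icc 0 b, HasDerivWithinAt g (g' t) (Ici 0) t) →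
      (∀ t ∈ Icc 0 b, |g' t - f' t| < m) → ∀ u v, 0 ≤ u → u < v → v ≤ b → z - δ < u → v < z + δ →
      σ * g u < σ * g v := by
    intro z hz hz0
    obtain ⟨σ, hσ, hσz⟩ := exists_sign (f' z)
    refine ⟨σ, hσ, fun g g' hg hclose u v hu huv hv hzu hvz => ?_⟩
    refine lt_of_hasDerivWithinAt_pos (f := fun t => σ * g t) hu huv
      (fun t ht => (hg t ⟨hu.trans ht.1, ht.2.trans hv⟩).const_mul σ) fun t ht => ?_
    have htb : t ∈ Icc 0 b := ⟨hu.trans ht.1.le, ht.2.le.trans hv⟩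
    have h1 := hclose t htb
    have h2 := huc t htb z hz (by rw [Real.dist_eq, abs_lt]; constructor <;> linarith [ht.1, ht.2])
    rw [Real.dist_eq] at h2
    have h3 := hmin z hz hz0
    have h4 : |σ * (g' t - f' z)| < 2 * m := by
      rw [abs_mul, hσ, one_mul]
      calc |g' t - f' z| ≤ |g' t - f' t| + |f' t - f' z| := abs_sub_le _ _ _
        _ < 2 * m := by linarith
    have h5 := (abs_lt.1 h4).1
    have h6 : σ * g' t = σ * (g' t - f' z) + σ * f' z := by ring
    rw [h6, hσz]
    linarith
  have hsep : ∀ z ∈ Icc 0 b, f z = 0 → ∀ z' ∈ Icc 0 b, f z' = 0 → |z - z'| < δ → z = z' := by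
    intro z hz hz0 z' hz' hz0' hzz'
    obtain ⟨σ, hσ, hinc⟩ := hmono z hz hz0
    have hinc' := hinc f f' hd fun t _ => by simpa using hm
    rw [abs_lt] at hzz'
    rcases lt_trichotomy z z' with h | h | h
    · have := hinc' z z' hz.1 h hz'.2 (by linarith) (by linarith)
      simp [hz0, hz0'] at this
    · exact h
    · have := hinc' z' z hz'.1 h hz.2 (by linarith) (by linarith)
      simp [hz0, hz0'] at this
  -- away from the zeros the function is bounded away from zero
  obtain ⟨μ, hμ, hfar⟩ : ∃ μ > 0, ∀ t ∈ Icc 0 b,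
      (∀ z ∈ Icc 0 b, f z = 0 → δ / 2 ≤ |t - z|) → μ ≤ |f t| := by
    obtain ⟨K, hK⟩ : ∃ K, K = {t ∈ Icc 0 b | ∀ z ∈ Icc 0 b, f z = 0 → δ / 2 ≤ |t - z|} :=
      ⟨_, rfl⟩
    have hKc : IsCompact K := by
      refine isCompact_Icc.of_isClosed_subset ?_ (hK ▸ sep_subset _ _)
      have : K = Icc 0 b ∩ ⋂ z ∈ {z ∈ Icc 0 b | f z = 0}, {t | δ / 2 ≤ |t - z|} := by
        rw [hK]
        ext t
        simp only [mem_inter_iff, mem_iInter, mem_ofPred_eq, and_imp]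
      rw [this]
      exact isClosed_Icc.inter (isClosed_biInter fun z _ =>
        isClosed_le continuous_const ((continuous_id.sub continuous_const).abs))
    have hsub : K ⊆ Icc 0 b := hK ▸ sep_subset _ _
    rcases K.eq_empty_or_nonempty with he | hKne
    · refine ⟨1, one_pos, fun t ht hz => ?_⟩
      have : t ∈ K := hK ▸ ⟨ht, hz⟩
      rw [he] at this
      exact this.elim
    · obtain ⟨t₀, ht₀, hmin₀⟩ := hKc.exists_isMinOn hKne (hf.abs.mono hsub)
      refine ⟨|f t₀|, abs_pos.2 fun h0 => ?_, fun t ht hz => hmin₀ (hK ▸ ⟨ht, hz⟩)⟩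
      have h1 : t₀ ∈ {t ∈ Icc 0 b | ∀ z ∈ Icc 0 b, f z = 0 → δ / 2 ≤ |t - z|} := hK ▸ ht₀
      have := h1.2 t₀ h1.1 h0
      simp only [sub_self, abs_zero] at this
      linarith
  -- a zero of `g` near each zero of `f`
  have hnear : ∀ᶠ ε in 𝓝[>] (0 : ℝ), ∀ z ∈ {t ∈ Icc 0 b | f t = 0}, 0 < z → ∀ g : ℝ → ℝ,
      ContinuousOn g (Icc 0 b) → (∀ t ∈ Icc 0 b, |g t - f t| < ε) →
      ∃ t, 0 < t ∧ t ≤ b ∧ |t - z| < δ / 2 ∧ g t = 0 := by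
    rw [eventually_all_finite hfin]
    intro z hz
    by_cases hz0 : 0 < z
    swap
    · exact Eventually.of_forall fun _ h => absurd h hz0
    have hzb : z < b := lt_of_le_of_ne hz.1.2 fun h => hfb (h ▸ hz.2)
    obtain ⟨σ, hσ, hinc⟩ := hmono z hz.1 hz.2
    have hinc' := hinc f f' hd fun t _ => by simpa using hm
    obtain ⟨u, hu⟩ : ∃ u, u = max (z - δ / 4) (z / 2) := ⟨_, rfl⟩
    obtain ⟨v, hv⟩ : ∃ v, v = min (z + δ / 4) b := ⟨_, rfl⟩
    have hu1 : z - δ / 4 ≤ u := hu ▸ le_max_left _ _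
    have hu2 : z / 2 ≤ u := hu ▸ le_max_right _ _
    have hu3 : u < z := by rw [hu]; exact max_lt (by linarith) (by linarith)
    have hv1 : v ≤ z + δ / 4 := hv ▸ min_le_left _ _
    have hv2 : v ≤ b := hv ▸ min_le_right _ _
    have hv3 : z < v := by rw [hv]; exact lt_min (by linarith) hzb
    have hu0 : 0 < u := by linarith
    have hfu := hinc' u z hu0.le hu3 hz.1.2 (by linarith) (by linarith)
    have hfv := hinc' z v hz.1.1 hv3 hv2 (by linarith) (by linarith)
    rw [hz.2, mul_zero] at hfu hfv
    have hε0 : 0 < min (-(σ * f u)) (σ * f v) := lt_min (by linarith) hfv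
    filter_upwards [Ioo_mem_nhdsGT hε0] with ε hε _ g hgc hg
    have hub : u ∈ Icc 0 b := ⟨hu0.le, by linarith⟩
    have hvb : v ∈ Icc 0 b := ⟨by linarith, hv2⟩
    have bound : ∀ t ∈ Icc 0 b, |σ * g t - σ * f t| < ε := fun t ht => by
      rw [← mul_sub, abs_mul, hσ, one_mul]
      exact hg t ht
    have h1 := (abs_lt.1 (bound u hub)).2
    have h2 := (abs_lt.1 (bound v hvb)).1
    have h3 : ε < -(σ * f u) := hε.2.trans_le (min_le_left _ _)
    have h4 : ε < σ * f v := hε.2.trans_le (min_le_right _ _)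
    obtain ⟨t, ht, htz⟩ := intermediate_value_Icc (hu3.trans hv3).le
      ((continuousOn_const (c := σ)).mul (hgc.mono (Icc_subset_Icc hub.1 hv2)))
      (show (0 : ℝ) ∈ Icc (σ * g u) (σ * g v) from ⟨by linarith, by linarith⟩)
    have hσ0 : σ ≠ 0 := fun h => by simp [h] at hσ
    refine ⟨t, hu0.trans_le ht.1, ht.2.trans hv2, ?_, (mul_eq_zero.1 htz).resolve_left hσ0⟩
    rw [abs_lt]
    constructor <;> linarith [ht.1, ht.2]
  obtain ⟨ε, hεnear, hε0, hεlt⟩ := (hnear.and (Ioo_mem_nhdsGT (lt_min hm hμ))).exists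
  refine ⟨ε, hε0, fun g g' hg hclose hg0 => ?_⟩
  have hgc := continuousOn_of_hasDerivWithinAt_Ici le_rfl hg
  have hεm : ε < m := hεlt.trans_le (min_le_left _ _)
  have hεμ : ε < μ := hεlt.trans_le (min_le_right _ _)
  have hclose' : ∀ t ∈ Icc 0 b, |g' t - f' t| < m := fun t ht => (hclose t ht).2.trans hεm
  -- zeros of `g` within `δ/2` of the same zero of `f` coincide
  have huniq : ∀ z ∈ Icc 0 b, f z = 0 → ∀ t ∈ Icc 0 b, ∀ t' ∈ Icc 0 b, g t = 0 → g t' = 0 →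
      |t - z| < δ / 2 → |t' - z| < δ / 2 → t = t' := by
    intro z hz hz0 t ht t' ht' hgt hgt' h1 h2
    obtain ⟨σ, hσ, hinc⟩ := hmono z hz hz0
    rw [abs_lt] at h1 h2
    rcases lt_trichotomy t t' with h | h | h
    · have := hinc g g' hg hclose' t t' ht.1 h ht'.2 (by linarith) (by linarith)
      simp [hgt, hgt'] at this
    · exact h
    · have := hinc g g' hg hclose' t' t ht'.1 h ht.2 (by linarith) (by linarith)
      simp [hgt, hgt'] at this
  have hto : ∀ t, 0 < t → t ≤ b → g t = 0 → ∃ z, 0 < z ∧ z ≤ b ∧ f z = 0 ∧ |t - z| < δ / 2 := by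
    intro t ht0 htb hgt
    have ht : t ∈ Icc 0 b := ⟨ht0.le, htb⟩
    obtain ⟨z, hz, hz0, hzt⟩ : ∃ z ∈ Icc 0 b, f z = 0 ∧ |t - z| < δ / 2 := by
      by_contra! hcon
      have h1 := hfar t ht hcon
      have h2 := (hclose t ht).1
      rw [hgt, zero_sub, abs_neg] at h2
      linarith
    rcases hz.1.eq_or_lt with h | h
    -- A zero of `f` at `0` is not counted. There `g` vanishes as well, and by local uniqueness `g`
    -- has no further zero nearby, so no spurious positive zero appears.
    · subst h
      have := huniq 0 hz hz0 t ht 0 hz hgt (hg0 hz0) hzt (by simpa using hδ)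
      exact absurd this ht0.ne'
    · exact ⟨z, h, hz.2, hz0, hzt⟩
  refine le_antisymm ?_ ?_
  · have : ∀ t : ℝ, ∃ z, (0 < t → t ≤ b → g t = 0 → 0 < z ∧ z ≤ b ∧ f z = 0 ∧ |t - z| < δ / 2) := by
      intro t
      by_cases h : 0 < t ∧ t ≤ b ∧ g t = 0
      · obtain ⟨z, hz⟩ := hto t h.1 h.2.1 h.2.2
        exact ⟨z, fun _ _ _ => hz⟩
      · exact ⟨0, fun h1 h2 h3 => absurd ⟨h1, h2, h3⟩ h⟩
    choose φ hφ using this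
    refine encard_le_encard_of_injOn (f := φ) (fun t ht => ?_) fun t ht t' ht' heq => ?_
    · obtain ⟨h1, h2, h3, -⟩ := hφ t ht.1 ht.2.1 ht.2.2
      exact ⟨h1, h2, h3⟩
    · obtain ⟨h1, h2, h3, h4⟩ := hφ t ht.1 ht.2.1 ht.2.2
      obtain ⟨-, -, -, h4'⟩ := hφ t' ht'.1 ht'.2.1 ht'.2.2
      exact huniq (φ t) ⟨h1.le, h2⟩ h3 t ⟨ht.1.le, ht.2.1⟩ t' ⟨ht'.1.le, ht'.2.1⟩ ht.2.2 ht'.2.2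
        h4 (heq ▸ h4')
  · have : ∀ z : ℝ, ∃ t, (0 < z → z ≤ b → f z = 0 → 0 < t ∧ t ≤ b ∧ |t - z| < δ / 2 ∧ g t = 0) := by
      intro z
      by_cases h : 0 < z ∧ z ≤ b ∧ f z = 0
      · obtain ⟨t, ht⟩ := hεnear z ⟨⟨h.1.le, h.2.1⟩, h.2.2⟩ h.1 g hgc fun t ht => (hclose t ht).1
        exact ⟨t, fun _ _ _ => ht⟩
      · exact ⟨0, fun h1 h2 h3 => absurd ⟨h1, h2, h3⟩ h⟩
    choose φ hφ using this
    refine encard_le_encard_of_injOn (f := φ) (fun z hz => ?_) fun z hz z' hz' heq => ?_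
    · obtain ⟨h1, h2, -, h4⟩ := hφ z hz.1 hz.2.1 hz.2.2
      exact ⟨h1, h2, h4⟩
    · obtain ⟨-, -, h3, -⟩ := hφ z hz.1 hz.2.1 hz.2.2
      obtain ⟨-, -, h3', -⟩ := hφ z' hz'.1 hz'.2.1 hz'.2.2
      refine hsep z ⟨hz.1.le, hz.2.1⟩ hz.2.2 z' ⟨hz'.1.le, hz'.2.1⟩ hz'.2.2 ?_
      rw [← heq, abs_lt] at h3'
      rw [abs_lt] at h3 ⊢
      constructor <;> linarith

/-! ### Stability of escaping and crashing data -/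

/-- The implication `w₀ = 0 → y.1 = 0` holds on the `U₀`-slice, where `y.1 = w₀`, and is vacuous on
the `w₀`-slice when `w₀ ≠ 0`. One neighbourhood statement therefore serves both. -/
theorem slicesEventuallySubset_of_eventually {r0 : ℝ} {x0 : ℝ × ℝ} {Y : Set (ℝ × ℝ)}
    (h : ∀ᶠ y in 𝓝 x0, y ∈ slice admissible r0 → (x0.1 = 0 → y.1 = 0) → y ∈ Y) :
    SlicesEventuallySubset r0 x0 Y := by
  obtain ⟨δ, hδ, hball⟩ := Metric.eventually_nhds_iff.1 h
  have key : ∀ y : ℝ × ℝ, |y.1 - x0.1| < δ → |y.2 - x0.2| < δ → dist y x0 < δ := fun y h1 h2 => by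
    rw [Prod.dist_eq]
    exact max_lt h1 h2
  refine ⟨δ / 2, by linarith, fun d hd hdδ => ⟨fun y hy => ?_, fun hne y hy => ?_⟩⟩
  · obtain ⟨hy1, hy2, hy3⟩ := hy
    refine hball (key y ?_ (by linarith)) hy1 fun h0 => hy2.trans h0
    rw [hy2, sub_self, abs_zero]
    exact hδ
  · obtain ⟨hy1, hy2, hy3⟩ := hy
    refine hball (key y (by linarith) ?_) hy1 fun h0 => absurd h0 hne
    rw [hy2, sub_self, abs_zero]
    exact hδ

section Stability

variable {r0 : ℝ} {x0 : ℝ × ℝ} {T : EReal} {γ : PhaseCurve}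

theorem IsSolution.eventually_state_mem (h : IsSolution (r0, x0.1, x0.2) T γ) {τ : ℝ}
    (hτ0 : 0 ≤ τ) (hτ : (τ : EReal) < T) {O : Set Phase} (hO : IsOpen O) (hmem : state γ τ ∈ O) :
    ∀ᶠ y in 𝓝 x0, ∀ (T' : EReal) (γ' : PhaseCurve), IsOrbit (r0, y.1, y.2) T' γ' →
      (τ : EReal) < T' ∧ state γ' τ ∈ O := by
  obtain ⟨ε, hε, hball⟩ := Metric.isOpen_iff.1 hO _ hmem
  filter_upwards [h.eventually_near hτ0 hτ hε] with y hy T' γ' hγ'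
  obtain ⟨h1, h2⟩ := hy T' γ' hγ'
  refine ⟨h1, hball ?_⟩
  rw [Metric.mem_ball, dist_pi_lt_iff hε]
  exact fun i => h2 τ (right_mem_Icc.2 hτ0) i

theorem IsSolution.eventually_encard_zeros (h : IsSolution (r0, x0.1, x0.2) T γ) (hx0 : x0 ≠ 0)
    {τ : ℝ} (hτ0 : 0 ≤ τ) (hτ : (τ : EReal) < T) (hw : γ.w τ ≠ 0) :
    ∀ᶠ y in 𝓝 x0, (x0.1 = 0 → y.1 = 0) → ∀ (T' : EReal) (γ' : PhaseCurve),
      IsOrbit (r0, y.1, y.2) T' γ' → (τ : EReal) < T' ∧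
        {t : ℝ | 0 < t ∧ t ≤ τ ∧ γ'.w t = 0}.encard =
          {t : ℝ | 0 < t ∧ t ≤ τ ∧ γ.w t = 0}.encard := by
  obtain ⟨c1, c2, c3, c4, c5, c6⟩ := h.continuousOn_coord hτ
  obtain ⟨ε, hε, hstab⟩ := encard_zeros_stable hτ0
    (fun t ht => h.eq_w t ht.1 (coe_lt_of_le ht.2 hτ)) (c1.mul c4)
    (fun t ht h0 => mul_ne_zero (h.r_pos t ht.1 (coe_lt_of_le ht.2 hτ)).ne'
      (h.U_ne_zero hx0 ht.1 (coe_lt_of_le ht.2 hτ) h0)) hw (h.finite_zeros hx0 hτ)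
  obtain ⟨B₁, hB₁⟩ := isCompact_Icc.exists_bound_of_continuousOn c1
  obtain ⟨B₂, hB₂⟩ := isCompact_Icc.exists_bound_of_continuousOn c4
  have hB₁0 : 0 ≤ B₁ := (norm_nonneg _).trans (hB₁ 0 (left_mem_Icc.2 hτ0))
  have hB₂0 : 0 ≤ B₂ := (norm_nonneg _).trans (hB₂ 0 (left_mem_Icc.2 hτ0))
  -- Closeness `η ≤ 1` in each coordinate changes the product `rU` by at most `η(1 + B₁ + B₂)`.
  obtain ⟨η, hη⟩ : ∃ η, η = min 1 (ε / (B₁ + B₂ + 2)) := ⟨_, rfl⟩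
  have hη0 : 0 < η := by rw [hη]; positivity
  have hη1 : η ≤ 1 := hη ▸ min_le_left _ _
  have hη2 : η * (B₁ + B₂ + 2) ≤ ε := by
    rw [← le_div_iff₀ (by positivity), hη]
    exact min_le_right _ _
  filter_upwards [h.eventually_near hτ0 hτ hη0] with y hy hy0 T' γ' hγ'
  obtain ⟨h1, h2⟩ := hy T' γ' hγ'
  refine ⟨h1, hstab γ'.w (fun t => γ'.r t * γ'.U t)
    (fun t ht => hγ'.1.eq_w t ht.1 (coe_lt_of_le ht.2 h1)) (fun t ht => ?_) fun h0 => ?_⟩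
  · have er : |γ'.r t - γ.r t| < η := h2 t ht 0
    have ew : |γ'.w t - γ.w t| < η := h2 t ht 2
    have eU : |γ'.U t - γ.U t| < η := h2 t ht 3
    have b1 : |γ.r t| ≤ B₁ := hB₁ t ht
    have b2 : |γ.U t| ≤ B₂ := hB₂ t ht
    refine ⟨ew.trans_le (le_trans ?_ hη2), lt_of_lt_of_le ?_ hη2⟩
    · nlinarith
    · have e : γ'.r t * γ'.U t - γ.r t * γ.U t =
        (γ'.r t - γ.r t) * (γ'.U t - γ.U t) + (γ'.r t - γ.r t) * γ.U t +
          γ.r t * (γ'.U t - γ.U t) := by ring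
      rw [e]
      have t1 := abs_add_three ((γ'.r t - γ.r t) * (γ'.U t - γ.U t)) ((γ'.r t - γ.r t) * γ.U t)
        (γ.r t * (γ'.U t - γ.U t))
      rw [abs_mul, abs_mul, abs_mul] at t1
      have t2 : |γ'.r t - γ.r t| * |γ'.U t - γ.U t| ≤ η * 1 :=
        mul_le_mul er.le (eU.le.trans hη1) (abs_nonneg _) hη0.le
      have t3 : |γ'.r t - γ.r t| * |γ.U t| ≤ η * B₂ :=
        mul_le_mul er.le b2 (abs_nonneg _) hη0.le
      have t4 : |γ.r t| * |γ'.U t - γ.U t| ≤ B₁ * η :=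
        mul_le_mul b1 eU.le (abs_nonneg _) hB₁0
      linarith
  · rw [h.init_w] at h0
    rw [hγ'.1.init_w]
    exact hy0 h0

end Stability

theorem IsSolution.numZeros_of_exit {p : ℝ × ℝ × ℝ} {T : EReal} {γ : PhaseCurve}
    (h : IsSolution p T γ) (hp : p ∈ admissible) {s : ℝ} (hs0 : 0 ≤ s) (hs : (s : EReal) < T)
    (hw : 1 < |γ.w s|) :
    numZeros T γ = {t : ℝ | 0 < t ∧ t ≤ s ∧ γ.w t = 0}.encard := by
  unfold numZeros
  congr 1
  ext t
  constructor
  · rintro ⟨h1, h2, h3⟩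
    refine ⟨h1, ?_, h3⟩
    by_contra hgt
    have := h.exit_persists_abs hp hs0 (not_le.1 hgt).le h2 hw
    rw [h3, abs_zero] at this
    linarith
  · rintro ⟨h1, h2, h3⟩
    exact ⟨h1, coe_lt_of_le h2 hs, h3⟩

theorem mem_escaping_of_exit {p : ℝ × ℝ × ℝ} {T : EReal} {γ : PhaseCurve} (h : IsOrbit p T γ)
    (hp : p ∈ admissible) {s : ℝ} (hs0 : 0 ≤ s) (hs : (s : EReal) < T) (hw : 1 < |γ.w s|) {n : ℕ}
    (hn : {t : ℝ | 0 < t ∧ t ≤ s ∧ γ.w t = 0}.encard = n) : p ∈ escaping n := by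
  have hz := h.1.numZeros_of_exit hp hs0 hs hw
  obtain ⟨ρend, rfl, hsing⟩ := h.singular_of_exit hp hs0 hs hw
  exact ⟨hp, ρend, γ, hsing, ⟨s, hs0, by exact_mod_cast hs, hw⟩, hz.trans hn⟩

section Main

variable {r0 : ℝ} {x0 : ℝ × ℝ}

theorem eventually_escaping {n : ℕ} (hx0 : x0 ∈ slice (escaping n) r0) :
    ∀ᶠ y in 𝓝 x0, y ∈ slice admissible r0 → (x0.1 = 0 → y.1 = 0) →
      y ∈ slice (escaping n) r0 := by
  obtain ⟨hp, ρend, γ, hsing, ⟨s, hs0, hs, hw⟩, hn⟩ := hx0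
  have h := hsing.1
  have hsT : (s : EReal) < ρend := by exact_mod_cast hs
  have hne : x0 ≠ 0 := fun h0 => by
    have := h.1.w_eq_zero (show (r0, x0.1, x0.2).2 = 0 from h0) hs0 hsT
    rw [this, abs_zero] at hw
    linarith
  have hws : γ.w s ≠ 0 := fun h0 => by
    rw [h0, abs_zero] at hw
    linarith
  have hopen : IsOpen {x : Phase | 1 < |x 2|} :=
    isOpen_lt continuous_const (continuous_apply 2).abs
  filter_upwards [h.1.eventually_state_mem hs0 hsT hopen hw,
    h.1.eventually_encard_zeros hne hs0 hsT hws] with y hy1 hy2 hadm hy0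
  obtain ⟨T', γ', hγ'⟩ := exists_isOrbit (p := (r0, y.1, y.2)) hadm.1
  obtain ⟨hT', hw'⟩ := hy1 T' γ' hγ'
  refine mem_escaping_of_exit hγ' hadm hs0 hT' hw' ?_
  rw [(hy2 hy0 T' γ' hγ').2, ← h.1.numZeros_of_exit hp hs0 hsT hw, hn]

/-- Entering the trap is an open condition. Only the finiteness of the zero count is needed, so `w₀`
may vary freely, even near `0`. -/
theorem eventually_crashing (hx0 : x0 ∈ slice crashing r0 \ {0}) :
    ∀ᶠ y in 𝓝 x0, y ∈ slice admissible r0 → y ∈ slice crashing r0 \ {0} := by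
  obtain ⟨hcr, hne⟩ := hx0
  obtain ⟨n, hp, ρend, γ, hsing, hw, -⟩ := mem_iUnion.1 hcr
  have h := hsing.1
  obtain ⟨s, B, hs0, hs, hc⟩ := exists_crashTrap h hp hw
  have hsT : (s : EReal) < ρend := by exact_mod_cast hs
  have hopen : IsOpen {x : Phase | x 1 < -4 ∧ x 1 < -x 5 ∧ |x 3| < B ∧
      |x 2| + B / 4 * x 0 < 1} := by
    refine (isOpen_lt (continuous_apply 1) continuous_const).inter
      ((isOpen_lt (continuous_apply 1) (continuous_apply 5).neg).inter
      ((isOpen_lt (continuous_apply 3).abs continuous_const).inter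
      (isOpen_lt ((continuous_apply 2).abs.add (continuous_const.mul (continuous_apply 0)))
        continuous_const)))
  filter_upwards [h.1.eventually_state_mem hs0 hsT hopen
    ⟨hc.N_lt, hc.N_lt_zeta, hc.U_lt, hc.w_lt⟩, isOpen_ne.mem_nhds hne] with y hy hy0 hadm
  obtain ⟨T', γ', hγ'⟩ := exists_isOrbit (p := (r0, y.1, y.2)) hadm.1
  obtain ⟨hT', h1, h2, h3, h4⟩ := hy T' γ' hγ'
  exact ⟨mem_crashing_of_trap hγ' hadm hy0 hs0 hT' ⟨h1, h2, hc.two_le, h3, h4⟩, hy0⟩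

end Main

/-! ### Global orbits -/

section Global

variable {p : ℝ × ℝ × ℝ} {γ : PhaseCurve}

theorem IsOrbit.N_ge (h : IsOrbit p ⊤ γ) (hp : p ∈ admissible) {t : ℝ} (ht : 0 ≤ t) :
    -γ.ζ t ≤ γ.N t := by
  by_contra hN
  obtain ⟨ρend, h1, -⟩ := h.singular_of_N_lt hp ht (EReal.coe_lt_top t) (not_le.1 hN)
  exact absurd h1 (by simp)

theorem IsSolution.zeta_tendsto (h : IsSolution p ⊤ γ) : Tendsto γ.ζ atTop (𝓝 0) := by
  -- For `t ≥ 2` one has `tκ ≥ 1`, so `tζ` is nonincreasing.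
  have hb : ∀ t, 2 ≤ t → γ.ζ t ≤ 2 * γ.ζ 2 / t := by
    intro t ht
    rw [le_div_iff₀ (by linarith)]
    have := le_of_hasDerivWithinAt_nonpos (f := fun x => x * γ.ζ x)
      (f' := fun x => 1 * γ.ζ x + x * (-γ.κ x * γ.ζ x)) zero_le_two ht
      (fun x hx => (hasDerivAt_id x).hasDerivWithinAt.mul
        (h.eq_ζ x (zero_le_two.trans hx.1) (EReal.coe_lt_top x))) fun x hx => by
        have hx0 : 0 ≤ x := zero_le_two.trans hx.1.le
        have h1 := h.kappa_ge hx0 (EReal.coe_lt_top x)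
        have h2 := h.zeta_nonneg hx0 (EReal.coe_lt_top x)
        rw [div_le_iff₀ (by linarith)] at h1
        have h3 : 1 ≤ x * γ.κ x := by
          have h4 := h.kappa_nonneg hx0 (EReal.coe_lt_top x)
          have : (1 : ℝ) / 2 ≤ γ.κ x := by nlinarith [hx.1]
          nlinarith [hx.1]
        nlinarith
    linarith
  refine squeeze_zero' (g := fun t => 2 * γ.ζ 2 / t) ?_ ?_ (tendsto_const_nhds.div_atTop tendsto_id)
  · filter_upwards [eventually_ge_atTop 0] with t ht
    exact h.zeta_nonneg ht (EReal.coe_lt_top t)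
  · filter_upwards [eventually_ge_atTop 2] with t ht
    exact hb t ht

theorem IsOrbit.exists_r_ge (h : IsOrbit p ⊤ γ) (hp : p ∈ admissible) :
    ∃ c > 0, ∀ t, 1 ≤ t → c ≤ γ.r t := by
  have hs := h.1
  have hr1 := hs.r_pos 1 zero_le_one (EReal.coe_lt_top _)
  refine ⟨γ.r 1 * Real.exp (-2 * γ.ζ 1), mul_pos hr1 (Real.exp_pos _), fun t ht => ?_⟩
  -- For `t ≥ 1` one has `κ ≥ 1/2`, so `(log r - 2ζ)' = N + 2κζ ≥ -ζ + ζ = 0`.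
  have key := le_of_hasDerivWithinAt_nonneg (f := fun x => γ.r x * Real.exp (-2 * γ.ζ x))
    zero_le_one ht (fun x hx => (hs.eq_r x (zero_le_one.trans hx.1) (EReal.coe_lt_top x)).mul
      (((hs.eq_ζ x (zero_le_one.trans hx.1) (EReal.coe_lt_top x)).const_mul (-2)).exp))
    fun x hx => by
      have hx0 : 0 ≤ x := zero_le_one.trans hx.1.le
      have h1 := hs.kappa_ge hx0 (EReal.coe_lt_top x)
      have h2 := hs.zeta_nonneg hx0 (EReal.coe_lt_top x)
      have h3 := h.N_ge hp hx0
      have h4 : 0 < γ.r x * Real.exp (-2 * γ.ζ x) :=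
        mul_pos (hs.r_pos x hx0 (EReal.coe_lt_top x)) (Real.exp_pos _)
      have h5 : (1 : ℝ) / 2 ≤ γ.κ x := by
        rw [div_le_iff₀ (by linarith)] at h1
        have := hs.kappa_nonneg hx0 (EReal.coe_lt_top x)
        nlinarith [hx.1]
      have h6 : 0 ≤ (γ.r x * Real.exp (-2 * γ.ζ x)) * (γ.N x + 2 * (γ.κ x * γ.ζ x)) :=
        mul_nonneg h4.le (by nlinarith)
      linarith
  refine key.trans (mul_le_of_le_one_right (hs.r_pos t (by linarith) (EReal.coe_lt_top t)).le ?_)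
  have := hs.zeta_nonneg (show 0 ≤ t by linarith) (EReal.coe_lt_top t)
  exact Real.exp_le_one_iff.2 (by linarith)

theorem IsSolution.rU_tendsto (h : IsSolution p ⊤ γ) (hw : Tendsto (deriv γ.w) atTop (𝓝 0)) :
    Tendsto (fun t => γ.r t * γ.U t) atTop (𝓝 0) := by
  refine hw.congr' ?_
  filter_upwards [eventually_gt_atTop 0] with t ht
  exact (h.hasDerivAt_w ht (EReal.coe_lt_top t)).deriv

theorem IsOrbit.U_tendsto (h : IsOrbit p ⊤ γ) (hp : p ∈ admissible)
    (hw : Tendsto (deriv γ.w) atTop (𝓝 0)) : Tendsto γ.U atTop (𝓝 0) := by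
  obtain ⟨c, hc, hr⟩ := h.exists_r_ge hp
  have h1 := ((h.1.rU_tendsto hw).abs.div_const c)
  rw [abs_zero, zero_div] at h1
  refine squeeze_zero_norm' ?_ h1
  filter_upwards [eventually_ge_atTop 1] with t ht
  rw [Real.norm_eq_abs, le_div_iff₀ hc, abs_mul, mul_comm]
  have := hr t ht
  exact mul_le_mul_of_nonneg_right (this.trans (le_abs_self _)) (abs_nonneg _)

theorem div_one_add_tendsto (C k t₀ : ℝ) :
    Tendsto (fun t => C / (k + (t - t₀))) atTop (𝓝 0) :=
  tendsto_const_nhds.div_atTop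
    (tendsto_atTop_add_const_left _ _ (tendsto_atTop_add_const_right _ _ tendsto_id))

theorem hasDerivWithinAt_div_add (C k t₀ x : ℝ) (hx : k + (x - t₀) ≠ 0) :
    HasDerivWithinAt (fun t => C / (k + (t - t₀))) (-C / (k + (x - t₀)) ^ 2) (Ici 0) x := by
  have := ((hasDerivAt_const x C).div (((hasDerivAt_id x).sub_const t₀).const_add k) hx)
  exact (this.congr_deriv (by simp)).hasDerivWithinAt

theorem IsSolution.kappa_tendsto (h : IsSolution p ⊤ γ) (hU : Tendsto γ.U atTop (𝓝 0)) :
    Tendsto γ.κ atTop (𝓝 1) := by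
  rw [tendsto_order]
  constructor
  · intro a ha
    have h1 : Tendsto (fun t : ℝ => 1 - 1 / (1 + (t - 0))) atTop (𝓝 1) := by
      simpa using (tendsto_const_nhds (x := (1 : ℝ))).sub (div_one_add_tendsto 1 1 0)
    filter_upwards [h1.eventually_const_lt ha, eventually_ge_atTop 0] with t ht ht0
    refine ht.trans_le (le_trans (le_of_eq ?_) (h.kappa_ge ht0 (EReal.coe_lt_top t)))
    have : 1 + t ≠ 0 := by linarith
    rw [sub_zero]
    field_simp
    ring
  · intro a ha
    obtain ⟨e, he⟩ : ∃ e, e = (a - 1) / 2 := ⟨_, rfl⟩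
    have he0 : 0 < e := by rw [he]; linarith
    have hU2 : Tendsto (fun t => 2 * γ.U t ^ 2) atTop (𝓝 0) := by
      simpa using (hU.pow 2).const_mul 2
    obtain ⟨t₀, ht₀⟩ := eventually_atTop.1
      ((hU2.eventually_lt_const he0).and (eventually_ge_atTop 0))
    have ht₀0 := (ht₀ t₀ le_rfl).2
    obtain ⟨C, hC⟩ : ∃ C, C = γ.κ t₀ := ⟨_, rfl⟩
    have hC0 : 0 ≤ C := hC ▸ h.kappa_nonneg ht₀0 (EReal.coe_lt_top _)
    -- Once `2U² < e`, this is a supersolution of `κ' = 1 + 2U² - κ²`, chosen to lie above `κ` at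
    -- `t₀`.
    have hb : ∀ t, t₀ ≤ t → γ.κ t ≤ 1 + e + C / (1 + (t - t₀)) := by
      intro t ht
      have := nonpos_of_barrier (f := fun x => γ.κ x - (1 + e) - C / (1 + (x - t₀)))
        (K := fun _ => 0) ht₀0
        (fun x hx => ((h.eq_κ x (ht₀0.trans hx.1) (EReal.coe_lt_top x)).sub_const (1 + e)).sub
          (hasDerivWithinAt_div_add C 1 t₀ x (by linarith [hx.1])))
        continuousOn_const (by simp [← hC]; linarith) (fun x hx hpos => by
          obtain ⟨h1, h2⟩ := ht₀ x hx.1.le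
          have hd : 1 ≤ 1 + (x - t₀) := by linarith [hx.1]
          obtain ⟨X, hX⟩ : ∃ X, X = C / (1 + (x - t₀)) := ⟨_, rfl⟩
          have hX0 : 0 ≤ X := by rw [hX]; exact div_nonneg hC0 (by linarith)
          have hX1 : C / (1 + (x - t₀)) ^ 2 ≤ X := by
            rw [hX]
            exact div_le_div_of_nonneg_left hC0 (by linarith) (by nlinarith)
          rw [← hX] at hpos
          have h3 : (1 + e + X) ^ 2 ≤ γ.κ x ^ 2 := pow_le_pow_left₀ (by linarith) (by linarith) 2
          have h4 : 0 ≤ e * X := mul_nonneg he0.le hX0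
          rw [neg_div]
          nlinarith [sq_nonneg X, sq_nonneg e]) t (right_mem_Icc.2 ht)
      linarith
    have h2 : Tendsto (fun t => 1 + e + C / (1 + (t - t₀))) atTop (𝓝 (1 + e)) := by
      simpa using (tendsto_const_nhds (x := 1 + e)).add (div_one_add_tendsto C 1 t₀)
    filter_upwards [h2.eventually_lt_const (show 1 + e < a by rw [he]; linarith),
      eventually_ge_atTop t₀] with t ht ht'
    exact (hb t ht').trans_lt ht

/-! ### Oscillatory orbits -/

/-- Without a zero, `y = w'/w` is defined throughout and `(arctan y)' = (Ay - (1 - w²) - y²)/(1 +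
y²)` with `A = 2N - κ`. For `|A| ≤ 11/10` and `w² ≤ 1/10` this is at most `-29/100`. Over length at
least `11` the angle would drop by more than `π`. -/
theorem IsSolution.exists_zero_of_oscillation {T : EReal} (h : IsSolution p T γ) {a b : ℝ}
    (ha : 0 ≤ a) (hb : (b : EReal) < T) (hab : a + 12 ≤ b)
    (hosc : ∀ t ∈ Icc a b, |2 * γ.N t - γ.κ t| ≤ 11 / 10 ∧ γ.w t ^ 2 ≤ 1 / 10) :
    ∃ t ∈ Ioo a b, γ.w t = 0 := by
  by_contra! hne
  -- The ends are trimmed because `w` is assumed nonzero only on the open interval.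
  have hmem : ∀ t ∈ Icc (a + 1 / 2) (b - 1 / 2), t ∈ Ioo a b := fun t ht =>
    ⟨by linarith [ht.1], by linarith [ht.2]⟩
  have key := le_of_hasDerivWithinAt_nonpos
    (f := fun x => Real.arctan (γ.r x * γ.U x / γ.w x) + 29 / 100 * x)
    (show 0 ≤ a + 1 / 2 by linarith) (show a + 1 / 2 ≤ b - 1 / 2 by linarith)
    (fun x hx => by
      have hx' := hmem x hx
      have hxT := coe_lt_of_le hx'.2.le hb
      exact (((h.eq_rU (ha.trans hx'.1.le) hxT).div (h.eq_w x (ha.trans hx'.1.le) hxT)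
        (hne x hx')).arctan).add (((hasDerivAt_id x).const_mul (29 / 100)).hasDerivWithinAt))
    fun x hx => by
      have hx' := hmem x (Ioo_subset_Icc_self hx)
      obtain ⟨h1, h2⟩ := hosc x (Ioo_subset_Icc_self hx')
      have hw := hne x hx'
      obtain ⟨y, hy⟩ : ∃ y, y = γ.r x * γ.U x / γ.w x := ⟨_, rfl⟩
      obtain ⟨A, hA⟩ : ∃ A, A = 2 * γ.N x - γ.κ x := ⟨_, rfl⟩
      have hz : γ.r x * γ.U x = y * γ.w x := by rw [hy]; field_simp
      have e : ((2 * γ.N x - γ.κ x) * (γ.r x * γ.U x) - γ.w x * (1 - γ.w x ^ 2)) * γ.w x -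
          γ.r x * γ.U x * (γ.r x * γ.U x) =
          (A * y - (1 - γ.w x ^ 2) - y ^ 2) * γ.w x ^ 2 := by
        rw [hz, ← hA]
        ring
      rw [← hA] at h1
      have hA2 : A ^ 2 ≤ (11 / 10) ^ 2 := by
        rw [← sq_abs]
        exact pow_le_pow_left₀ (abs_nonneg _) h1 2
      have h3 : A * y - (1 - γ.w x ^ 2) - y ^ 2 ≤ -(29 / 100) * (1 + y ^ 2) := by
        nlinarith [sq_nonneg (A - y), sq_nonneg y]
      rw [Pi.div_apply, ← hy, e, mul_div_assoc, div_self (pow_ne_zero 2 hw), mul_one]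
      have h4 : (1 / (1 + y ^ 2)) * (A * y - (1 - γ.w x ^ 2) - y ^ 2) ≤ -(29 / 100) := by
        rw [one_div, inv_mul_le_iff₀ (by positivity)]
        linarith
      simp only [mul_one]
      linarith
  have h1 := Real.neg_pi_div_two_lt_arctan (γ.r (b - 1 / 2) * γ.U (b - 1 / 2) / γ.w (b - 1 / 2))
  have h2 := Real.arctan_lt_pi_div_two (γ.r (a + 1 / 2) * γ.U (a + 1 / 2) / γ.w (a + 1 / 2))
  have h3 := Real.pi_lt_d2
  linarith

theorem IsSolution.le_numZeros_of_oscillation {T : EReal} (h : IsSolution p T γ) {a : ℝ} (n : ℕ)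
    (ha : 0 ≤ a) (hb : ((a + 12 * n : ℝ) : EReal) < T)
    (hosc : ∀ t ∈ Icc a (a + 12 * n), |2 * γ.N t - γ.κ t| ≤ 11 / 10 ∧ γ.w t ^ 2 ≤ 1 / 10) :
    (n : ℕ∞) ≤ numZeros T γ := by
  have hex : ∀ k : Fin n, ∃ t ∈ Ioo (a + 12 * (k : ℝ)) (a + 12 * ((k : ℝ) + 1)), γ.w t = 0 := by
    intro k
    have hk : ((k : ℕ) : ℝ) + 1 ≤ n := by exact_mod_cast k.2
    have hk0 : (0 : ℝ) ≤ ((k : ℕ) : ℝ) := Nat.cast_nonneg _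
    refine h.exists_zero_of_oscillation (by linarith) (coe_lt_of_le (by linarith) hb)
      (by linarith) fun t ht => hosc t ⟨by linarith [ht.1], by linarith [ht.2]⟩
  choose φ hφ hφ0 using hex
  have hinj : Function.Injective φ := by
    intro i j hij
    have h1 := hφ i
    have h2 := hφ j
    rw [hij] at h1
    have h3 : ((i : ℕ) : ℝ) < (j : ℕ) + 1 := by linarith [h1.1, h2.2]
    have h4 : ((j : ℕ) : ℝ) < (i : ℕ) + 1 := by linarith [h1.2, h2.1]
    have h5 : (i : ℕ) < j + 1 := by exact_mod_cast h3
    have h6 : (j : ℕ) < i + 1 := by exact_mod_cast h4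
    exact Fin.ext (by omega)
  have hsub : range φ ⊆ {ρ : ℝ | 0 < ρ ∧ (ρ : EReal) < T ∧ γ.w ρ = 0} := by
    rintro _ ⟨k, rfl⟩
    have hk : ((k : ℕ) : ℝ) + 1 ≤ n := by exact_mod_cast k.2
    have hk0 : (0 : ℝ) ≤ ((k : ℕ) : ℝ) := Nat.cast_nonneg _
    exact ⟨by linarith [(hφ k).1], coe_lt_of_le (by linarith [(hφ k).2]) hb, hφ0 k⟩
  calc (n : ℕ∞) = (univ : Set (Fin n)).encard := by simp
    _ = (range φ).encard := by rw [← image_univ, hinj.encard_image]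
    _ ≤ numZeros T γ := encard_le_encard hsub

/-- The coefficients of the second-order equation for `w` along an oscillatory orbit. -/
theorem IsOrbit.eventually_oscillation (h : IsOrbit p ⊤ γ) (hp : p ∈ admissible)
    (hw : Tendsto γ.w atTop (𝓝 0)) (hw' : Tendsto (deriv γ.w) atTop (𝓝 0)) :
    ∀ᶠ t in atTop, |2 * γ.N t - γ.κ t| < 21 / 20 ∧ γ.w t ^ 2 < 1 / 20 := by
  have hκ := h.1.kappa_tendsto (h.U_tendsto hp hw')
  have hw2 : Tendsto (fun t => γ.w t ^ 2) atTop (𝓝 0) := by simpa using hw.pow 2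
  filter_upwards [hκ.eventually_const_lt (show (99 : ℝ) / 100 < 1 by norm_num),
    hκ.eventually_lt_const (show (1 : ℝ) < 101 / 100 by norm_num),
    h.1.zeta_tendsto.eventually_lt_const (show (0 : ℝ) < 1 / 100 by norm_num),
    hw2.eventually_lt_const (show (0 : ℝ) < 1 / 20 by norm_num), eventually_ge_atTop 0]
    with t h1 h2 h3 h4 h5
  have h6 := h.N_ge hp h5
  have h7 := h.1.N_le_one h5 (EReal.coe_lt_top t)
  -- Only `-ζ ≤ N ≤ 1`, `ζ → 0` and `κ → 1` enter; the limit of `N` is not needed.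
  exact ⟨abs_lt.2 ⟨by linarith, by linarith⟩, h4⟩

theorem oscillatory_nearby {r0 : ℝ} {x0 : ℝ × ℝ} (hx0 : x0 ∈ slice oscillatory r0) (n : ℕ) :
    ∀ᶠ y in 𝓝 x0, y ∈ slice admissible r0 → ∃ (T : EReal) (γ : PhaseCurve),
      IsOrbit (r0, y.1, y.2) T γ ∧ (n : ℕ∞) ≤ numZeros T γ := by
  obtain ⟨hp, γ, h, hw, hw'⟩ := hx0
  obtain ⟨a, ha⟩ := eventually_atTop.1
    ((h.eventually_oscillation hp hw hw').and (eventually_ge_atTop 0))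
  have ha0 := (ha a le_rfl).2
  have hn0 : (0 : ℝ) ≤ n := Nat.cast_nonneg _
  filter_upwards [h.1.eventually_near (show 0 ≤ a + 12 * n by positivity)
    (EReal.coe_lt_top _) (show (0 : ℝ) < 1 / 100 by norm_num)] with y hy hadm
  obtain ⟨T', γ', hγ'⟩ := exists_isOrbit (p := (r0, y.1, y.2)) hadm.1
  obtain ⟨h1, h2⟩ := hy T' γ' hγ'
  refine ⟨T', γ', hγ', hγ'.1.le_numZeros_of_oscillation n ha0 h1 fun t ht => ?_⟩
  obtain ⟨⟨h3, h4⟩, h5⟩ := ha t ht.1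
  have ht' : t ∈ Icc 0 (a + 12 * n) := ⟨h5, ht.2⟩
  have eN : |γ'.N t - γ.N t| < 1 / 100 := h2 t ht' 1
  have ew : |γ'.w t - γ.w t| < 1 / 100 := h2 t ht' 2
  have eκ : |γ'.κ t - γ.κ t| < 1 / 100 := h2 t ht' 4
  rw [abs_lt] at h3 eN ew eκ
  have hwabs : |γ.w t| < 1 / 4 := by
    refine abs_lt_of_sq_lt_sq (by linarith) (by norm_num)
  rw [abs_lt] at hwabs
  refine ⟨abs_le.2 ⟨by linarith, by linarith⟩, ?_⟩
  have hw3 : |γ'.w t| ≤ 3 / 10 := abs_le.2 ⟨by linarith, by linarith⟩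
  rw [← sq_abs]
  calc |γ'.w t| ^ 2 ≤ (3 / 10) ^ 2 := pow_le_pow_left₀ (abs_nonneg _) hw3 2
    _ ≤ 1 / 10 := by norm_num

end Global

/-! ### The asymptotically flat region -/

theorem false_of_linear_growth {f f' : ℝ → ℝ} {t₀ c B : ℝ} (h0 : 0 ≤ t₀) (hc : 0 < c)
    (hd : ∀ t, t₀ ≤ t → HasDerivWithinAt f (f' t) (Ici 0) t) (hf' : ∀ t, t₀ ≤ t → c ≤ f' t)
    (hB : ∀ t, t₀ ≤ t → f t ≤ B) : False := by
  obtain ⟨t, ht, ht'⟩ : ∃ t, t₀ ≤ t ∧ (B - f t₀) / c < t - t₀ :=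
    ⟨max t₀ ((B - f t₀) / c + t₀ + 1), le_max_left _ _,
      by linarith [le_max_right t₀ ((B - f t₀) / c + t₀ + 1)]⟩
  have := le_of_hasDerivWithinAt_nonneg (f := fun x => f x - c * x) h0 ht
    (fun x hx => (hd x hx.1).sub ((hasDerivAt_id x).const_mul c).hasDerivWithinAt)
    fun x hx => by have := hf' x hx.1.le; linarith
  rw [div_lt_iff₀ hc] at ht'
  linarith [hB t ht]

/-- Conditions at one time for an orbit to be in the asymptotically flat region near `w = 1`. -/
structure FlatTrap (γ : PhaseCurve) (s : ℝ) : Prop where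
  r_gt : 100 < γ.r s
  N_gt : 97 / 100 < γ.N s
  kappa_gt : 99 / 100 < γ.κ s
  kappa_lt : γ.κ s < 101 / 100
  rU_lt : |γ.r s * γ.U s| < 1
  w_gt : 95 / 100 < γ.w s

theorem abs_cubic_le {w : ℝ} (hw : |w| ≤ 1) : |w * (1 - w ^ 2)| ≤ 1 / 2 := by
  have h1 : 0 ≤ |w| := abs_nonneg w
  have h2 : 0 ≤ 1 - w ^ 2 := by
    rw [← sq_abs]
    nlinarith
  rw [abs_mul, abs_of_nonneg h2, ← sq_abs]
  -- This product expands to `|w|³ - 1.08|w| + 0.432`, which gives `|w| - |w|³ ≤ 0.432`.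
  have h3 : 0 ≤ (|w| - 6 / 10) ^ 2 * (|w| + 12 / 10) := by positivity
  linarith

section Flat

variable {p : ℝ × ℝ × ℝ} {T : EReal} {γ : PhaseCurve}

theorem FlatTrap.kappa_ge {s t : ℝ} (hf : FlatTrap γ s) (h : IsSolution p T γ) (hs0 : 0 ≤ s)
    (hst : s ≤ t) (ht : (t : EReal) < T) : 99 / 100 ≤ γ.κ t := by
  have := nonpos_of_barrier (f := fun x => 99 / 100 - γ.κ x) (K := fun _ => 0) hs0
    (fun x hx => (h.eq_κ x (hs0.trans hx.1) (coe_lt_of_le hx.2 ht)).const_sub (99 / 100))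
    continuousOn_const (by linarith [hf.kappa_gt]) (fun x hx hpos => by
      have h1 := h.kappa_nonneg (hs0.trans hx.1.le) (coe_lt_of_le hx.2.le ht)
      nlinarith [sq_nonneg (γ.U x)]) t (right_mem_Icc.2 hst)
  linarith

theorem FlatTrap.rU_bound {s t : ℝ} (hf : FlatTrap γ s) (h : IsSolution p T γ) (hs0 : 0 ≤ s)
    (hst : s ≤ t) (ht : (t : EReal) < T) (hw : ∀ x ∈ Icc s t, |γ.w x| ≤ 1) :
    |γ.r t * γ.U t| ≤ 5 := by
  have hsT := coe_lt_of_le hst ht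
  have hrU := abs_lt.1 hf.rU_lt
  -- A barrier in the phase plane: for `z = σw' ≥ 1` the rate of `z - (8/5)σw` is at most `1.01z +
  -- 1/2 - 1.6z < 0`. As `σw ≤ 1`, the barrier never exceeds `4.2`.
  have aux : ∀ σ : ℝ, |σ| = 1 → σ * (γ.r t * γ.U t) ≤ 1 + 8 / 5 * (1 + σ * γ.w t) := by
    intro σ hσ
    have hσw : ∀ x ∈ Icc s t, -1 ≤ σ * γ.w x := fun x hx => by
      have : |σ * γ.w x| ≤ 1 := by rw [abs_mul, hσ, one_mul]; exact hw x hx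
      exact (abs_le.1 this).1
    have := nonpos_of_barrier
      (f := fun x => σ * (γ.r x * γ.U x) - (1 + 8 / 5 * (1 + σ * γ.w x))) (K := fun _ => 0) hs0
      (fun x hx => ((h.eq_rU (hs0.trans hx.1) (coe_lt_of_le hx.2 ht)).const_mul σ).sub
        (((((h.eq_w x (hs0.trans hx.1) (coe_lt_of_le hx.2 ht)).const_mul σ).const_add
          1).const_mul (8 / 5)).const_add 1))
      continuousOn_const (by
        have h1 := hσw s (left_mem_Icc.2 hst)
        have h2 : σ * (γ.r s * γ.U s) ≤ 1 := by
          refine (le_abs_self _).trans ?_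
          rw [abs_mul, hσ, one_mul]
          exact hf.rU_lt.le
        linarith) (fun x hx hpos => by
        have hx' := Ioo_subset_Icc_self hx
        have hxT := coe_lt_of_le hx.2.le ht
        have h1 := hσw x hx'
        obtain ⟨z, hz⟩ : ∃ z, z = σ * (γ.r x * γ.U x) := ⟨_, rfl⟩
        have hz1 : 1 ≤ z := by linarith
        have h2 := hf.kappa_ge h hs0 hx.1.le hxT
        have h3 := h.N_le_one (hs0.trans hx.1.le) hxT
        have h4 : -(σ * (γ.w x * (1 - γ.w x ^ 2))) ≤ 1 / 2 := by
          refine (neg_le_abs _).trans ?_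
          rw [abs_mul, hσ, one_mul]
          exact abs_cubic_le (hw x hx')
        have h5 : (2 * γ.N x - γ.κ x) * z ≤ 101 / 100 * z :=
          mul_le_mul_of_nonneg_right (by linarith) (by linarith)
        have e : σ * ((2 * γ.N x - γ.κ x) * (γ.r x * γ.U x) - γ.w x * (1 - γ.w x ^ 2)) -
            8 / 5 * (σ * (γ.r x * γ.U x)) =
            (2 * γ.N x - γ.κ x) * z - σ * (γ.w x * (1 - γ.w x ^ 2)) - 8 / 5 * z := by
          rw [hz]
          ring
        rw [e]
        linarith) t (right_mem_Icc.2 hst)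
    linarith
  have hwt := abs_le.1 (hw t (right_mem_Icc.2 hst))
  have h1 := aux 1 (by norm_num)
  have h2 := aux (-1) (by norm_num)
  exact abs_le.2 ⟨by linarith, by linarith⟩

/-- In the asymptotically flat region `N` and `κ` stay close to `1` as long as `|w| ≤ 1`. -/
theorem FlatTrap.region {s t : ℝ} (hf : FlatTrap γ s) (h : IsSolution p T γ) (hs0 : 0 ≤ s)
    (hst : s ≤ t) (ht : (t : EReal) < T) (hw : ∀ x ∈ Icc s t, |γ.w x| ≤ 1) :
    97 / 100 ≤ γ.N t ∧ 99 / 100 ≤ γ.κ t ∧ γ.κ t ≤ 101 / 100 := by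
  -- As long as `N > 0.96`, `r` stays above `100`, so `|U| ≤ 1/20` and the squared tension is at
  -- most `10⁻⁴`; this keeps `κ ≤ 1.01` and returns the better bound `N ≥ 0.97`.
  have step : ∀ y ∈ Icc s t, (∀ x ∈ Ico s y, 0 < γ.N x - 96 / 100) →
      97 / 100 ≤ γ.N y ∧ γ.κ y ≤ 101 / 100 := by
    intro y hy hb
    have hyT := coe_lt_of_le hy.2 ht
    have hr : ∀ x ∈ Icc s y, 100 ≤ γ.r x := by
      intro x hx
      refine hf.r_gt.le.trans (le_of_hasDerivWithinAt_nonneg hs0 hx.1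
        (fun u hu => h.eq_r u (hs0.trans hu.1) (coe_lt_of_le (hu.2.trans hx.2) hyT))
        fun u hu => ?_)
      have := hb u ⟨hu.1.le, hu.2.trans_le hx.2⟩
      exact mul_nonneg (h.r_pos u (hs0.trans hu.1.le)
        (coe_lt_of_le (hu.2.le.trans hx.2) hyT)).le (by linarith)
    have hU : ∀ x ∈ Icc s y, γ.U x ^ 2 ≤ 25 / 10000 := by
      intro x hx
      have h1 := hf.rU_bound h hs0 hx.1 (coe_lt_of_le hx.2 hyT) fun u hu =>
        hw u ⟨hu.1, hu.2.trans (hx.2.trans hy.2)⟩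
      have h2 := hr x hx
      have h3 : |γ.U x| ≤ 5 / 100 := by
        rw [abs_mul, abs_of_pos (by linarith : 0 < γ.r x)] at h1
        have := mul_le_mul_of_nonneg_right h2 (abs_nonneg (γ.U x))
        linarith
      rw [← sq_abs]
      calc |γ.U x| ^ 2 ≤ (5 / 100) ^ 2 := pow_le_pow_left₀ (abs_nonneg _) h3 2
        _ = 25 / 10000 := by norm_num
    have hκ : ∀ x ∈ Icc s y, γ.κ x ≤ 101 / 100 := by
      intro x hx
      have := nonpos_of_barrier (f := fun u => γ.κ u - 101 / 100) (K := fun _ => 0) hs0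
        (fun u hu => (h.eq_κ u (hs0.trans hu.1) (coe_lt_of_le (hu.2.trans hx.2) hyT)).sub_const
          (101 / 100)) continuousOn_const (by linarith [hf.kappa_lt]) (fun u hu hpos => by
          have h1 := hU u ⟨hu.1.le, hu.2.le.trans hx.2⟩
          nlinarith) x (right_mem_Icc.2 hx.1)
      linarith
    refine ⟨?_, hκ y (right_mem_Icc.2 hy.1)⟩
    have := nonpos_of_barrier (f := fun u => 97 / 100 - γ.N u) (K := fun _ => 0) hs0
      (fun u hu => (h.eq_N u (hs0.trans hu.1) (coe_lt_of_le hu.2 hyT)).const_sub (97 / 100))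
      continuousOn_const (by linarith [hf.N_gt]) (fun u hu hpos => by
        have hu' := Ioo_subset_Icc_self hu
        have h1 := hb u ⟨hu.1.le, hu.2⟩
        have h2 := hκ u hu'
        have h3 := hr u hu'
        have h4 := hw u ⟨hu.1.le, hu.2.le.trans hy.2⟩
        have h5 : (1 - γ.w u ^ 2) ^ 2 / γ.r u ^ 2 ≤ 1 / 10000 := by
          have h6 : γ.w u ^ 2 ≤ 1 := by
            rw [← sq_abs]
            exact pow_le_one₀ (abs_nonneg _) h4
          refine div_le_div₀ zero_le_one ?_ (by norm_num) (by nlinarith)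
          exact pow_le_one₀ (by linarith) (by linarith [sq_nonneg (γ.w u)])
        have h7 : γ.κ u * γ.N u ≤ 101 / 100 * (97 / 100) :=
          mul_le_mul h2 (by linarith) (by linarith) (by norm_num)
        linarith) y (right_mem_Icc.2 hy.1)
    linarith
  have hpos := pos_of_continuous_induction (f := fun x => γ.N x - 96 / 100)
    (((h.continuousOn_coord ht).2.1.sub continuousOn_const).mono (Icc_subset_Icc_left hs0))
    fun y hy hb => by linarith [(step y hy hb).1]
  obtain ⟨h1, h2⟩ := step t (right_mem_Icc.2 hst) fun x hx => hpos x (Ico_subset_Icc_self hx)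
  exact ⟨h1, hf.kappa_ge h hs0 hst ht, h2⟩

theorem FlatTrap.eq_top {s : ℝ} (hf : FlatTrap γ s) (h : IsOrbit p T γ) (hp : p ∈ admissible)
    (hs0 : 0 ≤ s) (hs : (s : EReal) < T) (hw : ∀ x, s ≤ x → (x : EReal) < T → |γ.w x| ≤ 1) :
    T = ⊤ := by
  induction T with
  | bot => exact absurd h.1.pos (by simp)
  | top => rfl
  | coe T =>
    obtain ⟨t, ht, -, hN⟩ := h.exists_N_lt_after hp 0 (show s < T by exact_mod_cast hs)
    have htT : (t : EReal) < T := by exact_mod_cast ht.2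
    have := (hf.region h.1 hs0 ht.1.le htT fun x hx => hw x hx.1 (coe_lt_of_le hx.2 htT)).1
    linarith

/-- The lower barrier `φ(w) = (3/5) (w₁ - w) (1 + w/2)` for `-w'`. -/
theorem descent_barrier_ineq {a w w₁ : ℝ} (ha : 93 / 100 ≤ a) (hw₁ : 9 / 10 ≤ w₁) (hw₁' : w₁ ≤ 1)
    (hw : -1 ≤ w) (hww : w ≤ w₁) :
    0 ≤ (a + 3 / 5 * (-1 + w₁ / 2 - w)) * (3 / 5 * ((w₁ - w) * (1 + w / 2))) +
      w * (1 - w ^ 2) := by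
  rcases le_total 0 w with h0 | h0
  · have h1 : 0 ≤ a + 3 / 5 * (-1 + w₁ / 2 - w) := by linarith
    have h2 : 0 ≤ 3 / 5 * ((w₁ - w) * (1 + w / 2)) :=
      mul_nonneg (by norm_num) (mul_nonneg (by linarith) (by linarith))
    have h3 : 0 ≤ w * (1 - w ^ 2) := mul_nonneg h0 (by nlinarith)
    exact add_nonneg (mul_nonneg h1 h2) h3
  · have h1 : 3 / 5 * (1 - w) ≤ a + 3 / 5 * (-1 + w₁ / 2 - w) := by linarith
    have h2 : 3 / 5 * (9 / 10 * (1 - w) * (1 + w / 2)) ≤ 3 / 5 * ((w₁ - w) * (1 + w / 2)) := by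
      have : 9 / 10 * (1 - w) ≤ w₁ - w := by linarith
      have h3 := mul_le_mul_of_nonneg_right this (show 0 ≤ 1 + w / 2 by linarith)
      linarith
    have h4 : 0 ≤ 3 / 5 * (9 / 10 * (1 - w) * (1 + w / 2)) :=
      mul_nonneg (by norm_num) (mul_nonneg (by linarith) (by linarith))
    have h5 := mul_le_mul h1 h2 h4 (by linarith)
    have h6 : 0 ≤ (1 - w) * (81 / 250 + 419 / 500 * w + 419 / 500 * w ^ 2) :=
      mul_nonneg (by linarith) (by nlinarith [sq_nonneg (w + 1 / 2)])
    have h7 : 3 / 5 * (1 - w) * (3 / 5 * (9 / 10 * (1 - w) * (1 + w / 2))) + w * (1 - w ^ 2) =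
        (1 - w) * (81 / 250 + 419 / 500 * w + 419 / 500 * w ^ 2) := by ring
    linarith

/-- If `w` turns around near `1` in the asymptotically flat region, it decreases down to `-1`. -/
theorem FlatTrap.descent {s t₁ t : ℝ} (hf : FlatTrap γ s) (h : IsSolution p T γ) (hs0 : 0 ≤ s)
    (hst₁ : s ≤ t₁) (htt : t₁ ≤ t) (ht : (t : EReal) < T)
    (hw : ∀ x ∈ Icc s t₁, 9 / 10 ≤ γ.w x ∧ γ.w x ≤ 1) (hU : γ.U t₁ < 0)
    (hlow : ∀ x ∈ Icc t₁ t, -1 ≤ γ.w x) :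
    γ.U t < 0 ∧ γ.w t ≤ γ.w t₁ ∧
      γ.r t * γ.U t ≤ -(3 / 5 * ((γ.w t₁ - γ.w t) * (1 + γ.w t / 2))) := by
  have ht₁0 := hs0.trans hst₁
  obtain ⟨w₁, hw₁⟩ : ∃ w₁, w₁ = γ.w t₁ := ⟨_, rfl⟩
  obtain ⟨hw₁a, hw₁b⟩ := hw t₁ (right_mem_Icc.2 hst₁)
  rw [← hw₁] at hw₁a hw₁b ⊢
  obtain ⟨c1, c2, c3, c4, c5, -⟩ := h.continuousOn_coord ht
  have hr : ∀ x ∈ Icc t₁ t, 0 < γ.r x := fun x hx =>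
    h.r_pos x (ht₁0.trans hx.1) (coe_lt_of_le hx.2 ht)
  have step : ∀ y ∈ Icc t₁ t, (∀ x ∈ Ico t₁ y, 0 < -γ.U x) →
      γ.w y ≤ w₁ ∧ γ.r y * γ.U y ≤ -(3 / 5 * ((w₁ - γ.w y) * (1 + γ.w y / 2))) := by
    intro y hy hb
    have hyT := coe_lt_of_le hy.2 ht
    have hdec : ∀ x ∈ Icc t₁ y, γ.w x ≤ w₁ := by
      intro x hx
      rw [hw₁]
      refine le_of_hasDerivWithinAt_nonpos ht₁0 hx.1
        (fun u hu => h.eq_w u (ht₁0.trans hu.1) (coe_lt_of_le (hu.2.trans hx.2) hyT))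
        fun u hu => ?_
      have h1 := hb u ⟨hu.1.le, hu.2.trans_le hx.2⟩
      exact mul_nonpos_of_nonneg_of_nonpos
        (hr u ⟨hu.1.le, hu.2.le.trans (hx.2.trans hy.2)⟩).le (by linarith)
    have hwabs : ∀ x ∈ Icc s y, |γ.w x| ≤ 1 := by
      intro x hx
      rcases le_total x t₁ with hle | hle
      · obtain ⟨h1, h2⟩ := hw x ⟨hx.1, hle⟩
        exact abs_le.2 ⟨by linarith, h2⟩
      · have h1 := hdec x ⟨hle, hx.2⟩
        exact abs_le.2 ⟨hlow x ⟨hle, hx.2.trans hy.2⟩, by linarith⟩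
    refine ⟨hdec y (right_mem_Icc.2 hy.1), ?_⟩
    -- With `φ` the descent barrier and `K = 2N - κ + φ'(w)`, one has `(w' + φ)' = K(w' + φ) - (Kφ +
    -- w(1 - w²))`. The last bracket is nonnegative because `2N - κ ≥ 0.93` in the flat region.
    have := nonpos_of_barrier
      (f := fun x => γ.r x * γ.U x + 3 / 5 * ((w₁ - γ.w x) * (1 + γ.w x / 2)))
      (K := fun x => 2 * γ.N x - γ.κ x + 3 / 5 * (-1 + w₁ / 2 - γ.w x)) ht₁0
      (fun x hx => (h.eq_rU (ht₁0.trans hx.1) (coe_lt_of_le hx.2 hyT)).add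
        ((((h.eq_w x (ht₁0.trans hx.1) (coe_lt_of_le hx.2 hyT)).const_sub w₁).mul
        (((h.eq_w x (ht₁0.trans hx.1) (coe_lt_of_le hx.2 hyT)).div_const 2).const_add
          1)).const_mul (3 / 5)))
      ((((continuousOn_const.mul c2).sub c5).add
        (continuousOn_const.mul (continuousOn_const.sub c3))).mono
        (Icc_subset_Icc ht₁0 hy.2))
      (by
        have := mul_pos (hr t₁ (left_mem_Icc.2 htt)) (neg_pos.2 hU)
        rw [← hw₁, sub_self, zero_mul, mul_zero]
        linarith) (fun x hx _ => by
        have hx' := Ioo_subset_Icc_self hx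
        have hreg := hf.region h hs0 (hst₁.trans hx.1.le) (coe_lt_of_le hx.2.le hyT) fun u hu =>
          hwabs u ⟨hu.1, hu.2.trans hx.2.le⟩
        have := descent_barrier_ineq (a := 2 * γ.N x - γ.κ x) (by linarith [hreg.1, hreg.2.2])
          hw₁a hw₁b (hlow x ⟨hx.1.le, hx.2.le.trans hy.2⟩) (hdec x hx')
        linarith) y (right_mem_Icc.2 hy.1)
    linarith
  have hneg := pos_of_continuous_induction (f := fun x => -γ.U x)
    (c4.neg.mono (Icc_subset_Icc_left ht₁0)) (fun y hy hb => by
      rcases hy.1.eq_or_lt with heq | hlt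
      · rw [← heq]
        linarith
      · have hlty : γ.w y < w₁ := by
          have := lt_of_hasDerivWithinAt_pos (f := fun x => -γ.w x) ht₁0 hlt
            (fun u hu => (h.eq_w u (ht₁0.trans hu.1) (coe_lt_of_le (hu.2.trans hy.2) ht)).neg)
            fun u hu => by
              have h1 := mul_pos (hr u ⟨hu.1.le, hu.2.le.trans hy.2⟩) (hb u ⟨hu.1.le, hu.2⟩)
              linarith
          linarith
        have h1 := (step y hy hb).2
        have h2 : 0 < (w₁ - γ.w y) * (1 + γ.w y / 2) :=
          mul_pos (by linarith) (by linarith [hlow y hy])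
        have h3 : γ.r y * γ.U y < 0 := by linarith
        linarith [neg_of_mul_neg_right h3 (hr y hy).le])
  obtain ⟨h1, h2⟩ := step t (right_mem_Icc.2 htt) fun x hx => hneg x (Ico_subset_Icc_self hx)
  exact ⟨by linarith [hneg t (right_mem_Icc.2 htt)], h1, h2⟩

theorem FlatTrap.exists_exit_below {s t₁ : ℝ} (hf : FlatTrap γ s) (h : IsOrbit p T γ)
    (hp : p ∈ admissible) (hs0 : 0 ≤ s) (hst₁ : s ≤ t₁) (ht₁ : (t₁ : EReal) < T)
    (hw : ∀ x ∈ Icc s t₁, 9 / 10 ≤ γ.w x ∧ γ.w x ≤ 1) (hU : γ.U t₁ < 0) :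
    ∃ t₂ : ℝ, t₁ ≤ t₂ ∧ (t₂ : EReal) < T ∧ γ.w t₂ < -1 ∧ ∀ t ∈ Icc t₁ t₂, γ.U t < 0 := by
  have ht₁0 := hs0.trans hst₁
  have hex : ∃ t₂ : ℝ, t₁ ≤ t₂ ∧ (t₂ : EReal) < T ∧ γ.w t₂ < -1 := by
    by_contra! hcon
    have hdes := fun t (htt : t₁ ≤ t) (ht : (t : EReal) < T) =>
      hf.descent h.1 hs0 hst₁ htt ht hw hU fun x hx => hcon x hx.1 (coe_lt_of_le hx.2 ht)
    obtain ⟨hw₁a, hw₁b⟩ := hw t₁ (right_mem_Icc.2 hst₁)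
    have hT : T = ⊤ := by
      refine hf.eq_top h hp hs0 (coe_lt_of_le hst₁ ht₁) fun x hx hxT => ?_
      rcases le_total x t₁ with hle | hle
      · obtain ⟨h1, h2⟩ := hw x ⟨hx, hle⟩
        exact abs_le.2 ⟨by linarith, h2⟩
      · have h1 := (hdes x hle hxT).2.1
        exact abs_le.2 ⟨hcon x hle hxT, by linarith⟩
    subst hT
    have dom : ∀ t : ℝ, (t : EReal) < ⊤ := EReal.coe_lt_top
    have hder : ∀ t, t₁ ≤ t → HasDerivWithinAt (fun x => -γ.w x) (-(γ.r t * γ.U t)) (Ici 0) t :=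
      fun t ht => (h.1.eq_w t (ht₁0.trans ht) (dom t)).neg
    have hstrict : ∀ a b, t₁ ≤ a → a < b → γ.w b < γ.w a := by
      intro a b ha hab
      have := lt_of_hasDerivWithinAt_pos (ht₁0.trans ha) hab (fun u hu => hder u (ha.trans hu.1))
        fun u hu => by
          have h1 := (hdes u (ha.trans hu.1.le) (dom u)).1
          have h2 := h.1.r_pos u (ht₁0.trans (ha.trans hu.1.le)) (dom u)
          have := mul_pos h2 (neg_pos.2 h1)
          linarith
      linarith
    -- The barrier vanishes at the turning value, so one unit of time is allowed to pass; from then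
    -- on it gives `w' ≤ -(3/10)η`, and `w` cannot stay above `-1`.
    obtain ⟨η, hη⟩ : ∃ η, η = γ.w t₁ - γ.w (t₁ + 1) := ⟨_, rfl⟩
    have hη0 : 0 < η := by
      have := hstrict t₁ (t₁ + 1) le_rfl (by linarith)
      linarith
    refine false_of_linear_growth (f := fun x => -γ.w x) (t₀ := t₁ + 1) (c := 3 / 10 * η) (B := 1)
      (by linarith) (by linarith) (fun t ht => hder t (by linarith)) (fun t ht => ?_)
      fun t ht => by linarith [hcon t (by linarith) (dom t)]
    have h1 := (hdes t (by linarith) (dom t)).2.2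
    have h2 : γ.w t ≤ γ.w (t₁ + 1) := by
      rcases ht.eq_or_lt with heq | hlt
      · rw [heq]
      · exact (hstrict _ _ (by linarith) hlt).le
    have h3 := hcon t (by linarith) (dom t)
    have h4 : η * (1 / 2) ≤ (γ.w t₁ - γ.w t) * (1 + γ.w t / 2) :=
      mul_le_mul (by linarith) (by linarith) (by norm_num) (by linarith)
    linarith
  obtain ⟨t₂, h12, ht₂, hw₂⟩ := hex
  refine ⟨t₂, h12, ht₂, hw₂, fun t ht => ?_⟩
  have htT := coe_lt_of_le ht.2 ht₂
  -- Down to `w = -1` the barrier keeps `U < 0`; beyond `-1` the reflected exit argument does.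
  by_cases hlow : ∀ x ∈ Icc t₁ t, -1 ≤ γ.w x
  · exact (hf.descent h.1 hs0 hst₁ ht.1 htT hw hU hlow).1
  · push Not at hlow
    obtain ⟨x, hx, hwx⟩ := hlow
    have := (h.1.reflect.exit_persists (reflectData_mem_admissible hp) (ht₁0.trans hx.1) hx.2 htT
      (show 1 < -γ.w x by linarith)).2
    have e : γ.reflect.U t = -γ.U t := rfl
    linarith

end Flat

/-! ### Orbits near regular orbits -/

section Regular

variable {p : ℝ × ℝ × ℝ} {T : EReal} {γ : PhaseCurve}

theorem encard_zeros_eq_of_pos {s t : ℝ} (hst : s ≤ t) (hw : ∀ x ∈ Icc s t, 0 < γ.w x) :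
    {x : ℝ | 0 < x ∧ x ≤ t ∧ γ.w x = 0}.encard = {x : ℝ | 0 < x ∧ x ≤ s ∧ γ.w x = 0}.encard := by
  congr 1
  ext x
  refine ⟨fun ⟨h1, h2, h3⟩ => ⟨h1, ?_, h3⟩, fun ⟨h1, h2, h3⟩ => ⟨h1, h2.trans hst, h3⟩⟩
  by_contra hgt
  exact absurd h3 (hw x ⟨(not_le.1 hgt).le, h2⟩).ne'

theorem FlatTrap.mem_escaping_succ {s t₁ : ℝ} {n : ℕ} (hf : FlatTrap γ s) (h : IsOrbit p T γ)
    (hp : p ∈ admissible) (hs0 : 0 ≤ s) (hst₁ : s ≤ t₁) (ht₁ : (t₁ : EReal) < T)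
    (hw : ∀ x ∈ Icc s t₁, 9 / 10 ≤ γ.w x ∧ γ.w x ≤ 1) (hU : γ.U t₁ < 0)
    (hn : {x : ℝ | 0 < x ∧ x ≤ s ∧ γ.w x = 0}.encard = n) : p ∈ escaping (n + 1) := by
  have ht₁0 := hs0.trans hst₁
  obtain ⟨t₂, h12, ht₂, hw₂, hneg⟩ := hf.exists_exit_below h hp hs0 hst₁ ht₁ hw hU
  refine mem_escaping_of_exit h hp (ht₁0.trans h12) ht₂ (lt_abs.2 (Or.inr (by linarith))) ?_
  rw [← encard_zeros_eq_of_pos hst₁ fun x hx => by linarith [(hw x hx).1]] at hn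
  have hwt₁ := (hw t₁ (right_mem_Icc.2 hst₁)).1
  obtain ⟨c, hc, hc0⟩ := intermediate_value_Icc' h12
    ((h.1.continuousOn_coord ht₂).2.2.1.mono (Icc_subset_Icc_left ht₁0))
    (show (0 : ℝ) ∈ Icc (γ.w t₂) (γ.w t₁) from ⟨by linarith, by linarith⟩)
  have hct : t₁ < c := lt_of_le_of_ne hc.1 fun heq => by
    rw [← heq] at hc0
    linarith
  have hstrict : ∀ a b, t₁ ≤ a → a < b → b ≤ t₂ → γ.w b < γ.w a := by
    intro a b ha hab hb
    have := lt_of_hasDerivWithinAt_pos (f := fun x => -γ.w x) (ht₁0.trans ha) hab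
      (fun u hu => (h.1.eq_w u (ht₁0.trans (ha.trans hu.1))
        (coe_lt_of_le (hu.2.trans hb) ht₂)).neg)
      fun u hu => by
        have h1 := hneg u ⟨ha.trans hu.1.le, hu.2.le.trans hb⟩
        have h2 := h.1.r_pos u (ht₁0.trans (ha.trans hu.1.le))
          (coe_lt_of_le (hu.2.le.trans hb) ht₂)
        have := mul_pos h2 (neg_pos.2 h1)
        linarith
    linarith
  have hset : {x : ℝ | 0 < x ∧ x ≤ t₂ ∧ γ.w x = 0} =
      insert c {x : ℝ | 0 < x ∧ x ≤ t₁ ∧ γ.w x = 0} := by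
    ext x
    constructor
    · rintro ⟨h1, h2, h3⟩
      rcases le_or_gt x t₁ with hle | hgt
      · exact Or.inr ⟨h1, hle, h3⟩
      · refine Or.inl ?_
        rcases lt_trichotomy x c with hlt | heq | hlt
        · linarith [hstrict x c hgt.le hlt hc.2]
        · exact heq
        · linarith [hstrict c x hc.1 hlt h2]
    · rintro (rfl | ⟨h1, h2, h3⟩)
      · exact ⟨ht₁0.trans_lt hct, hc.2, hc0⟩
      · exact ⟨h1, h2.trans h12, h3⟩
  rw [hset, encard_insert_of_notMem fun hmem => not_lt.2 hmem.2.1 hct, hn]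
  push_cast
  rfl

/-- An increasing `w` confined to `w ≤ 1` in the asymptotically flat region converges to `1`. -/
theorem FlatTrap.tendsto {s : ℝ} (hf : FlatTrap γ s) (h : IsSolution p ⊤ γ) (hs0 : 0 ≤ s)
    (hw : ∀ x, s ≤ x → 9 / 10 ≤ γ.w x ∧ γ.w x ≤ 1) (hU : ∀ x, s ≤ x → 0 ≤ γ.U x) :
    Tendsto γ.w atTop (𝓝 1) ∧ Tendsto (fun t => γ.r t * γ.U t) atTop (𝓝 0) := by
  have dom : ∀ t : ℝ, (t : EReal) < ⊤ := EReal.coe_lt_top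
  have hwabs : ∀ x, s ≤ x → |γ.w x| ≤ 1 := fun x hx =>
    abs_le.2 ⟨by linarith [(hw x hx).1], (hw x hx).2⟩
  have hreg := fun x (hx : s ≤ x) => hf.region h hs0 hx (dom x) fun u hu => hwabs u hu.1
  have hz5 := fun x (hx : s ≤ x) => hf.rU_bound h hs0 hx (dom x) fun u hu => hwabs u hu.1
  have hz0 : ∀ x, s ≤ x → 0 ≤ γ.r x * γ.U x := fun x hx =>
    mul_nonneg (h.r_pos x (hs0.trans hx) (dom x)).le (hU x hx)
  have conv : ∀ f f' : ℝ → ℝ, (∀ x, s ≤ x → HasDerivWithinAt f (f' x) (Ici 0) x) →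
      (∀ x, s ≤ x → 0 ≤ f' x) → ∀ B, (∀ x, s ≤ x → f x ≤ B) → ∃ L, Tendsto f atTop (𝓝 L) := by
    intro f f' hd hf' B hB
    have hmono : Monotone fun x => f (max s x) := fun x y hxy =>
      le_of_hasDerivWithinAt_nonneg (hs0.trans (le_max_left _ _)) (max_le_max_left s hxy)
        (fun u hu => hd u ((le_max_left _ _).trans hu.1))
        fun u hu => hf' u ((le_max_left _ _).trans hu.1.le)
    refine ⟨_, (tendsto_atTop_ciSup hmono ⟨B, ?_⟩).congr' ?_⟩
    · rintro _ ⟨x, rfl⟩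
      exact hB _ (le_max_left _ _)
    · filter_upwards [eventually_ge_atTop s] with x hx
      rw [max_eq_right hx]
  obtain ⟨L, hL⟩ := conv γ.w _ (fun x hx => h.eq_w x (hs0.trans hx) (dom x)) hz0 1
    fun x hx => (hw x hx).2
  -- The energy `(w')² - (1 - w²)²/2` has derivative `2(2N - κ)(w')² ≥ 0`: friction has the
  -- anti-damping sign here. Its limit and that of `w` give a limit for `w' ≥ 0`.
  obtain ⟨E, hE⟩ := conv (fun x => (γ.r x * γ.U x) ^ 2 - (1 - γ.w x ^ 2) ^ 2 / 2) _
    (fun x hx => ((h.eq_rU (hs0.trans hx) (dom x)).pow 2).sub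
      (((((h.eq_w x (hs0.trans hx) (dom x)).pow 2).const_sub 1).pow 2).div_const 2))
    (fun x hx => by
      have h1 := hreg x hx
      have h2 : 0 ≤ 2 * ((2 * γ.N x - γ.κ x) * (γ.r x * γ.U x) ^ 2) :=
        mul_nonneg zero_le_two (mul_nonneg (by linarith) (sq_nonneg _))
      refine h2.trans_eq ?_
      simp only [Nat.cast_ofNat, Nat.reduceSub, pow_one, Pi.pow_apply]
      ring) 25 (fun x hx => by
      have h1 := hz5 x hx
      have h2 : (γ.r x * γ.U x) ^ 2 ≤ 5 ^ 2 := by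
        rw [← sq_abs]
        exact pow_le_pow_left₀ (abs_nonneg _) h1 2
      linarith [sq_nonneg (1 - γ.w x ^ 2)])
  obtain ⟨ℓ, hℓ⟩ : ∃ ℓ, Tendsto (fun t => γ.r t * γ.U t) atTop (𝓝 ℓ) := by
    have h1 : Tendsto (fun x => (γ.r x * γ.U x) ^ 2) atTop (𝓝 (E + (1 - L ^ 2) ^ 2 / 2)) := by
      have := hE.add ((((tendsto_const_nhds (x := (1 : ℝ))).sub (hL.pow 2)).pow 2).div_const 2)
      refine this.congr fun x => ?_
      ring
    refine ⟨_, (h1.sqrt).congr' ?_⟩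
    filter_upwards [eventually_ge_atTop s] with x hx
    exact Real.sqrt_sq (hz0 x hx)
  have hℓ0 : ℓ = 0 := by
    refine le_antisymm (le_of_not_gt fun hpos => ?_)
      (ge_of_tendsto hℓ (eventually_ge_atTop s |>.mono hz0))
    obtain ⟨t₀, ht₀⟩ := eventually_atTop.1
      ((hℓ.eventually_const_lt (half_lt_self hpos)).and (eventually_ge_atTop s))
    exact false_of_linear_growth (hs0.trans (ht₀ t₀ le_rfl).2) (half_pos hpos)
      (fun t ht => h.eq_w t (hs0.trans (ht₀ t ht).2) (dom t)) (fun t ht => (ht₀ t ht).1.le)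
      fun t ht => (hw t (ht₀ t ht).2).2
  rw [hℓ0] at hℓ
  have hL1 : 9 / 10 ≤ L := ge_of_tendsto hL ((eventually_ge_atTop s).mono fun x hx => (hw x hx).1)
  have hL2 : L ≤ 1 := le_of_tendsto hL ((eventually_ge_atTop s).mono fun x hx => (hw x hx).2)
  refine ⟨?_, hℓ⟩
  -- If `L < 1`, then `w'' → -L(1 - L²) < 0` while `w' → 0`, which would make `w'` negative.
  have hLeq : L = 1 := by
    by_contra hne
    have hlt : L < 1 := lt_of_le_of_ne hL2 hne
    have hc : 0 < L * (1 - L ^ 2) := mul_pos (by linarith) (by nlinarith)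
    have hforce : Tendsto (fun t => γ.w t * (1 - γ.w t ^ 2) - 2 * (γ.r t * γ.U t)) atTop
        (𝓝 (L * (1 - L ^ 2))) := by
      have := (hL.mul ((tendsto_const_nhds (x := (1 : ℝ))).sub (hL.pow 2))).sub (hℓ.const_mul 2)
      simpa using this
    obtain ⟨t₀, ht₀⟩ := eventually_atTop.1
      ((hforce.eventually_const_lt (half_lt_self hc)).and (eventually_ge_atTop s))
    refine false_of_linear_growth (f := fun t => -(γ.r t * γ.U t)) (B := 0)
      (hs0.trans (ht₀ t₀ le_rfl).2) (half_pos hc)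
      (fun t ht => (h.eq_rU (hs0.trans (ht₀ t ht).2) (dom t)).neg) (fun t ht => ?_)
      fun t ht => by linarith [hz0 t (ht₀ t ht).2]
    obtain ⟨h1, h2⟩ := ht₀ t ht
    have h3 := hz0 t h2
    have h4 := hreg t h2
    have h5 := h.N_le_one (hs0.trans h2) (dom t)
    have h6 : (2 * γ.N t - γ.κ t) * (γ.r t * γ.U t) ≤ 2 * (γ.r t * γ.U t) :=
      mul_le_mul_of_nonneg_right (by linarith) h3
    linarith
  rwa [hLeq] at hL

/-- The trichotomy for orbits passing through the asymptotically flat region near `w = 1`. -/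
theorem FlatTrap.trichotomy {s : ℝ} {n : ℕ} (hf : FlatTrap γ s) (h : IsOrbit p T γ)
    (hp : p ∈ admissible) (hs0 : 0 ≤ s) (hs : (s : EReal) < T)
    (hn : {x : ℝ | 0 < x ∧ x ≤ s ∧ γ.w x = 0}.encard = n) :
    p ∈ regular n ∪ escaping n ∪ escaping (n + 1) := by
  -- The fates are separated by whether `w` first turns back while still in `[9/10, 1]`; otherwise
  -- it increases for as long as it is at most `1`.
  by_cases hB : ∃ t₁ : ℝ, s ≤ t₁ ∧ (t₁ : EReal) < T ∧ γ.U t₁ < 0 ∧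
      ∀ x ∈ Icc s t₁, 9 / 10 ≤ γ.w x ∧ γ.w x ≤ 1
  · obtain ⟨t₁, h1, h2, h3, h4⟩ := hB
    exact Or.inr (hf.mem_escaping_succ h hp hs0 h1 h2 h4 h3 hn)
  push Not at hB
  have hws := hf.w_gt
  -- as long as `w ≤ 1`, it is increasing
  have hinc : ∀ t, s ≤ t → (t : EReal) < T → (∀ x ∈ Icc s t, γ.w x ≤ 1) →
      9 / 10 < γ.w t ∧ 0 ≤ γ.U t := by
    intro t hst ht hle
    have hpos := pos_of_continuous_induction (f := fun x => γ.w x - 9 / 10)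
      (((h.1.continuousOn_coord ht).2.2.1.sub continuousOn_const).mono
        (Icc_subset_Icc_left hs0)) (fun y hy hb => by
        have : γ.w s ≤ γ.w y := by
          refine le_of_hasDerivWithinAt_nonneg hs0 hy.1
            (fun u hu => h.1.eq_w u (hs0.trans hu.1) (coe_lt_of_le (hu.2.trans hy.2) ht))
            fun u hu => ?_
          have huT := coe_lt_of_le (hu.2.le.trans hy.2) ht
          refine mul_nonneg (h.1.r_pos u (hs0.trans hu.1.le) huT).le ?_
          by_contra hneg
          obtain ⟨x, hx, hx1⟩ := hB u hu.1.le huT (not_le.1 hneg)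
          have h2 := hb x ⟨hx.1, hx.2.trans_lt hu.2⟩
          exact absurd (hx1 (by linarith))
            (not_lt.2 (hle x ⟨hx.1, hx.2.trans (hu.2.le.trans hy.2)⟩))
        linarith)
    refine ⟨by linarith [hpos t (right_mem_Icc.2 hst)], ?_⟩
    by_contra hneg
    obtain ⟨x, hx, hx1⟩ := hB t hst ht (not_le.1 hneg)
    exact absurd (hx1 (by linarith [hpos x hx])) (not_lt.2 (hle x hx))
  have hposw : ∀ t, s ≤ t → (t : EReal) < T → 0 < γ.w t := by
    intro t hst ht
    by_cases hle : ∀ x ∈ Icc s t, γ.w x ≤ 1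
    · linarith [(hinc t hst ht hle).1]
    · push Not at hle
      obtain ⟨x, hx, hx1⟩ := hle
      linarith [(h.1.exit_persists hp (hs0.trans hx.1) hx.2 ht hx1).1]
  by_cases hA : ∃ t : ℝ, s ≤ t ∧ (t : EReal) < T ∧ 1 < γ.w t
  · obtain ⟨t, hst, ht, hwt⟩ := hA
    refine Or.inl (Or.inr (mem_escaping_of_exit h hp (hs0.trans hst) ht
      (lt_abs.2 (Or.inl hwt)) ?_))
    rw [encard_zeros_eq_of_pos hst fun x hx => hposw x hx.1 (coe_lt_of_le hx.2 ht), hn]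
  · push Not at hA
    have hall : ∀ t, s ≤ t → (t : EReal) < T → 9 / 10 < γ.w t ∧ 0 ≤ γ.U t := fun t hst ht =>
      hinc t hst ht fun x hx => hA x hx.1 (coe_lt_of_le hx.2 ht)
    have hT := hf.eq_top h hp hs0 hs fun x hx hxT =>
      abs_le.2 ⟨by linarith [(hall x hx hxT).1], hA x hx hxT⟩
    subst hT
    have dom : ∀ t : ℝ, (t : EReal) < ⊤ := EReal.coe_lt_top
    obtain ⟨hw1, hz⟩ := hf.tendsto h.1 hs0
      (fun x hx => ⟨(hall x hx (dom x)).1.le, hA x hx (dom x)⟩) fun x hx => (hall x hx (dom x)).2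
    refine Or.inl (Or.inl ⟨hp, γ, h, by simpa using hw1.abs, hz.congr' ?_, ?_⟩)
    · filter_upwards [eventually_gt_atTop 0] with t ht
      exact (h.1.hasDerivAt_w ht (dom t)).deriv.symm
    · rw [← hn]
      unfold numZeros
      congr 1
      ext x
      refine ⟨fun ⟨h1, h2, h3⟩ => ⟨h1, ?_, h3⟩, fun ⟨h1, h2, h3⟩ => ⟨h1, dom x, h3⟩⟩
      by_contra hgt
      exact absurd h3 (hposw x (not_le.1 hgt).le (dom x)).ne'

/-- `N` is eventually close to `1` along a regular orbit. -/
theorem IsOrbit.eventually_N_gt (h : IsOrbit p ⊤ γ) (hp : p ∈ admissible)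
    (hw : Tendsto γ.w atTop (𝓝 1)) (hw' : Tendsto (deriv γ.w) atTop (𝓝 0)) :
    ∀ᶠ t in atTop, 97 / 100 < γ.N t := by
  have hκ := h.1.kappa_tendsto (h.U_tendsto hp hw')
  obtain ⟨c, hc, hr⟩ := h.exists_r_ge hp
  have hT : Tendsto (fun t => (1 - γ.w t ^ 2) ^ 2 / c ^ 2) atTop (𝓝 0) := by
    have := (((tendsto_const_nhds (x := (1 : ℝ))).sub (hw.pow 2)).pow 2).div_const (c ^ 2)
    simpa using this
  obtain ⟨t₀, ht₀⟩ := eventually_atTop.1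
    ((((hκ.eventually_const_lt (show (1 : ℝ) / 2 < 1 by norm_num)).and
    (hκ.eventually_lt_const (show (1 : ℝ) < 101 / 100 by norm_num))).and
    (hT.eventually_lt_const (show (0 : ℝ) < 1 / 100 by norm_num))).and (eventually_ge_atTop 1))
  have ht₀0 : 0 ≤ t₀ := by linarith [(ht₀ t₀ le_rfl).2]
  -- The barrier starts at `-|N(t₀)|`. The `2` in its denominator makes its slope at most half the
  -- deficit `X`, which `κ > 1/2` covers.
  obtain ⟨C, hC⟩ : ∃ C, C = 2 * (98 / 100 + |γ.N t₀|) := ⟨_, rfl⟩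
  have hC0 : 0 ≤ C := by rw [hC]; positivity
  have hb : ∀ t, t₀ ≤ t → 98 / 100 - C / (2 + (t - t₀)) ≤ γ.N t := by
    intro t ht
    have := nonpos_of_barrier (f := fun x => 98 / 100 - C / (2 + (x - t₀)) - γ.N x)
      (K := fun _ => 0) ht₀0
      (fun x hx => ((hasDerivWithinAt_div_add C 2 t₀ x (by linarith [hx.1])).const_sub
        (98 / 100)).sub (h.1.eq_N x (ht₀0.trans hx.1) (EReal.coe_lt_top x)))
      continuousOn_const (by
        rw [hC, sub_self, add_zero]
        linarith [neg_abs_le (γ.N t₀)]) (fun x hx hpos => by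
        obtain ⟨⟨⟨h1, h2⟩, h3⟩, h4⟩ := ht₀ x hx.1.le
        have hd : 2 ≤ 2 + (x - t₀) := by linarith [hx.1]
        obtain ⟨X, hX⟩ : ∃ X, X = C / (2 + (x - t₀)) := ⟨_, rfl⟩
        have hX0 : 0 ≤ X := by rw [hX]; exact div_nonneg hC0 (by linarith)
        have hX1 : C / (2 + (x - t₀)) ^ 2 ≤ X / 2 := by
          rw [hX, div_div]
          exact div_le_div_of_nonneg_left hC0 (by linarith) (by nlinarith)
        rw [← hX] at hpos
        have h5 : γ.κ x * γ.N x ≤ γ.κ x * (98 / 100 - X) :=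
          mul_le_mul_of_nonneg_left (by linarith) (by linarith)
        have h6 : X / 2 ≤ γ.κ x * X := by
          have := mul_le_mul_of_nonneg_right h1.le hX0
          linarith
        have h7 : (1 - γ.w x ^ 2) ^ 2 / γ.r x ^ 2 ≤ 1 / 100 := by
          refine le_trans ?_ h3.le
          exact div_le_div_of_nonneg_left (sq_nonneg _) (by positivity)
            (pow_le_pow_left₀ hc.le (hr x h4) 2)
        rw [neg_div]
        nlinarith) t (right_mem_Icc.2 ht)
    linarith
  have h2 : Tendsto (fun t => 98 / 100 - C / (2 + (t - t₀))) atTop (𝓝 (98 / 100)) := by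
    simpa using (tendsto_const_nhds (x := (98 : ℝ) / 100)).sub (div_one_add_tendsto C 2 t₀)
  filter_upwards [h2.eventually_const_lt (show (97 : ℝ) / 100 < 98 / 100 by norm_num),
    eventually_ge_atTop t₀] with t ht ht'
  exact ht.trans_le (hb t ht')

/-- A regular orbit with `w → 1` enters the asymptotically flat region. -/
theorem IsOrbit.exists_flatTrap (h : IsOrbit p ⊤ γ) (hp : p ∈ admissible)
    (hw : Tendsto γ.w atTop (𝓝 1)) (hw' : Tendsto (deriv γ.w) atTop (𝓝 0)) :
    ∃ s, 0 ≤ s ∧ FlatTrap γ s ∧ ∀ t, s ≤ t → 0 < γ.w t := by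
  have hκ := h.1.kappa_tendsto (h.U_tendsto hp hw')
  have hz := (h.1.rU_tendsto hw').abs
  rw [abs_zero] at hz
  obtain ⟨c, hc, hr⟩ := h.exists_r_ge hp
  obtain ⟨t₀, ht₀⟩ := eventually_atTop.1
    ((((((hκ.eventually_const_lt (show (99 : ℝ) / 100 < 1 by norm_num)).and
    (hκ.eventually_lt_const (show (1 : ℝ) < 101 / 100 by norm_num))).and
    (hz.eventually_lt_const one_pos)).and
    (hw.eventually_const_lt (show (95 : ℝ) / 100 < 1 by norm_num))).and
    (h.eventually_N_gt hp hw hw')).and (eventually_ge_atTop 1))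
  have ht₀1 : 1 ≤ t₀ := (ht₀ t₀ le_rfl).2
  -- As `r' = rN` with `r` bounded below and `N` near `1`, the radius grows at least linearly and
  -- passes `100`.
  obtain ⟨s, hs, hrs⟩ : ∃ s, t₀ ≤ s ∧ 100 < γ.r s := by
    by_contra! hcon
    refine false_of_linear_growth (f := γ.r) (c := c * (97 / 100)) (by linarith)
      (by positivity) (fun t ht => h.1.eq_r t (by linarith) (EReal.coe_lt_top t)) (fun t ht => ?_)
      hcon
    exact mul_le_mul (hr t (ht₀1.trans ht)) (ht₀ t ht).1.2.le (by norm_num)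
      (hc.le.trans (hr t (ht₀1.trans ht)))
  obtain ⟨⟨⟨⟨⟨h1, h2⟩, h3⟩, h4⟩, h5⟩, h6⟩ := ht₀ s hs
  refine ⟨s, by linarith, ⟨hrs, h5, h1, h2, h3, h4⟩, fun t ht => ?_⟩
  linarith [(ht₀ t (hs.trans ht)).1.1.2]

theorem eventually_regular_of_tendsto_one {r0 : ℝ} {x0 : ℝ × ℝ} {n : ℕ}
    (hp : (r0, x0.1, x0.2) ∈ admissible) (hne : x0 ≠ 0) (h : IsOrbit (r0, x0.1, x0.2) ⊤ γ)
    (hw : Tendsto γ.w atTop (𝓝 1)) (hw' : Tendsto (deriv γ.w) atTop (𝓝 0))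
    (hn : numZeros ⊤ γ = n) :
    ∀ᶠ y in 𝓝 x0, y ∈ slice admissible r0 → (x0.1 = 0 → y.1 = 0) →
      y ∈ slice (regular n ∪ escaping n ∪ escaping (n + 1)) r0 := by
  obtain ⟨s, hs0, hf, hpos⟩ := h.exists_flatTrap hp hw hw'
  have hsT : (s : EReal) < ⊤ := EReal.coe_lt_top s
  have hn' : {x : ℝ | 0 < x ∧ x ≤ s ∧ γ.w x = 0}.encard = n := by
    rw [← hn]
    unfold numZeros
    congr 1
    ext x
    refine ⟨fun ⟨h1, h2, h3⟩ => ⟨h1, EReal.coe_lt_top x, h3⟩, fun ⟨h1, h2, h3⟩ => ⟨h1, ?_, h3⟩⟩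
    by_contra hgt
    exact absurd h3 (hpos x (not_le.1 hgt).le).ne'
  have hopen : IsOpen {x : Phase | 100 < x 0 ∧ 97 / 100 < x 1 ∧ 99 / 100 < x 4 ∧
      x 4 < 101 / 100 ∧ |x 0 * x 3| < 1 ∧ 95 / 100 < x 2} := by
    have c : ∀ i : Fin 6, Continuous fun x : Phase => x i := continuous_apply
    exact (isOpen_lt continuous_const (c 0)).inter ((isOpen_lt continuous_const (c 1)).inter
      ((isOpen_lt continuous_const (c 4)).inter ((isOpen_lt (c 4) continuous_const).inter
      ((isOpen_lt ((c 0).mul (c 3)).abs continuous_const).inter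
      (isOpen_lt continuous_const (c 2))))))
  filter_upwards [h.1.eventually_state_mem hs0 hsT hopen
    ⟨hf.r_gt, hf.N_gt, hf.kappa_gt, hf.kappa_lt, hf.rU_lt, hf.w_gt⟩,
    h.1.eventually_encard_zeros hne hs0 hsT (hpos s le_rfl).ne'] with y hy1 hy2 hadm hy0
  obtain ⟨T', γ', hγ'⟩ := exists_isOrbit (p := (r0, y.1, y.2)) hadm.1
  obtain ⟨hT', h1, h2, h3, h4, h5, h6⟩ := hy1 T' γ' hγ'
  exact FlatTrap.trichotomy ⟨h1, h2, h3, h4, h5, h6⟩ hγ' hadm hs0 hT'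
    ((hy2 hy0 T' γ' hγ').2.trans hn')

theorem escaping_of_reflect {n : ℕ} (h : reflectData p ∈ escaping n) : p ∈ escaping n := by
  obtain ⟨hp, ρend, γ, hsing, ⟨s, hs0, hs, hw⟩, hn⟩ := h
  have hp' := reflectData_mem_admissible hp
  have hγ := hsing.1.reflect
  rw [reflectData_reflectData] at hp' hγ
  refine ⟨hp', ρend, γ.reflect, ⟨hγ, hsing.2.1, hsing.2.2⟩, ⟨s, hs0, hs, ?_⟩, ?_⟩
  · simpa [PhaseCurve.reflect] using hw
  · rw [numZeros_reflect, hn]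

theorem deriv_reflect_w (γ : PhaseCurve) : deriv γ.reflect.w = fun t => -deriv γ.w t := by
  funext t
  exact deriv.fun_neg

theorem regular_of_reflect {n : ℕ} (h : reflectData p ∈ regular n) : p ∈ regular n := by
  obtain ⟨hp, γ, hγ, hw, hw', hn⟩ := h
  have hp' := reflectData_mem_admissible hp
  have hγ' := hγ.reflect
  rw [reflectData_reflectData] at hp' hγ'
  refine ⟨hp', γ.reflect, hγ', ?_, ?_, ?_⟩
  · simpa [PhaseCurve.reflect] using hw
  · rw [deriv_reflect_w]
    simpa using hw'.neg
  · rw [numZeros_reflect, hn]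

/-- If `|w| → 1` along a global orbit, then `w → 1` or `w → -1`. -/
theorem IsSolution.tendsto_or_of_abs (h : IsSolution p ⊤ γ)
    (hw : Tendsto (fun t => |γ.w t|) atTop (𝓝 1)) :
    Tendsto γ.w atTop (𝓝 1) ∨ Tendsto (fun t => -γ.w t) atTop (𝓝 1) := by
  obtain ⟨t₀, ht₀⟩ := eventually_atTop.1
    ((hw.eventually_const_lt (show (0 : ℝ) < 1 by norm_num)).and (eventually_ge_atTop 0))
  have h0 := (ht₀ t₀ le_rfl).2
  have hne : ∀ t, t₀ ≤ t → γ.w t ≠ 0 := fun t ht => abs_pos.1 (ht₀ t ht).1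
  have hc : ∀ t, t₀ ≤ t → ContinuousOn γ.w (Icc t₀ t) := fun t ht =>
    (h.continuousOn_coord (EReal.coe_lt_top t)).2.2.1.mono (Icc_subset_Icc_left h0)
  rcases lt_or_gt_of_ne (hne t₀ le_rfl) with hneg | hpos
  · right
    refine hw.congr' ?_
    filter_upwards [eventually_ge_atTop t₀] with t ht
    refine abs_of_nonpos (le_of_not_gt fun hgt => ?_)
    obtain ⟨c, hc1, hc2⟩ := intermediate_value_Icc ht (hc t ht)
      (show (0 : ℝ) ∈ Icc (γ.w t₀) (γ.w t) from ⟨hneg.le, hgt.le⟩)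
    exact hne c hc1.1 hc2
  · left
    refine hw.congr' ?_
    filter_upwards [eventually_ge_atTop t₀] with t ht
    refine abs_of_nonneg (le_of_not_gt fun hlt => ?_)
    obtain ⟨c, hc1, hc2⟩ := intermediate_value_Icc' ht (hc t ht)
      (show (0 : ℝ) ∈ Icc (γ.w t) (γ.w t₀) from ⟨hlt.le, hpos.le⟩)
    exact hne c hc1.1 hc2

theorem eventually_regular {r0 : ℝ} {x0 : ℝ × ℝ} {n : ℕ}
    (hx0 : x0 ∈ slice (regular n) r0 \ {0}) :
    ∀ᶠ y in 𝓝 x0, y ∈ slice admissible r0 → (x0.1 = 0 → y.1 = 0) →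
      y ∈ slice (regular n ∪ escaping n ∪ escaping (n + 1)) r0 := by
  obtain ⟨⟨hp, γ, h, hw, hw', hn⟩, hne⟩ := hx0
  have hne0 : x0 ≠ 0 := hne
  rcases h.1.tendsto_or_of_abs hw with hw1 | hw1
  · exact eventually_regular_of_tendsto_one hp hne0 h hw1 hw' hn
  · have key := eventually_regular_of_tendsto_one (x0 := -x0) (n := n) (γ := γ.reflect)
      (reflectData_mem_admissible hp) (neg_ne_zero.2 hne0) h.reflect hw1
      (by rw [deriv_reflect_w]; simpa using hw'.neg) (by rw [numZeros_reflect, hn])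
    have key' := (continuous_neg.tendsto x0).eventually key
    filter_upwards [key'] with y hy hadm hy0
    have := hy (reflectData_mem_admissible hadm) (fun h0 => by
      have h1 : x0.1 = 0 := by simpa using h0
      simp [hy0 h1])
    rcases this with (h1 | h1) | h1
    · exact Or.inl (Or.inl (regular_of_reflect h1))
    · exact Or.inl (Or.inr (escaping_of_reflect h1))
    · exact Or.inr (escaping_of_reflect h1)

end Regular

end HauntedEYM

theorem mainTheorem3 (r0 : ℝ) (hr0 : 0 < r0) (x0 : ℝ × ℝ)
    (hx0 : x0 ∈ HauntedEYM.slice HauntedEYM.admissible r0) :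
    -- (i) escaping and crashing orbits
    (∀ n : ℕ, x0 ∈ HauntedEYM.slice (HauntedEYM.escaping n) r0 →
      HauntedEYM.SlicesEventuallySubset r0 x0 (HauntedEYM.slice (HauntedEYM.escaping n) r0)) ∧
    (x0 ∈ HauntedEYM.slice HauntedEYM.crashing r0 \ {0} →
      HauntedEYM.SlicesEventuallySubset r0 x0
        (HauntedEYM.slice HauntedEYM.crashing r0 \ {0})) ∧
    -- (ii) oscillatory orbits
    (x0 ∈ HauntedEYM.slice HauntedEYM.oscillatory r0 →
      ∀ n : ℕ, ∃ δ : ℝ, 0 < δ ∧ ∀ y0 ∈ HauntedEYM.slice HauntedEYM.admissible r0,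
        0 < Real.sqrt ((y0.1 - x0.1) ^ 2 + (y0.2 - x0.2) ^ 2) →
        Real.sqrt ((y0.1 - x0.1) ^ 2 + (y0.2 - x0.2) ^ 2) ≤ δ →
        ∃ (T : EReal) (γ : HauntedEYM.PhaseCurve),
          HauntedEYM.IsOrbit (r0, y0.1, y0.2) T γ ∧ (n : ℕ∞) ≤ HauntedEYM.numZeros T γ) ∧
    -- (iii) regular orbits
    (∀ n : ℕ, x0 ∈ HauntedEYM.slice (HauntedEYM.regular n) r0 \ {0} →
      HauntedEYM.SlicesEventuallySubset r0 x0
        (HauntedEYM.slice (HauntedEYM.regular n ∪ HauntedEYM.escaping n ∪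
          HauntedEYM.escaping (n + 1)) r0)) := by
  refine ⟨fun n hn => ?_, fun hc => ?_, fun ho n => ?_, fun n hr => ?_⟩
  · exact HauntedEYM.slicesEventuallySubset_of_eventually (HauntedEYM.eventually_escaping hn)
  · refine HauntedEYM.slicesEventuallySubset_of_eventually ?_
    filter_upwards [HauntedEYM.eventually_crashing hc] with y hy hadm _
    exact hy hadm
  · obtain ⟨δ, hδ, hball⟩ := Metric.eventually_nhds_iff.1 (HauntedEYM.oscillatory_nearby ho n)
    refine ⟨δ / 2, by linarith, fun y hy _ hle => hball ?_ hy⟩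
    -- The Euclidean distance in the statement dominates each coordinate, hence the sup distance on
    -- the product.
    have h1 : |y.1 - x0.1| ≤ δ / 2 := (Real.abs_le_sqrt (by nlinarith)).trans hle
    have h2 : |y.2 - x0.2| ≤ δ / 2 := (Real.abs_le_sqrt (by nlinarith)).trans hle
    rw [Prod.dist_eq]
    exact max_lt (lt_of_le_of_lt h1 (by linarith)) (lt_of_le_of_lt h2 (by linarith))
  · exact HauntedEYM.slicesEventuallySubset_of_eventually (HauntedEYM.eventually_regular hr)
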